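/- **Dictionary of parabolic Mellin transforms.** For $\sigma>0$, a weight $f$ and $z\in\mathbb C$ put $$\mathcal P_\sigma[f](z)=\int_{-\infty}^{\infty}w^{2z}f(w^2)\,dt,\qquad w=\sigma+it,$$ with principal branches, and throughout let $s=z+\tfrac12$. "$\mathcal P_\sigma[f](z)=c$" means that the integral converges absolutely and equals $c$. Let $\mathcal P_0[f](z)=\lim_{\sigma\downarrow0}\mathcal P_\sigma[f](z)$ (boundary transform; the integrals converge absolutely for all small $\sigma>0$ and the limit exists). Let $G(z)$, $R(z)$, $D(z)$, $R(z,a)$ be the transforms of $e^u$, $\frac{e^u}{1-e^u}$, $\frac{e^u}{1+e^u}$, $\frac{e^{au}}{1-e^u}$ ($a>0$) along any line with, respectively, $\sigma>0$, $0<\sigma<\sqrt\pi$, $0<\sigma<\sqrt{\pi/2}$, $0<\sigma<\sqrt\pi$; these integrals converge absolutely for all $z\in\mathbb C$ and do not depend on the choice of such $\sigma$. Then: 1. *Gaussian.* For all $z$: $G(z)=\pi/\Gamma(1-s)$ (understood as $0$ at the poles of $\Gamma(1-s)$), and $G(z)=\cos(\pi z)\Gamma(s)$ if $s\notin\{0,-1,-2,\dots\}$.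 2. *Rational.* For $0<\sigma<1$ and $\operatorname{Re}z<\frac12$: $\mathcal P_\sigma[\frac1{1-u}](z)=\pi$; its analytic continuation to $z\in\mathbb C$ is the constant $\pi$. 3. *Scaled Gaussian.* For $\operatorname{Re}\alpha>0$, $\sigma>0$, all $z$: $\mathcal P_\sigma[e^{\alpha u}](z)=\alpha^{-s}G(z)$. 4. *Perturbed exponential.* For $\operatorname{Re}\lambda>0$, $\sigma>0$, all $z$: $\mathcal P_\sigma[e^{u/2-\lambda\sqrt u}](z)=\sqrt{2\pi}\,e^{-\lambda^2/4}D_{2z}(\lambda)$, where $D_\nu$ is the parabolic cylinder function $$D_\nu(x)=2^{\nu/2}e^{-x^2/4}\Big[\tfrac{\sqrt\pi}{\Gamma((1-\nu)/2)}\,{}_1F_1(-\tfrac\nu2;\tfrac12;\tfrac{x^2}2)-\tfrac{\sqrt{2\pi}\,x}{\Gamma(-\nu/2)}\,{}_1F_1(\tfrac{1-\nu}2;\tfrac32;\tfrac{x^2}2)\Big].$$ 5. *Incomplete Gamma.* For $\operatorname{Re}\nu>0$, $\operatorname{Re}\lambda>0$ and $\operatorname{Re}s>0$: $\mathcal P_0[\Gamma(\nu,-\lambda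 u)](z)=G(z)\lambda^{-s}\frac{\Gamma(\nu+s)}{\Gamma(s+1)}$, with $\Gamma(\nu,x)=\int_x^{\infty}r^{\nu-1}e^{-r}dr$ the principal upper incomplete Gamma function. The right side is its analytic continuation to $\{z:\nu+s\notin\{0,-1,-2,\dots\}\}$. 6. *Monomial.* For integers $k\ge0$, $\sigma>0$, all $z$: $\mathcal P_\sigma[u^ke^u](z)=G(z+k)$. 7. *Log-Gaussian.* $G$ is entire, and for $\sigma>0$ and all $z$: $\mathcal P_\sigma[e^u\log u](z)=G'(z)$. If $\cos(\pi z)\ne0$, then $G'(z)=G(z)\,(\psi(s)-\pi\tan(\pi z))$, with $\psi=\Gamma'/\Gamma$. 8. *Geometric, alternating, Hurwitz.* $R(z)=G(z)\zeta(s)$ for $s\ne1$; $D(z)=G(z)\eta(s)$ for all $z$; $R(z,a)=G(z)\zeta(s,a)$ for $a>0$, $s\ne1$. Here $\eta(s)=\sum_{n\ge1}(-1)^{n-1}n^{-s}$ and $\zeta(s,a)=\sum_{n\ge0}(n+a)^{-s}$, analytically continued. 9. *Dirichlet $L$.* Let $\chi$ be a Dirichlet character and $k\ge1$ an integer, and let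 $f(u)$ be $\sum_{n\ge1}\chi(n)e^{nu}n^{-k}$ for $\operatorname{Re}u<0$, continued analytically as a function of $x=e^u$ to the complement of the radial cuts $x^q\in[1,\infty)$, $q$ being the modulus of $\chi$. For $\operatorname{Re}s>0$: $\mathcal P_0[f](z)=G(z)L(s+k,\chi)$. The right side is its analytic continuation to all $z$ (to $s+k\ne1$ if $\chi$ is principal). 10. *Fresnel sine and cosine* (Abel limits). Let $f=\sin$ and $c(z)=-G(z)\sin(\frac\pi2s)$, or $f=\cos$ and $c(z)=G(z)\cos(\frac\pi2s)$. For all $z$, $\lim_{\varepsilon\downarrow0}\mathcal P_0[e^{\varepsilon u}f(u)](z)=c(z)$. Also $\lim_{\varepsilon\downarrow0}\mathcal P_\sigma[e^{\varepsilon u}f(u)](z)=c(z)$ for each fixed $\sigma>0$ and all $z$; and, if $\operatorname{Re}s>0$, $\lim_{\varepsilon\downarrow0}\int_{-\infty}^\infty(it)^{2z}e^{-\varepsilon t^2}f(-t^2)\,dt=c(z)$. For each $\varepsilon>0$ the regularized integrals converge absolutely. 11. *Polylogarithms.* Let $k\ge1$ be an integer and $\operatorname{Li}_k$ the principal branch on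 $\mathbb C\setminus[1,\infty)$. (a) For $\operatorname{Re}s>0$: $\mathcal P_0[\operatorname{Li}_k(e^u)](z)=G(z)\zeta(s+k)$, and the right side is its analytic continuation to $s\ne1-k$. If $s\notin\{0,-1,\dots,-(k-1)\}$, then $G(z)\zeta(s+k)=\dfrac{R(z+k)}{(-1)^ks(s+1)\cdots(s+k-1)}$. (b) For all $z$: $\mathcal P_0[\operatorname{Li}_k(-e^u)](z)=-G(z)\eta(s+k)$. (c) For $\operatorname{Re}s>0$: $\mathcal P_0[e^{iu}\operatorname{Li}_k(e^u)](z)=G(z)\sum_{n\ge1}\frac1{n^k(n+i)^s}$. This function continues to a meromorphic function on $\mathbb C$, analytic off $s\in\{1-k,-k,-k-1,\dots\}$, and it is given by the same formula (with a convergent series) for $\operatorname{Re}s>1-k$. -/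

import Mathlib

open Filter Topology MeasureTheory Set

noncomputable section

/-! ### The parabolic Mellin transform -/

/-- The integrand `w ^ (2z) * f (w ^ 2)` at the point `w = σ + it` (principal branch of the power). -/
def pmtIntegrand (σ : ℝ) (f : ℂ → ℂ) (z : ℂ) (t : ℝ) : ℂ :=
  ((σ : ℂ) + t * Complex.I) ^ (2 * z) * f (((σ : ℂ) + t * Complex.I) ^ 2)

/-- The parabolic Mellin transform along the line `w = σ + it`. -/
def pmt (σ : ℝ) (f : ℂ → ℂ) (z : ℂ) : ℂ := ∫ t : ℝ, pmtIntegrand σ f z t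

/-- The transform along `w = σ + it` converges absolutely and has the value `c`. -/
def HasPMT (σ : ℝ) (f : ℂ → ℂ) (z c : ℂ) : Prop :=
  Integrable (pmtIntegrand σ f z) ∧ pmt σ f z = c

/-- The boundary transform: the limit of the transforms along `w = σ + it` as `σ ↓ 0`
exists and equals `c`. -/
def HasBoundaryPMT (f : ℂ → ℂ) (z c : ℂ) : Prop :=
  (∀ᶠ σ in 𝓝[>] (0 : ℝ), Integrable (pmtIntegrand σ f z)) ∧
    Tendsto (fun σ : ℝ => pmt σ f z) (𝓝[>] 0) (𝓝 c)

/-- The weight `f` with the Abel factor `e ^ (ε u)`. -/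
def abelWeight (ε : ℝ) (f : ℂ → ℂ) (u : ℂ) : ℂ := Complex.exp (ε * u) * f u

/-- The Abel limit (`ε ↓ 0`) of the regularized transforms along the fixed line `w = σ + it`. -/
def HasAbelPMT (σ : ℝ) (f : ℂ → ℂ) (z c : ℂ) : Prop :=
  (∀ ε : ℝ, 0 < ε → Integrable (pmtIntegrand σ (abelWeight ε f) z)) ∧
    Tendsto (fun ε : ℝ => pmt σ (abelWeight ε f) z) (𝓝[>] 0) (𝓝 c)

/-- The Abel limit (`ε ↓ 0`) of the boundary transforms (`σ ↓ 0`) of the regularized weights. -/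
def HasAbelBoundaryPMT (f : ℂ → ℂ) (z c : ℂ) : Prop :=
  ∃ h : ℝ → ℂ, (∀ ε : ℝ, 0 < ε → HasBoundaryPMT (abelWeight ε f) z (h ε)) ∧
    Tendsto h (𝓝[>] 0) (𝓝 c)

/-- `F` is the analytic continuation to the connected open set `U` of the function which is given on
the nonempty open set `D` by the transform `P` (`P z c`: the transform exists at `z`, with value
`c`). By the identity theorem `P`, `D` and `U` determine `F` on `U`. -/
structure ContinuesTransform (P : ℂ → ℂ → Prop) (D U : Set ℂ) (F : ℂ → ℂ) : Prop where
  isOpen_dom : IsOpen D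
  nonempty_dom : D.Nonempty
  subset : D ⊆ U
  isOpen : IsOpen U
  isPreconnected : IsPreconnected U
  eq_transform : ∀ z ∈ D, P z (F z)
  differentiableOn : DifferentiableOn ℂ F U

/-! ### The functions `G`, `R` and `D`

The line used in each definition is one of the admissible lines (`0 < σ`, `0 < σ < √π` and
`0 < σ < √(π / 2)`, respectively). -/

def pmtG (z : ℂ) : ℂ := pmt 1 Complex.exp z

def hurwitzWeight (a : ℝ) (u : ℂ) : ℂ := Complex.exp (a * u) / (1 - Complex.exp u)

def zetaWeight (u : ℂ) : ℂ := Complex.exp u / (1 - Complex.exp u)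

def etaWeight (u : ℂ) : ℂ := Complex.exp u / (1 + Complex.exp u)

def pmtRa (z : ℂ) (a : ℝ) : ℂ := pmt 1 (hurwitzWeight a) z

def pmtR (z : ℂ) : ℂ := pmt 1 zetaWeight z

def pmtD (z : ℂ) : ℂ := pmt 1 etaWeight z

/-! ### Special functions -/

/-- Kummer's function `₁F₁(a; b; x)`, for `b` not a nonpositive integer. -/
def kummerM (a b x : ℂ) : ℂ := Complex.Gamma b * Complex.regularizedHGFun {a} {b} x

theorem hasSum_kummerM (a b x : ℂ) (hb : ∀ m : ℕ, b ≠ -m) :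
    HasSum (fun n : ℕ => (ascPochhammer ℂ n).eval a / (ascPochhammer ℂ n).eval b * x ^ n /
      (n.factorial : ℂ)) (kummerM a b x) := by
  have hΓ : ∀ n : ℕ, Complex.Gamma (b + n) = (ascPochhammer ℂ n).eval b * Complex.Gamma b := by
    intro n
    induction n with
    | zero => simp
    | succ n ih =>
      have h0 : b + n ≠ 0 := fun h => hb n (eq_neg_of_add_eq_zero_left h)
      rw [Nat.cast_succ, ← add_assoc, Complex.Gamma_add_one _ h0, ih, ascPochhammer_succ_eval]
      ring
  have hb0 : Complex.Gamma b ≠ 0 := Complex.Gamma_ne_zero hb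
  have hrad : (Complex.regularizedHGFunSeries {a} {b}).radius = ⊤ :=
    Complex.radius_regularizedHGFunSeries_eq_top (by simp)
  have h := (Complex.regularizedHGFunSeries {a} {b}).hasSum (x := x) (by simp [hrad])
  have h2 := h.mul_left (Complex.Gamma b)
  refine h2.congr_fun fun n => ?_
  have hP : (ascPochhammer ℂ n).eval b ≠ 0 := by
    intro h0
    have h3 := hΓ n
    rw [h0, zero_mul] at h3
    refine Complex.Gamma_ne_zero (s := b + n) (fun m hm => hb (m + n) ?_) h3
    push_cast
    linear_combination hm
  have hf : (n.factorial : ℂ) ≠ 0 := by exact_mod_cast n.factorial_ne_zero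
  simp only [Complex.regularizedHGFunSeries, FormalMultilinearSeries.ofScalars_apply_eq,
    Complex.regularizedHGFunCoeff, Multiset.map_singleton, Multiset.prod_singleton, hΓ n,
    smul_eq_mul]
  field_simp

/-- The parabolic cylinder function `D_ν(x)` (Whittaker's notation). -/
def parabolicCylinderD (ν x : ℂ) : ℂ :=
  (2 : ℂ) ^ (ν / 2) * Complex.exp (-x ^ 2 / 4) *
    ((√Real.pi : ℂ) / Complex.Gamma ((1 - ν) / 2) * kummerM (-ν / 2) (1 / 2) (x ^ 2 / 2) -
      (√(2 * Real.pi) : ℂ) * x / Complex.Gamma (-ν / 2) *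
        kummerM ((1 - ν) / 2) (3 / 2) (x ^ 2 / 2))

/-- The (principal) upper incomplete Gamma function `Γ(ν, x) = ∫_x^∞ r ^ (ν - 1) e ^ (-r) dr`,
integrated along the horizontal ray from `x` to `+∞`; for `Re ν > 0`. -/
def upperGamma (ν x : ℂ) : ℂ :=
  ∫ r in Ioi (0 : ℝ), (x + r) ^ (ν - 1) * Complex.exp (-(x + r))

/-- For `c : ℕ → ℂ` of period `q ≥ 1` and `k ≥ 1`: the series `∑_{n ≥ 1} c n x ^ n / n ^ k`, continued
analytically from `‖x‖ < 1` to all `x` with `x ^ q` outside the cut `[1, ∞)`, as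
`(1 / Γ(k)) ∫_0^∞ r ^ (k - 1) g (x e ^ (-r)) dr`, where the rational function
`g y = (∑_{n = 1}^q c n y ^ n) / (1 - y ^ q)` is the sum of the series `∑_{n ≥ 1} c n y ^ n`. -/
def periodicPolylog (c : ℕ → ℂ) (q k : ℕ) (x : ℂ) : ℂ :=
  1 / ((k - 1).factorial : ℂ) * ∫ r in Ioi (0 : ℝ), (r : ℂ) ^ (k - 1) *
    ((∑ n ∈ Finset.range q, c (n + 1) * (x * Complex.exp (-r)) ^ (n + 1)) /
      (1 - (x * Complex.exp (-r)) ^ q))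

theorem hasSum_periodicPolylog {c : ℕ → ℂ} {q k : ℕ} (hq : 1 ≤ q) (hc : ∀ n, c (n + q) = c n)
    (hk : 1 ≤ k) {x : ℂ} (hx : ‖x‖ < 1) :
    HasSum (fun n : ℕ => c (n + 1) * x ^ (n + 1) / ((n + 1 : ℕ) : ℂ) ^ k)
      (periodicPolylog c q k x) := by
  have hk0 : (0 : ℝ) < k := by exact_mod_cast hk
  have hnorm : ∀ r ∈ Ioi (0 : ℝ), ‖x * Complex.exp (-r)‖ < 1 := by
    intro r hr
    have h1 : ‖Complex.exp (-(r : ℂ))‖ ≤ 1 := by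
      rw [Complex.norm_exp]; simpa using (mem_Ioi.1 hr).le
    rw [norm_mul]
    nlinarith [norm_nonneg x, norm_nonneg (Complex.exp (-(r : ℂ)))]
  obtain ⟨C, hC⟩ : ∃ C : ℝ, ∀ n, ‖c n‖ ≤ C := by
    refine ⟨∑ i ∈ Finset.range q, ‖c i‖, fun n => ?_⟩
    have hn : c n = c (n % q) := (Function.Periodic.map_mod_nat (f := c) hc n).symm
    rw [hn]
    exact Finset.single_le_sum (f := fun i => ‖c i‖) (fun i _ => norm_nonneg _)
      (Finset.mem_range.2 (Nat.mod_lt _ hq))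
  have hC0 : 0 ≤ C := (norm_nonneg _).trans (hC 0)
  have hgeom : ∀ y : ℂ, ‖y‖ < 1 → HasSum (fun n : ℕ => c (n + 1) * y ^ (n + 1))
      ((∑ n ∈ Finset.range q, c (n + 1) * y ^ (n + 1)) / (1 - y ^ q)) := by
    intro y hy
    have hs : Summable (fun n : ℕ => c (n + 1) * y ^ (n + 1)) := by
      refine Summable.of_norm_bounded (g := fun n : ℕ => C * ‖y‖ ^ (n + 1)) ?_ ?_
      · exact ((summable_nat_add_iff 1).2
          (summable_geometric_of_lt_one (norm_nonneg y) hy)).mul_left C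
      · intro n
        rw [norm_mul, norm_pow]
        exact mul_le_mul_of_nonneg_right (hC _) (by positivity)
    have h1 : 1 - y ^ q ≠ 0 := by
      intro h
      have h2 : ‖y ^ q‖ < 1 := by
        rw [norm_pow]; exact pow_lt_one₀ (norm_nonneg _) hy (by omega)
      rw [← sub_eq_zero.1 h] at h2
      simp at h2
    have h3 := hs.sum_add_tsum_nat_add q
    have h4 : ∑' n : ℕ, c (n + q + 1) * y ^ (n + q + 1) =
        y ^ q * ∑' n : ℕ, c (n + 1) * y ^ (n + 1) := by
      rw [← tsum_mul_left]
      refine tsum_congr fun n => ?_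
      rw [show n + q + 1 = (n + 1) + q by ring, hc, pow_add]
      ring
    rw [h4] at h3
    convert hs.hasSum using 1
    rw [div_eq_iff h1]
    linear_combination h3
  have hint : ∀ n : ℕ, ∫ r in Ioi (0 : ℝ), r ^ (k - 1) * Real.exp (-((n + 1 : ℕ) * r)) =
      (k - 1).factorial / ((n + 1 : ℕ) : ℝ) ^ k := by
    intro n
    have h := Real.integral_rpow_mul_exp_neg_mul_Ioi (a := k) (r := (n + 1 : ℕ)) hk0
      (by positivity)
    have hG : Real.Gamma k = (k - 1).factorial := by
      conv_lhs => rw [show (k : ℝ) = ((k - 1 : ℕ) : ℝ) + 1 by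
        rw [Nat.cast_sub hk]; simp]
      exact Real.Gamma_nat_eq_factorial _
    rw [hG, Real.rpow_natCast] at h
    rw [show ((k - 1).factorial : ℝ) / ((n + 1 : ℕ) : ℝ) ^ k =
      (1 / ((n + 1 : ℕ) : ℝ)) ^ k * (k - 1).factorial by rw [div_pow, one_pow]; ring, ← h]
    refine setIntegral_congr_fun measurableSet_Ioi fun r _ => ?_
    rw [← Real.rpow_natCast r (k - 1), Nat.cast_sub hk, Nat.cast_one]
  have hintble : ∀ n : ℕ, IntegrableOn
      (fun r : ℝ => r ^ (k - 1) * Real.exp (-((n + 1 : ℕ) * r))) (Ioi 0) := by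
    intro n
    refine not_imp_comm.1 integral_undef ?_
    rw [hint n]
    positivity
  have hnormF : ∀ (n : ℕ), ∀ r ∈ Ioi (0 : ℝ),
      (r : ℂ) ^ (k - 1) * (c (n + 1) * (x * Complex.exp (-r)) ^ (n + 1)) =
      (c (n + 1) * x ^ (n + 1)) * ((r ^ (k - 1) * Real.exp (-((n + 1 : ℕ) * r)) : ℝ) : ℂ) := by
    intro n r _
    rw [mul_pow, ← Complex.exp_nat_mul]
    push_cast
    ring_nf
  have key := hasSum_integral_of_summable_integral_norm (μ := volume.restrict (Ioi (0 : ℝ)))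
    (F := fun (n : ℕ) (r : ℝ) =>
      (c (n + 1) * x ^ (n + 1)) * ((r ^ (k - 1) * Real.exp (-((n + 1 : ℕ) * r)) : ℝ) : ℂ))
    (fun n => ((hintble n).ofReal).const_mul _) ?_
  · have hval : ∀ n : ℕ, ∫ r in Ioi (0 : ℝ), (c (n + 1) * x ^ (n + 1)) *
        ((r ^ (k - 1) * Real.exp (-((n + 1 : ℕ) * r)) : ℝ) : ℂ) =
        ((k - 1).factorial : ℂ) * (c (n + 1) * x ^ (n + 1) / ((n + 1 : ℕ) : ℂ) ^ k) := by
      intro n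
      rw [integral_const_mul, integral_complex_ofReal, hint n]
      push_cast
      ring
    simp only [hval] at key
    have hf : ((k - 1).factorial : ℂ) ≠ 0 := by exact_mod_cast (k - 1).factorial_ne_zero
    have key2 := key.mul_left (1 / ((k - 1).factorial : ℂ))
    have hsum : periodicPolylog c q k x = 1 / ((k - 1).factorial : ℂ) * ∫ r in Ioi (0 : ℝ),
        ∑' n : ℕ, (c (n + 1) * x ^ (n + 1)) *
          ((r ^ (k - 1) * Real.exp (-((n + 1 : ℕ) * r)) : ℝ) : ℂ) := by
      unfold periodicPolylog
      congr 1
      refine setIntegral_congr_fun measurableSet_Ioi fun r hr => ?_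
      rw [← ((hgeom _ (hnorm r hr)).mul_left ((r : ℂ) ^ (k - 1))).tsum_eq]
      exact tsum_congr fun n => hnormF n r hr
    rw [hsum]
    refine key2.congr_fun fun n => ?_
    field_simp
  · refine Summable.of_nonneg_of_le (fun n => by positivity) (fun n => ?_)
      (((summable_nat_add_iff 1).2 (summable_geometric_of_lt_one (norm_nonneg x) hx)).mul_left
        (C * (k - 1).factorial))
    have h1 : ∫ r in Ioi (0 : ℝ), ‖(c (n + 1) * x ^ (n + 1)) *
        ((r ^ (k - 1) * Real.exp (-((n + 1 : ℕ) * r)) : ℝ) : ℂ)‖ =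
        ‖c (n + 1) * x ^ (n + 1)‖ * ((k - 1).factorial / ((n + 1 : ℕ) : ℝ) ^ k) := by
      rw [← hint n, ← integral_const_mul]
      refine setIntegral_congr_fun measurableSet_Ioi fun r hr => ?_
      have hr0 : (0 : ℝ) < r := hr
      change _ = _
      rw [norm_mul, Complex.norm_real, Real.norm_of_nonneg (by positivity)]
    rw [h1, norm_mul, norm_pow]
    have h2 : ((k - 1).factorial : ℝ) / ((n + 1 : ℕ) : ℝ) ^ k ≤ (k - 1).factorial :=
      div_le_self (by positivity) (one_le_pow₀ (by push_cast; linarith [(n.cast_nonneg : (0:ℝ) ≤ n)]))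
    calc ‖c (n + 1)‖ * ‖x‖ ^ (n + 1) * (((k - 1).factorial : ℝ) / ((n + 1 : ℕ) : ℝ) ^ k)
        ≤ C * ‖x‖ ^ (n + 1) * (k - 1).factorial := by
          gcongr
          exact hC _
      _ = _ := by ring

/-- The principal branch of the polylogarithm `Li_k` on `ℂ \ [1, ∞)`, for integers `k ≥ 1`: this is
`(1 / Γ(k)) ∫_0^∞ r ^ (k - 1) x e ^ (-r) / (1 - x e ^ (-r)) dr`. -/
def polylog (k : ℕ) (x : ℂ) : ℂ := periodicPolylog (fun _ => 1) 1 k x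

theorem hasSum_polylog {k : ℕ} (hk : 1 ≤ k) {x : ℂ} (hx : ‖x‖ < 1) :
    HasSum (fun n : ℕ => x ^ (n + 1) / ((n + 1 : ℕ) : ℂ) ^ k) (polylog k x) := by
  simpa [polylog] using hasSum_periodicPolylog (c := fun _ => 1) le_rfl (fun _ => rfl) hk hx

/-- The Dirichlet `L`-weight `∑_{n ≥ 1} χ(n) e ^ (n u) / n ^ k` (continued analytically
from `Re u < 0`). -/
def dirichletWeight {q : ℕ} (χ : DirichletCharacter ℂ q) (k : ℕ) (u : ℂ) : ℂ :=
  periodicPolylog (fun n => χ n) q k (Complex.exp u)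

theorem hasSum_dirichletWeight {q : ℕ} [NeZero q] (χ : DirichletCharacter ℂ q) {k : ℕ} (hk : 1 ≤ k)
    {u : ℂ} (hu : u.re < 0) :
    HasSum (fun n : ℕ => χ ((n + 1 : ℕ) : ZMod q) * Complex.exp ((n + 1 : ℕ) * u) /
      ((n + 1 : ℕ) : ℂ) ^ k) (dirichletWeight χ k u) := by
  have h := hasSum_periodicPolylog (c := fun n : ℕ => χ n) (q := q) (k := k) NeZero.one_le
    (fun n => by simp) hk (x := Complex.exp u) (by simpa [Complex.norm_exp] using hu)
  simpa only [dirichletWeight, ← Complex.exp_nat_mul] using h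

/-- The Dirichlet eta function `η(s) = ∑_{n ≥ 1} (-1) ^ (n - 1) / n ^ s`, continued to an
entire function. -/
def dirichletEta (s : ℂ) : ℂ := -HurwitzZeta.expZeta ((1 / 2 : ℝ) : UnitAddCircle) s

theorem hasSum_dirichletEta {s : ℂ} (hs : 1 < s.re) :
    HasSum (fun n : ℕ => (-1) ^ n / ((n + 1 : ℕ) : ℂ) ^ s) (dirichletEta s) := by
  have h := HurwitzZeta.hasSum_expZeta_of_one_lt_re (1 / 2) hs
  have hs0 : s ≠ 0 := fun h => by simp [h] at hs; linarith
  have h1 := ((hasSum_nat_add_iff' 1).2 h).neg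
  have e : ∀ n : ℕ, Complex.exp (2 * Real.pi * Complex.I * ((1 / 2 : ℝ) : ℂ) * n) = (-1) ^ n := by
    intro n
    rw [← Complex.exp_pi_mul_I, ← Complex.exp_nat_mul]
    congr 1
    push_cast
    ring
  simp only [e, Finset.sum_range_one, Nat.cast_zero, Complex.zero_cpow hs0, div_zero, sub_zero] at h1
  refine h1.congr_fun fun n => ?_
  rw [pow_succ]
  ring

/-- The Hurwitz zeta function `ζ(s, a) = ∑_{n ≥ 0} (n + a) ^ (-s)` for an arbitrary real `a > 0`,
continued to `s ≠ 1`. Mathlib's function, for parameters in `(0, 1]`, depends only on `a` modulo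
`1`; the terms `(a - j) ^ (-s)` with `a - j > 0`, `j ≥ 1`, are taken off. -/
def hurwitzZetaPos (s : ℂ) (a : ℝ) : ℂ :=
  HurwitzZeta.hurwitzZeta (a : UnitAddCircle) s -
    ∑ j ∈ Finset.Icc 1 (⌈a⌉₊ - 1), ((a - j : ℝ) : ℂ) ^ (-s)

theorem hasSum_hurwitzZetaPos {a : ℝ} (ha : 0 < a) {s : ℂ} (hs : 1 < s.re) :
    HasSum (fun n : ℕ => 1 / ((n + a : ℝ) : ℂ) ^ s) (hurwitzZetaPos s a) := by
  obtain ⟨m, hm⟩ : ∃ m : ℕ, ⌈a⌉₊ = m + 1 := ⟨⌈a⌉₊ - 1, by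
    have := Nat.ceil_pos.2 ha; omega⟩
  have hm1 : (m : ℝ) < a := Nat.lt_ceil.1 (by omega)
  have hm2 : a ≤ m + 1 := by
    have := Nat.le_ceil a
    rw [hm] at this
    exact_mod_cast this
  have hcirc : (((a - m : ℝ)) : UnitAddCircle) = (a : UnitAddCircle) := by
    rw [AddCircle.coe_sub, sub_eq_self]
    exact AddCircle.coe_eq_zero_iff _ |>.2 ⟨m, by simp⟩
  have h := HurwitzZeta.hasSum_hurwitzZeta_of_one_lt_re (a := a - m)
    ⟨by linarith, by linarith⟩ hs
  rw [hcirc] at h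
  have h1 := (hasSum_nat_add_iff' m).2 h
  have hfin : ∑ i ∈ Finset.range m, 1 / ((i : ℂ) + ((a - m : ℝ) : ℂ)) ^ s =
      ∑ j ∈ Finset.Icc 1 (⌈a⌉₊ - 1), ((a - j : ℝ) : ℂ) ^ (-s) := by
    rw [hm, Nat.add_sub_cancel, ← Finset.sum_range_reflect, Finset.range_eq_Ico,
      Finset.sum_Ico_eq_sum_range]
    rw [← Finset.Ico_add_one_right_eq_Icc, Finset.sum_Ico_eq_sum_range]
    refine Finset.sum_congr rfl fun i hi => ?_
    have hi' : i < m := by simpa using hi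
    rw [Complex.cpow_neg, one_div]
    congr 2
    rw [show m - 1 - (0 + i) = m - (1 + i) by omega, Nat.cast_sub (by omega)]
    push_cast
    ring
  unfold hurwitzZetaPos
  rw [← hfin]
  refine h1.congr_fun fun n => ?_
  push_cast
  ring_nf

end

/-! On the imaginary axis `w = it` the phases of `w ^ (2z)` on the two half lines are `e ^ (± iπz)`,
and `y = t ^ 2` turns the integral into a Mellin integral. So `pmt 0 f z` is `cos (πz)` times the
Mellin transform of `y ↦ f (-y)` at `s = z + 1/2` (`pmt_zero_eq_mellin`). The dictionary is thus the
classical Mellin dictionary times a cosine. For `e ^ u` this gives `cos (πz) Γ(s) = π / Γ(1 - s)`,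
which is entire because the cosine cancels the poles of `Γ(s)`.

Three mechanisms carry such formulas to the lines `Re w = σ > 0`. For weights holomorphic in a strip
with Gaussian decay (`IsGaussianWeight`), the transform is entire in `z`, independent of `σ` by
Cauchy's theorem, and equal to the boundary integral once `Re z` is large enough; the identity
theorem then gives the value for all `z` (`IsGaussianWeight.pmt_eqOn`). This settles exponentials,
the zeta, eta and Hurwitz quotients, and `Li_k(-e ^ u)`. Weights that are not holomorphic in a full
strip (incomplete Gamma, Dirichlet weights, `Li_k(e ^ u)`) are treated by dominated convergence as
`σ ↓ 0` (`hasBoundaryPMT_of_bound`), where the work is a majorant uniform in `σ`. Weights that are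
series of exponentials are integrated term by term on the boundary (`hasSum_pmt_zero`), each term
contributing `α ^ (-s) G(z)`; this produces the Dirichlet series.

The remaining entries reduce to these. The logarithm comes from differentiating in `z`, and Fresnel
weights are combinations of scaled Gaussians with `α = ε ± i`. The rational weight is a Laplace
integral of scaled Gaussians. The perturbed exponential is expanded in powers of `λw`, and Kummer's
transformation identifies the resulting series with the parabolic cylinder function. For the complex
shift, `(n + i) ^ (-s)` is expanded binomially in `i / n`, so the Dirichlet series becomes a series
of shifted zeta values with explicit poles (`hasSum_shiftedZeta`). -/

/-! ### Generalities -/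

/-- Differentiation under the integral sign for locally dominated families of holomorphic
functions. -/
theorem hasDerivAt_integral_of_norm_le {α : Type*} [MeasurableSpace α] {μ : Measure α}
    {F : ℂ → α → ℂ} {z₀ : ℂ} {r : ℝ} (hr : 0 < r)
    (hmeas : ∀ z ∈ Metric.ball z₀ r, AEStronglyMeasurable (F z) μ)
    (hdiff : ∀ᵐ a ∂μ, DifferentiableOn ℂ (fun z => F z a) (Metric.ball z₀ r))
    {bound : α → ℝ} (hb : Integrable bound μ)
    (hle : ∀ᵐ a ∂μ, ∀ z ∈ Metric.ball z₀ r, ‖F z a‖ ≤ bound a) :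
    Integrable (fun a => deriv (fun z => F z a) z₀) μ ∧
      HasDerivAt (fun z => ∫ a, F z a ∂μ) (∫ a, deriv (fun z => F z a) z₀ ∂μ) z₀ := by
  have hz₀ : z₀ ∈ Metric.ball z₀ r := Metric.mem_ball_self hr
  have hball : ∀ z ∈ Metric.ball z₀ (r / 2), z ∈ Metric.ball z₀ r :=
    fun z hz => Metric.ball_subset_ball (by linarith) hz
  refine hasDerivAt_integral_of_dominated_loc_of_deriv_le (F := F)
    (F' := fun z a => deriv (fun z => F z a) z)
    (bound := fun a => bound a / (r / 4)) (Metric.ball_mem_nhds z₀ (half_pos hr)) ?_ ?_ ?_ ?_ ?_ ?_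
  · filter_upwards [Metric.ball_mem_nhds z₀ hr] with z hz using hmeas z hz
  · exact hb.mono' (hmeas _ hz₀) (hle.mono fun a ha => ha _ hz₀)
  -- The derivative is measurable as a limit of difference quotients with increments `r / (n + 2)`;
  -- the `2` keeps the first of them strictly inside the ball.
  · have hlt : ∀ n : ℕ, z₀ + ((r / (n + 2) : ℝ) : ℂ) ∈ Metric.ball z₀ r := by
      intro n
      rw [Metric.mem_ball, dist_eq_norm, add_sub_cancel_left, Complex.norm_real,
        Real.norm_of_nonneg (by positivity), div_lt_iff₀ (by positivity)]
      nlinarith [(n.cast_nonneg : (0 : ℝ) ≤ n)]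
    have h0 : Tendsto (fun n : ℕ => r / ((n : ℝ) + 2)) atTop (𝓝 0) :=
      tendsto_const_nhds.div_atTop (tendsto_atTop_add_const_right _ _ tendsto_natCast_atTop_atTop)
    refine aestronglyMeasurable_of_tendsto_ae (u := (atTop : Filter ℕ)) (f := fun n a =>
      ((r / (n + 2) : ℝ) : ℂ)⁻¹ * (F (z₀ + ((r / (n + 2) : ℝ) : ℂ)) a - F z₀ a)) ?_ ?_
    · intro n
      exact ((hmeas _ (hlt n)).sub (hmeas _ hz₀)).const_mul _
    · filter_upwards [hdiff] with a ha
      have hd := (ha.differentiableAt (Metric.ball_mem_nhds z₀ hr)).hasDerivAt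
      have h1 := hasDerivAt_iff_tendsto_slope_zero.1 hd
      have h2 : Tendsto (fun n : ℕ => ((r / ((n : ℝ) + 2) : ℝ) : ℂ)) atTop (𝓝[≠] 0) := by
        refine tendsto_nhdsWithin_iff.2 ⟨?_, Eventually.of_forall fun n => ?_⟩
        · simpa [Function.comp_def] using (Complex.continuous_ofReal.tendsto 0).comp h0
        · exact Complex.ofReal_ne_zero.2 (by positivity)
      simpa [Function.comp_def] using h1.comp h2
  -- Cauchy's estimate on circles of radius `r / 4`, which stay in the large ball when the centre
  -- lies in the half ball.
  · filter_upwards [hdiff, hle] with a ha hla z hz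
    have hsub : Metric.closedBall z (r / 4) ⊆ Metric.ball z₀ r := by
      intro y hy
      rw [Metric.mem_ball] at hz ⊢
      rw [Metric.mem_closedBall] at hy
      linarith [dist_triangle y z z₀]
    refine Complex.norm_deriv_le_of_forall_mem_sphere_norm_le (by positivity) ?_ ?_
    · refine DifferentiableOn.diffContOnCl_ball (U := Metric.closedBall z (r / 4)) ?_ subset_rfl
      exact ha.mono hsub
    · exact fun y hy => hla y (hsub (Metric.sphere_subset_closedBall hy))
  · exact hb.div_const _
  · filter_upwards [hdiff] with a ha z hz
    exact (ha.differentiableAt (Metric.isOpen_ball.mem_nhds (hball z hz))).hasDerivAt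

theorem eqOn_of_differentiableOn_of_eventuallyEq {f g : ℂ → ℂ} {U : Set ℂ} (hU : IsOpen U)
    (hU' : IsPreconnected U) (hf : DifferentiableOn ℂ f U) (hg : DifferentiableOn ℂ g U)
    {z₀ : ℂ} (hz₀ : z₀ ∈ U) (h : f =ᶠ[𝓝 z₀] g) : EqOn f g U :=
  (hf.analyticOnNhd hU).eqOn_of_preconnected_of_eventuallyEq (hg.analyticOnNhd hU) hU' hz₀ h

theorem integrable_comp_abs_of_integrableOn_Ioi {f : ℝ → ℝ} (hf : IntegrableOn f (Ioi 0)) :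
    Integrable (fun x => f |x|) := by
  have h1 : IntegrableOn (fun x => f |x|) (Ioi 0) :=
    hf.congr_fun (fun x hx => by simp [abs_of_pos (mem_Ioi.1 hx)]) measurableSet_Ioi
  have h2 : IntegrableOn (fun x => f |x|) (Iic 0) := by
    rw [← Measure.map_neg_eq_self (volume : Measure ℝ)]
    let m : MeasurableEmbedding fun x : ℝ => -x := (Homeomorph.neg ℝ).measurableEmbedding
    rw [m.integrableOn_map_iff]
    simp_rw [Function.comp_def, abs_neg, neg_preimage, neg_Iic, neg_zero]
    exact Iff.mpr integrableOn_Ici_iff_integrableOn_Ioi h1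
  rw [← integrableOn_univ, ← Iic_union_Ioi (a := (0 : ℝ))]
  exact h2.union h1

theorem integrable_abs_rpow_mul_exp_neg_mul_sq {p c : ℝ} (hp : -1 < p) (hc : 0 < c) :
    Integrable (fun t : ℝ => |t| ^ p * Real.exp (-c * t ^ 2)) := by
  simpa using integrable_comp_abs_of_integrableOn_Ioi (integrableOn_rpow_mul_exp_neg_mul_sq hc hp)

/-- Completing the square. This is the device by which linear exponential growth in `|t|` is
absorbed into half of a Gaussian `exp (-c t ^ 2)`. -/
theorem exp_mul_abs_le (a : ℝ) {c : ℝ} (hc : 0 < c) (t : ℝ) :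
    Real.exp (a * |t|) ≤ Real.exp (a ^ 2 / (2 * c)) * Real.exp (c / 2 * t ^ 2) := by
  rw [← Real.exp_add, Real.exp_le_exp, ← sq_abs t]
  have h : a ^ 2 / (2 * c) + c / 2 * |t| ^ 2 - a * |t| = (a - c * |t|) ^ 2 / (2 * c) := by
    field_simp
    ring
  have : 0 ≤ (a - c * |t|) ^ 2 / (2 * c) := by positivity
  linarith

/-! ### The power `w ^ (2z)` in the right half plane -/

/-- In the closed right half plane `|arg w| ≤ π / 2`, so the factor `exp (-2 arg w Im z)` is bounded
independently of `w`. -/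
theorem norm_cpow_two_mul_le {w : ℂ} (hw : 0 ≤ w.re) (hw0 : w ≠ 0) (z : ℂ) :
    ‖w ^ (2 * z)‖ ≤ Real.exp (Real.pi * |z.im|) * ‖w‖ ^ (2 * z.re) := by
  rw [Complex.norm_cpow_of_ne_zero hw0, div_eq_mul_inv, ← Real.exp_neg, mul_comm]
  have h1 : (2 * z).re = 2 * z.re := by simp
  have h2 : (2 * z).im = 2 * z.im := by simp
  rw [h1, h2]
  gcongr
  have h3 := Complex.abs_arg_le_pi_div_two_iff.2 hw
  calc -(w.arg * (2 * z.im)) ≤ |w.arg * (2 * z.im)| := neg_le_abs _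
    _ = |w.arg| * (2 * |z.im|) := by rw [abs_mul, abs_mul, abs_two]
    _ ≤ Real.pi / 2 * (2 * |z.im|) := by gcongr
    _ = _ := by ring

/-- The point is uniformity in `Re w`, including `Re w → 0`. For `q < 0` use `‖w‖ ≥ |Im w|`; for `q
≥ 0` bound `‖w‖` by an exponential and spend half of the Gaussian. The sum `|Im w| ^ q + 1` covers
both signs. -/
theorem norm_rpow_mul_exp_neg_le (q : ℝ) {c : ℝ} (hc : 0 < c) {s : ℝ} (hs : 0 ≤ s) {w : ℂ}
    (hw : 0 ≤ w.re) (hws : w.re ≤ s) (hw0 : w.im ≠ 0) :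
    ‖w‖ ^ q * Real.exp (-c * w.im ^ 2) ≤ Real.exp (|q| * s + q ^ 2 / (2 * c)) *
      ((|w.im| ^ q + 1) * Real.exp (-(c / 2) * w.im ^ 2)) := by
  have ht : 0 < |w.im| := abs_pos.2 hw0
  have hC : 1 ≤ Real.exp (|q| * s + q ^ 2 / (2 * c)) := Real.one_le_exp (by positivity)
  have hsplit : Real.exp (-c * w.im ^ 2) =
      Real.exp (-(c / 2) * w.im ^ 2) * Real.exp (-(c / 2) * w.im ^ 2) := by
    rw [← Real.exp_add]; ring_nf
  have hE1 : Real.exp (-(c / 2) * w.im ^ 2) ≤ 1 := by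
    rw [Real.exp_le_one_iff]
    nlinarith [sq_nonneg w.im]
  rcases lt_or_ge q 0 with hq | hq
  · have h1 : ‖w‖ ^ q ≤ |w.im| ^ q :=
      Real.rpow_le_rpow_of_nonpos ht (Complex.abs_im_le_norm w) hq.le
    calc ‖w‖ ^ q * Real.exp (-c * w.im ^ 2)
        ≤ (|w.im| ^ q + 1) * (Real.exp (-(c / 2) * w.im ^ 2) * 1) := by
          rw [hsplit]
          gcongr
          linarith
      _ ≤ _ := by
          rw [mul_one]
          exact le_mul_of_one_le_left (by positivity) hC
  · have h1 : ‖w‖ ≤ Real.exp (s + |w.im|) := by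
      have h2 := Complex.norm_le_abs_re_add_abs_im w
      rw [abs_of_nonneg hw] at h2
      linarith [Real.add_one_le_exp (s + |w.im|)]
    have h2 : ‖w‖ ^ q ≤ Real.exp (|q| * s + q ^ 2 / (2 * c)) * Real.exp (c / 2 * w.im ^ 2) := by
      calc ‖w‖ ^ q ≤ (Real.exp (s + |w.im|)) ^ q := by gcongr
        _ = Real.exp (|q| * s) * Real.exp (q * |w.im|) := by
          rw [← Real.exp_mul, ← Real.exp_add, abs_of_nonneg hq]; ring_nf
        _ ≤ Real.exp (|q| * s) * (Real.exp (q ^ 2 / (2 * c)) * Real.exp (c / 2 * w.im ^ 2)) := by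
          gcongr
          exact exp_mul_abs_le q hc _
        _ = _ := by rw [Real.exp_add]; ring
    calc ‖w‖ ^ q * Real.exp (-c * w.im ^ 2)
        ≤ Real.exp (|q| * s + q ^ 2 / (2 * c)) * Real.exp (c / 2 * w.im ^ 2) *
          (Real.exp (-(c / 2) * w.im ^ 2) * Real.exp (-(c / 2) * w.im ^ 2)) := by
          rw [hsplit]; gcongr
      _ = Real.exp (|q| * s + q ^ 2 / (2 * c)) * (1 * Real.exp (-(c / 2) * w.im ^ 2)) := by
          have : Real.exp (c / 2 * w.im ^ 2) * Real.exp (-(c / 2) * w.im ^ 2) = 1 := by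
            rw [← Real.exp_add]; simp
          linear_combination (Real.exp (|q| * s + q ^ 2 / (2 * c)) *
            Real.exp (-(c / 2) * w.im ^ 2)) * this
      _ ≤ _ := by
          gcongr
          linarith [Real.rpow_nonneg (abs_nonneg w.im) q]

theorem norm_pmtIntegrand_le {σ : ℝ} (hσ : 0 ≤ σ) {t : ℝ} (ht : t ≠ 0) (f : ℂ → ℂ) (z : ℂ) :
    ‖pmtIntegrand σ f z t‖ ≤ Real.exp (Real.pi * |z.im|) *
      ‖(σ : ℂ) + t * Complex.I‖ ^ (2 * z.re) * ‖f (((σ : ℂ) + t * Complex.I) ^ 2)‖ := by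
  rw [pmtIntegrand, norm_mul]
  gcongr
  refine norm_cpow_two_mul_le (by simpa using hσ) (fun h => ht ?_) z
  simpa using congrArg Complex.im h

theorem ae_ne_zero : ∀ᵐ t : ℝ, t ≠ 0 := by
  simp [ae_iff, measure_singleton]

theorem measurable_line (σ : ℝ) : Measurable fun t : ℝ => (σ : ℂ) + t * Complex.I := by fun_prop

theorem aestronglyMeasurable_pmtIntegrand {σ : ℝ} {f : ℂ → ℂ}
    (hf : AEStronglyMeasurable fun t : ℝ => f (((σ : ℂ) + t * Complex.I) ^ 2)) (z : ℂ) :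
    AEStronglyMeasurable (pmtIntegrand σ f z) :=
  ((measurable_line σ).pow_const (2 * z)).aestronglyMeasurable.mul hf

/-- A common integrable bound for the integrands on all lines `w = σ + it` with `0 < σ ≤ s`. -/
theorem exists_bound_pmtIntegrand {f : ℂ → ℂ} {s d δ c C : ℝ} (hs : 0 ≤ s) (hδ : δ < 1)
    (hc : 0 < c) (hC : 0 ≤ C)
    (hf : ∀ σ t : ℝ, 0 < σ → σ ≤ s → t ≠ 0 → ‖f (((σ : ℂ) + t * Complex.I) ^ 2)‖ ≤
      C * (‖(σ : ℂ) + t * Complex.I‖ ^ (-d) * |t| ^ (-δ) * Real.exp (-c * t ^ 2)))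
    {z : ℂ} (hz : -1 < 2 * z.re - d - δ) :
    ∃ B : ℝ → ℝ, Integrable B ∧ ∀ σ t : ℝ, 0 < σ → σ ≤ s → t ≠ 0 →
      ‖pmtIntegrand σ f z t‖ ≤ B t := by
  set q := 2 * z.re - d with hq
  -- The two powers come from `(|t| ^ q + 1) |t| ^ (-δ)`; they are integrable at the origin by `hz`
  -- and by `δ < 1`.
  have hB : Integrable fun t : ℝ => Real.exp (Real.pi * |z.im|) * (C *
      (Real.exp (|q| * s + q ^ 2 / (2 * c)) * ((|t| ^ (q - δ) + |t| ^ (-δ)) *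
        Real.exp (-(c / 2) * t ^ 2)))) := by
    simp_rw [add_mul]
    exact ((((integrable_abs_rpow_mul_exp_neg_mul_sq (by linarith) (half_pos hc)).add
      (integrable_abs_rpow_mul_exp_neg_mul_sq (by linarith) (half_pos hc))).const_mul _).const_mul
        _).const_mul _
  refine ⟨_, hB, fun σ t hσ hσs ht => ?_⟩
  refine (norm_pmtIntegrand_le hσ.le ht f z).trans ?_
  set w := (σ : ℂ) + t * Complex.I with hw
  have hre : w.re = σ := by simp [hw]
  have him : w.im = t := by simp [hw]
  have hw0 : 0 < ‖w‖ := norm_pos_iff.2 fun h => ht (by rw [← him, h]; simp)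
  have ht0 : 0 < |t| := abs_pos.2 ht
  have h1 := norm_rpow_mul_exp_neg_le q hc hs (w := w) (by rw [hre]; exact hσ.le)
    (by rw [hre]; exact hσs) (by rwa [him])
  rw [him] at h1
  rw [mul_assoc]
  refine mul_le_mul_of_nonneg_left ?_ (by positivity)
  calc ‖w‖ ^ (2 * z.re) * ‖f (w ^ 2)‖
      ≤ ‖w‖ ^ (2 * z.re) * (C * (‖w‖ ^ (-d) * |t| ^ (-δ) * Real.exp (-c * t ^ 2))) := by
        gcongr
        exact hf σ t hσ hσs ht
    _ = C * ((‖w‖ ^ q * Real.exp (-c * t ^ 2)) * |t| ^ (-δ)) := by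
        rw [hq, sub_eq_add_neg, Real.rpow_add hw0]; ring
    _ ≤ C * (Real.exp (|q| * s + q ^ 2 / (2 * c)) *
          ((|t| ^ q + 1) * Real.exp (-(c / 2) * t ^ 2)) * |t| ^ (-δ)) := by gcongr
    _ = _ := by
        rw [sub_eq_add_neg q δ, Real.rpow_add ht0]; ring

/-- Dominated convergence for the boundary transform. -/
theorem hasBoundaryPMT_of_bound {f : ℂ → ℂ} {s d δ c C : ℝ} (hs : 0 < s) (hδ : δ < 1)
    (hc : 0 < c) (hC : 0 ≤ C)
    (hmeas : ∀ σ : ℝ, 0 < σ → σ ≤ s →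
      AEStronglyMeasurable fun t : ℝ => f (((σ : ℂ) + t * Complex.I) ^ 2))
    (hf : ∀ σ t : ℝ, 0 < σ → σ ≤ s → t ≠ 0 → ‖f (((σ : ℂ) + t * Complex.I) ^ 2)‖ ≤
      C * (‖(σ : ℂ) + t * Complex.I‖ ^ (-d) * |t| ^ (-δ) * Real.exp (-c * t ^ 2)))
    (hcont : ∀ t : ℝ, t ≠ 0 → ContinuousAt f (-(t : ℂ) ^ 2))
    {z : ℂ} (hz : -1 < 2 * z.re - d - δ) :
    HasBoundaryPMT f z (pmt 0 f z) := by
  obtain ⟨B, hB, hle⟩ := exists_bound_pmtIntegrand hs.le hδ hc hC hf hz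
  have hev : ∀ᶠ σ in 𝓝[>] (0 : ℝ), 0 < σ ∧ σ ≤ s := Ioc_mem_nhdsGT hs
  refine ⟨hev.mono fun σ hσ => hB.mono' (aestronglyMeasurable_pmtIntegrand (hmeas σ hσ.1 hσ.2) z)
    (ae_ne_zero.mono fun t ht => hle σ t hσ.1 hσ.2 ht), ?_⟩
  refine tendsto_integral_filter_of_dominated_convergence B
    (hev.mono fun σ hσ => aestronglyMeasurable_pmtIntegrand (hmeas σ hσ.1 hσ.2) z)
    (hev.mono fun σ hσ => ae_ne_zero.mono fun t ht => hle σ t hσ.1 hσ.2 ht) hB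
    (ae_ne_zero.mono fun t ht => ?_)
  have hline : Tendsto (fun σ : ℝ => (σ : ℂ) + t * Complex.I) (𝓝[>] 0)
      (𝓝 (((0 : ℝ) : ℂ) + t * Complex.I)) :=
    ((Complex.continuous_ofReal.tendsto 0).mono_left nhdsWithin_le_nhds).add_const _
  have hslit : ((0 : ℝ) : ℂ) + t * Complex.I ∈ Complex.slitPlane := by
    right
    simpa using ht
  refine Tendsto.mul ?_ ?_
  · exact (continuousAt_cpow_const hslit).tendsto.comp hline
  · have h2 : (((0 : ℝ) : ℂ) + t * Complex.I) ^ 2 = -(t : ℂ) ^ 2 := by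
      rw [Complex.ofReal_zero, zero_add, mul_pow, Complex.I_sq]; ring
    have := (hcont t ht).tendsto
    rw [← h2] at this
    exact this.comp (hline.pow 2)

/-! ### Weights with Gaussian decay -/

/-- A weight `f` such that `w ↦ f (w ^ 2)` is holomorphic on the strip `0 < Re w < b`, with Gaussian
decay along vertical lines and growth at most `‖w‖ ^ (-d)` at the origin, and such that `f` is
continuous at the points of the negative axis. -/
structure IsGaussianWeight (f : ℂ → ℂ) (b d : ℝ) : Prop where
  differentiableOn : DifferentiableOn ℂ (fun w => f (w ^ 2)) {w | 0 < w.re ∧ w.re < b}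
  bound : ∀ s, 0 < s → s < b → ∃ C c : ℝ, 0 ≤ C ∧ 0 < c ∧ ∀ w : ℂ, 0 < w.re → w.re ≤ s →
    ‖f (w ^ 2)‖ ≤ C * (‖w‖ ^ (-d) * Real.exp (-c * w.im ^ 2))
  continuousAt : ∀ t : ℝ, t ≠ 0 → ContinuousAt f (-(t : ℂ) ^ 2)

/-- Both `‖w‖` and `‖w‖⁻¹` are at most `X ≤ exp X`, with `X` the bracket on the right. One bound
therefore serves all exponents in `[-M, M]`, hence a whole disc of `z`. -/
theorem norm_rpow_le_exp {w : ℂ} {q M σ₁ σ₂ : ℝ} (hq : |q| ≤ M) (hσ₁ : 0 < σ₁) (h₁ : σ₁ ≤ w.re)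
    (h₂ : w.re ≤ σ₂) : ‖w‖ ^ q ≤ Real.exp (M * (1 / σ₁ + σ₂ + |w.im|)) := by
  have hre : 0 < w.re := hσ₁.trans_le h₁
  have hw : σ₁ ≤ ‖w‖ := h₁.trans ((le_abs_self _).trans (Complex.abs_re_le_norm w))
  have hw0 : 0 < ‖w‖ := hσ₁.trans_le hw
  set X := 1 / σ₁ + σ₂ + |w.im| with hX
  have hX0 : 0 ≤ X := by
    have : 0 ≤ σ₂ := hre.le.trans h₂
    positivity
  have hmain : ‖w‖ ^ q ≤ Real.exp (|q| * X) := by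
    have hexp : ∀ y : ℝ, y ≤ X → y ≤ Real.exp X := fun y hy => by
      linarith [Real.add_one_le_exp X]
    rcases le_or_gt 0 q with h | h
    · rw [abs_of_nonneg h, mul_comm, Real.exp_mul]
      refine Real.rpow_le_rpow hw0.le (hexp _ ?_) h
      have := Complex.norm_le_abs_re_add_abs_im w
      rw [abs_of_pos hre] at this
      have h3 : 0 < 1 / σ₁ := by positivity
      linarith
    · rw [abs_of_neg h, mul_comm, Real.exp_mul, ← neg_neg q, Real.rpow_neg hw0.le,
        ← Real.inv_rpow hw0.le, neg_neg]
      refine Real.rpow_le_rpow (by positivity) (hexp _ ?_) (by linarith)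
      have h3 : ‖w‖⁻¹ ≤ 1 / σ₁ := by
        rw [one_div]; exact inv_anti₀ hσ₁ hw
      have : 0 ≤ σ₂ := hre.le.trans h₂
      linarith [abs_nonneg w.im]
  exact hmain.trans (Real.exp_le_exp.2 (by gcongr))

theorem line_ne_zero {σ : ℝ} (hσ : 0 < σ) (t : ℝ) : (σ : ℂ) + t * Complex.I ≠ 0 := fun h => by
  have := congrArg Complex.re h
  simp at this
  exact hσ.ne' this

theorem line_mem_slitPlane {σ : ℝ} (hσ : 0 < σ) (t : ℝ) :
    (σ : ℂ) + t * Complex.I ∈ Complex.slitPlane := by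
  left
  simpa using hσ

theorem differentiableOn_cpow_two_mul (z : ℂ) :
    DifferentiableOn ℂ (fun w : ℂ => w ^ (2 * z)) {w | 0 < w.re} := fun _ hw =>
  ((differentiableAt_id.cpow_const (Or.inl hw))).differentiableWithinAt

/-- Cauchy's theorem for two vertical lines. -/
theorem integral_line_eq {g : ℂ → ℂ} {σ₁ σ₂ : ℝ} (h : σ₁ ≤ σ₂)
    (hg : DifferentiableOn ℂ g {w | σ₁ ≤ w.re ∧ w.re ≤ σ₂}) {B : ℝ → ℝ} (hB : Integrable B)
    (hB0 : Tendsto B (cocompact ℝ) (𝓝 0))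
    (hle : ∀ w : ℂ, σ₁ ≤ w.re → w.re ≤ σ₂ → ‖g w‖ ≤ B w.im) :
    ∫ t : ℝ, g (σ₁ + t * Complex.I) = ∫ t : ℝ, g (σ₂ + t * Complex.I) := by
  have hcont : ∀ σ : ℝ, σ₁ ≤ σ → σ ≤ σ₂ → Continuous fun t : ℝ => g (σ + t * Complex.I) := by
    intro σ hσ hσ'
    refine hg.continuousOn.comp_continuous (by fun_prop) fun t => ?_
    simpa using ⟨hσ, hσ'⟩
  have hint : ∀ σ : ℝ, σ₁ ≤ σ → σ ≤ σ₂ → Integrable fun t : ℝ => g (σ + t * Complex.I) := by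
    intro σ hσ hσ'
    refine hB.mono' (hcont σ hσ hσ').aestronglyMeasurable (Eventually.of_forall fun t => ?_)
    simpa using hle (σ + t * Complex.I) (by simpa using hσ) (by simpa using hσ')
  have hvert : ∀ σ : ℝ, σ₁ ≤ σ → σ ≤ σ₂ → Tendsto (fun T : ℝ => ∫ t in (-T)..T,
      g (σ + t * Complex.I)) atTop (𝓝 (∫ t : ℝ, g (σ + t * Complex.I))) := fun σ hσ hσ' =>
    intervalIntegral_tendsto_integral (hint σ hσ hσ') tendsto_neg_atTop_atBot tendsto_id
  have hhor : ∀ e : ℝ → ℝ, Tendsto e atTop (cocompact ℝ) →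
      Tendsto (fun T : ℝ => ∫ x : ℝ in σ₁..σ₂, g (x + e T * Complex.I)) atTop (𝓝 0) := by
    intro e he
    have h1 : Tendsto (fun T => B (e T) * |σ₂ - σ₁|) atTop (𝓝 0) := by
      simpa using (hB0.comp he).mul_const |σ₂ - σ₁|
    refine squeeze_zero_norm (fun T => ?_) h1
    refine intervalIntegral.norm_integral_le_of_norm_le_const fun x hx => ?_
    rw [uIoc_of_le h] at hx
    simpa using hle (x + e T * Complex.I) (by simpa using hx.1.le) (by simpa using hx.2)
  have hcauchy : ∀ T : ℝ, (∫ x : ℝ in σ₁..σ₂, g (x + ((-T : ℝ) : ℂ) * Complex.I)) -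
      (∫ x : ℝ in σ₁..σ₂, g (x + (T : ℂ) * Complex.I)) +
      Complex.I * (∫ t in (-T)..T, g (σ₂ + t * Complex.I)) -
      Complex.I * (∫ t in (-T)..T, g (σ₁ + t * Complex.I)) = 0 := by
    intro T
    have := Complex.integral_boundary_rect_eq_zero_of_differentiableOn g
      (σ₁ + ((-T : ℝ) : ℂ) * Complex.I) (σ₂ + (T : ℂ) * Complex.I) ?_
    · simpa using this
    · refine hg.mono fun w hw => ?_
      have := hw.1
      simp only [mem_preimage, uIcc_of_le h, Complex.add_re, Complex.ofReal_re, Complex.mul_re,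
        Complex.I_re, mul_zero, Complex.ofReal_im, Complex.I_im, mul_one, sub_self, add_zero] at this
      exact this
  have hlim := (((hhor (fun T => -T) (tendsto_neg_atTop_atBot.mono_right
    atBot_le_cocompact)).sub (hhor (fun T => T) (tendsto_id.mono_right atTop_le_cocompact))).add
    ((hvert σ₂ h le_rfl).const_mul Complex.I)).sub ((hvert σ₁ le_rfl h).const_mul Complex.I)
  have h0 := tendsto_nhds_unique (hlim.congr hcauchy) tendsto_const_nhds
  have h1 : Complex.I * ((∫ t : ℝ, g (σ₂ + t * Complex.I)) -
      ∫ t : ℝ, g (σ₁ + t * Complex.I)) = 0 := by linear_combination h0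
  rcases mul_eq_zero.1 h1 with h2 | h2
  · exact absurd h2 Complex.I_ne_zero
  · exact (sub_eq_zero.1 h2).symm

namespace IsGaussianWeight

variable {f : ℂ → ℂ} {b d : ℝ}

theorem continuous_line (hf : IsGaussianWeight f b d) {σ : ℝ} (hσ : 0 < σ) (hσb : σ < b) :
    Continuous fun t : ℝ => f (((σ : ℂ) + t * Complex.I) ^ 2) :=
  hf.differentiableOn.continuousOn.comp_continuous (f := fun t : ℝ => (σ : ℂ) + t * Complex.I)
    (by fun_prop) fun t => by simpa using ⟨hσ, hσb⟩

theorem aestronglyMeasurable (hf : IsGaussianWeight f b d) {σ : ℝ} (hσ : 0 < σ) (hσb : σ < b)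
    (z : ℂ) : AEStronglyMeasurable (pmtIntegrand σ f z) :=
  aestronglyMeasurable_pmtIntegrand (hf.continuous_line hσ hσb).aestronglyMeasurable z

/-- A majorant uniform in `z` on discs and in `Re w` on closed strips away from `0`. It supplies at
once integrability, differentiation in `z` and the decay needed to shift the line. -/
theorem exists_bound (hf : IsGaussianWeight f b d) {σ₁ σ₂ : ℝ} (hσ₁ : 0 < σ₁) (h : σ₁ ≤ σ₂)
    (hσ₂ : σ₂ < b) (N : ℝ) : ∃ K c : ℝ, 0 < c ∧ ∀ w z : ℂ, σ₁ ≤ w.re → w.re ≤ σ₂ → ‖z‖ ≤ N →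
      ‖w ^ (2 * z) * f (w ^ 2)‖ ≤ K * Real.exp (-c * w.im ^ 2) := by
  obtain ⟨C, c, hC, hc, hle⟩ := hf.bound σ₂ (hσ₁.trans_le h) hσ₂
  set M := 2 * N + |d| with hM
  refine ⟨Real.exp (Real.pi * N) * (C * (Real.exp (M * (1 / σ₁ + σ₂)) *
    Real.exp (M ^ 2 / (2 * c)))), c / 2, half_pos hc, fun w z hw₁ hw₂ hz => ?_⟩
  have hre : 0 < w.re := hσ₁.trans_le hw₁
  have hw0 : w ≠ 0 := fun h => by simp [h] at hre
  have hw : 0 < ‖w‖ := norm_pos_iff.2 hw0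
  have hq : |2 * z.re - d| ≤ M := by
    have h1 := (Complex.abs_re_le_norm z).trans hz
    calc |2 * z.re - d| ≤ |2 * z.re| + |d| := abs_sub _ _
      _ = 2 * |z.re| + |d| := by rw [abs_mul, abs_two]
      _ ≤ M := by rw [hM]; linarith
  have hpow := norm_rpow_le_exp hq hσ₁ hw₁ hw₂
  have hcp := norm_cpow_two_mul_le hre.le hw0 z
  have him : |z.im| ≤ N := (Complex.abs_im_le_norm z).trans hz
  have hexp := exp_mul_abs_le M hc w.im
  rw [norm_mul]
  calc ‖w ^ (2 * z)‖ * ‖f (w ^ 2)‖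
      ≤ (Real.exp (Real.pi * N) * ‖w‖ ^ (2 * z.re)) *
          (C * (‖w‖ ^ (-d) * Real.exp (-c * w.im ^ 2))) := by
        refine mul_le_mul (hcp.trans ?_) (hle w hre hw₂) (norm_nonneg _) (by positivity)
        gcongr
    _ = Real.exp (Real.pi * N) * (C * (‖w‖ ^ (2 * z.re - d) * Real.exp (-c * w.im ^ 2))) := by
        rw [sub_eq_add_neg, Real.rpow_add hw]; ring
    _ ≤ Real.exp (Real.pi * N) * (C * (Real.exp (M * (1 / σ₁ + σ₂)) *
          (Real.exp (M ^ 2 / (2 * c)) * Real.exp (c / 2 * w.im ^ 2)) *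
          Real.exp (-c * w.im ^ 2))) := by
        gcongr
        rw [mul_add M _ |w.im|, Real.exp_add] at hpow
        exact hpow.trans (by gcongr)
    _ = _ := by
        have : Real.exp (c / 2 * w.im ^ 2) * Real.exp (-c * w.im ^ 2) =
            Real.exp (-(c / 2) * w.im ^ 2) := by
          rw [← Real.exp_add]; ring_nf
        rw [← this]; ring

theorem integrable (hf : IsGaussianWeight f b d) {σ : ℝ} (hσ : 0 < σ) (hσb : σ < b) (z : ℂ) :
    Integrable (pmtIntegrand σ f z) := by
  obtain ⟨K, c, hc, hle⟩ := hf.exists_bound hσ le_rfl hσb ‖z‖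
  refine ((integrable_exp_neg_mul_sq hc).const_mul K).mono' (hf.aestronglyMeasurable hσ hσb z)
    (Eventually.of_forall fun t => ?_)
  simpa [pmtIntegrand] using hle (σ + t * Complex.I) z (by simp) (by simp) le_rfl

/-- Integrability of the differentiated integrand is kept because that integrand is itself a
transform: for `e ^ u` it is the log-Gaussian one. -/
theorem hasDerivAt (hf : IsGaussianWeight f b d) {σ : ℝ} (hσ : 0 < σ) (hσb : σ < b) (z : ℂ) :
    Integrable (fun t => deriv (fun z => pmtIntegrand σ f z t) z) ∧
      HasDerivAt (pmt σ f) (∫ t, deriv (fun z => pmtIntegrand σ f z t) z) z := by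
  obtain ⟨K, c, hc, hle⟩ := hf.exists_bound hσ le_rfl hσb (‖z‖ + 1)
  refine hasDerivAt_integral_of_norm_le (F := fun z t => pmtIntegrand σ f z t) one_pos
    (fun z _ => hf.aestronglyMeasurable hσ hσb z)
    (Eventually.of_forall fun t => Differentiable.differentiableOn ?_)
    ((integrable_exp_neg_mul_sq hc).const_mul K)
    (Eventually.of_forall fun t z' hz' => ?_)
  · have h0 := line_ne_zero hσ t
    intro z
    exact (((differentiableAt_id.const_mul (2 : ℂ)).const_cpow (Or.inl h0))).mul_const _
  · have hz2 : ‖z'‖ ≤ ‖z‖ + 1 := by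
      rw [Metric.mem_ball, dist_eq_norm] at hz'
      linarith [norm_le_norm_add_norm_sub' z' z]
    simpa [pmtIntegrand] using hle (σ + t * Complex.I) z' (by simp) (by simp) hz2

theorem differentiable (hf : IsGaussianWeight f b d) {σ : ℝ} (hσ : 0 < σ) (hσb : σ < b) :
    Differentiable ℂ (pmt σ f) := fun z => (hf.hasDerivAt hσ hσb z).2.differentiableAt

theorem pmt_eq_of_le (hf : IsGaussianWeight f b d) {σ₁ σ₂ : ℝ} (hσ₁ : 0 < σ₁) (h : σ₁ ≤ σ₂)
    (hσ₂ : σ₂ < b) (z : ℂ) : pmt σ₁ f z = pmt σ₂ f z := by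
  obtain ⟨K, c, hc, hle⟩ := hf.exists_bound hσ₁ h hσ₂ ‖z‖
  have hsub : {w : ℂ | σ₁ ≤ w.re ∧ w.re ≤ σ₂} ⊆ {w | 0 < w.re ∧ w.re < b} := fun w hw =>
    ⟨hσ₁.trans_le hw.1, hw.2.trans_lt hσ₂⟩
  refine integral_line_eq (g := fun w => w ^ (2 * z) * f (w ^ 2)) h ?_
    ((integrable_exp_neg_mul_sq hc).const_mul K) ?_ fun w h₁ h₂ => hle w z h₁ h₂ le_rfl
  · exact ((differentiableOn_cpow_two_mul z).mono fun w hw => (hsub hw).1).mul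
      (hf.differentiableOn.mono hsub)
  · have h1 : Tendsto (fun t : ℝ => -c * t ^ 2) (cocompact ℝ) atBot := by
      refine Tendsto.const_mul_atTop_of_neg (neg_lt_zero.2 hc) ?_
      simpa [Function.comp_def] using
        (tendsto_pow_atTop two_ne_zero).comp (tendsto_norm_cocompact_atTop (E := ℝ))
    simpa using (Real.tendsto_exp_atBot.comp h1).const_mul K

theorem pmt_eq (hf : IsGaussianWeight f b d) {σ₁ σ₂ : ℝ} (hσ₁ : 0 < σ₁) (hσ₁b : σ₁ < b)
    (hσ₂ : 0 < σ₂) (hσ₂b : σ₂ < b) (z : ℂ) : pmt σ₁ f z = pmt σ₂ f z := by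
  rcases le_total σ₁ σ₂ with h | h
  · exact hf.pmt_eq_of_le hσ₁ h hσ₂b z
  · exact (hf.pmt_eq_of_le hσ₂ h hσ₁b z).symm

theorem hasBoundaryPMT (hf : IsGaussianWeight f b d) (hb : 0 < b) {z : ℂ}
    (hz : -1 < 2 * z.re - d) : HasBoundaryPMT f z (pmt 0 f z) := by
  obtain ⟨C, c, hC, hc, hle⟩ := hf.bound (b / 2) (half_pos hb) (half_lt_self hb)
  refine hasBoundaryPMT_of_bound (s := b / 2) (d := d) (δ := 0) (half_pos hb) one_pos hc hC
    (fun σ hσ hσs => (hf.continuous_line hσ (by linarith)).aestronglyMeasurable)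
    (fun σ t hσ hσs _ => ?_) hf.continuousAt (by linarith)
  simpa using hle (σ + t * Complex.I) (by simpa using hσ) (by simpa using hσs)

/-- The transform is constant in `σ` on `(0, b)`, so it equals its limit as `σ ↓ 0`. -/
theorem pmt_eq_boundary (hf : IsGaussianWeight f b d) {σ : ℝ} (hσ : 0 < σ) (hσb : σ < b) {z : ℂ}
    (hz : -1 < 2 * z.re - d) : pmt σ f z = pmt 0 f z := by
  have hb : 0 < b := hσ.trans hσb
  refine tendsto_nhds_unique (tendsto_const_nhds.congr' ?_) (hf.hasBoundaryPMT hb hz).2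
  filter_upwards [Ioo_mem_nhdsGT hb] with σ' hσ'
  exact hf.pmt_eq hσ hσb hσ'.1 hσ'.2 z

/-- A transform along `w = σ + it` is determined by the values of the boundary transform in a right
half plane. -/
theorem pmt_eqOn (hf : IsGaussianWeight f b d) {σ : ℝ} (hσ : 0 < σ) (hσb : σ < b) {U : Set ℂ}
    (hU : IsOpen U) (hU' : IsPreconnected U) {Φ : ℂ → ℂ} (hΦ : DifferentiableOn ℂ Φ U) {x₀ : ℝ}
    (hx₀ : -1 < 2 * x₀ - d) (hΦU : ∀ z : ℂ, x₀ < z.re → z ∈ U ∧ pmt 0 f z = Φ z) :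
    EqOn (pmt σ f) Φ U := by
  have h1 : (((x₀ + 1 : ℝ) : ℂ)) ∈ {z : ℂ | x₀ < z.re} := by simp
  refine eqOn_of_differentiableOn_of_eventuallyEq hU hU' (hf.differentiable hσ hσb).differentiableOn
    hΦ (hΦU _ h1).1 ?_
  filter_upwards [(isOpen_lt continuous_const Complex.continuous_re).mem_nhds h1] with z hz
  rw [← (hΦU z hz).2]
  have : x₀ < z.re := hz
  exact hf.pmt_eq_boundary hσ hσb (by linarith)

end IsGaussianWeight

/-! ### The boundary transform as a Mellin transform -/

/-- No integrability is assumed: since `a ≠ 0`, if `g` is not integrable then neither is `P`, and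
both integrals take the default value `0`. -/
theorem integral_eq_of_even_odd {P g : ℝ → ℂ} {a b : ℂ} (ha : a ≠ 0)
    (h₁ : ∀ t : ℝ, 0 < t → P t = a * g t) (h₂ : ∀ t : ℝ, 0 < t → P (-t) = b * g t) :
    ∫ t : ℝ, P t = (a + b) * ∫ t in Ioi (0 : ℝ), g t := by
  have e₁ : ∫ t in Ioi (0 : ℝ), P t = a * ∫ t in Ioi (0 : ℝ), g t := by
    rw [← integral_const_mul]
    exact setIntegral_congr_fun measurableSet_Ioi fun t ht => h₁ t ht
  by_cases hg : IntegrableOn g (Ioi 0)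
  · have i₁ : IntegrableOn P (Ioi 0) :=
      (Integrable.const_mul hg a).congr
        (ae_restrict_of_forall_mem measurableSet_Ioi fun t ht => (h₁ t ht).symm)
    have i₂ : IntegrableOn P (Iic 0) := by
      rw [← Measure.map_neg_eq_self (volume : Measure ℝ)]
      let m : MeasurableEmbedding fun x : ℝ => -x := (Homeomorph.neg ℝ).measurableEmbedding
      rw [m.integrableOn_map_iff]
      simp_rw [Function.comp_def, neg_preimage, neg_Iic, neg_zero]
      refine Iff.mpr integrableOn_Ici_iff_integrableOn_Ioi ?_
      exact (Integrable.const_mul hg b).congr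
        (ae_restrict_of_forall_mem measurableSet_Ioi fun t ht => (h₂ t ht).symm)
    have e₂ : ∫ t in Iic (0 : ℝ), P t = b * ∫ t in Ioi (0 : ℝ), g t := by
      rw [← integral_const_mul, ← neg_zero, ← integral_comp_neg_Ioi, neg_zero]
      exact setIntegral_congr_fun measurableSet_Ioi fun t ht => h₂ t ht
    rw [← setIntegral_univ, ← Iic_union_Ioi (a := (0 : ℝ)),
      setIntegral_union (Iic_disjoint_Ioi le_rfl) measurableSet_Ioi i₂ i₁, e₁, e₂]
    ring
  · have hP : ¬ Integrable P := by
      intro hP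
      refine hg (((hP.integrableOn (s := Ioi 0)).const_mul a⁻¹).congr
        (ae_restrict_of_forall_mem measurableSet_Ioi fun t ht => ?_))
      change a⁻¹ * P t = g t
      rw [h₁ t ht, inv_mul_cancel_left₀ ha]
    rw [integral_undef hP, integral_undef hg, mul_zero]

theorem ofReal_mul_I_cpow {t : ℝ} (ht : 0 < t) (z : ℂ) :
    ((t : ℂ) * Complex.I) ^ (2 * z) = Complex.exp (Real.pi * z * Complex.I) * (t : ℂ) ^ (2 * z) := by
  have h0 : (t : ℂ) ≠ 0 := Complex.ofReal_ne_zero.2 ht.ne'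
  rw [Complex.cpow_def_of_ne_zero (mul_ne_zero h0 Complex.I_ne_zero),
    Complex.cpow_def_of_ne_zero h0, Complex.log_ofReal_mul ht Complex.I_ne_zero, Complex.log_I,
    Complex.ofReal_log ht.le, ← Complex.exp_add]
  ring_nf

theorem neg_ofReal_mul_I_cpow {t : ℝ} (ht : 0 < t) (z : ℂ) :
    (-(t : ℂ) * Complex.I) ^ (2 * z) =
      Complex.exp (-(Real.pi * z * Complex.I)) * (t : ℂ) ^ (2 * z) := by
  have h0 : (t : ℂ) ≠ 0 := Complex.ofReal_ne_zero.2 ht.ne'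
  have hI : -Complex.I ≠ 0 := neg_ne_zero.2 Complex.I_ne_zero
  rw [neg_mul, ← mul_neg, Complex.cpow_def_of_ne_zero (mul_ne_zero h0 hI),
    Complex.cpow_def_of_ne_zero h0, Complex.log_ofReal_mul ht hI, Complex.log_neg_I,
    Complex.ofReal_log ht.le, ← Complex.exp_add]
  ring_nf

/-- The phases `e ^ (± iπz)` of the two half lines add up to `2 cos (πz)`. The substitution `y = t ^
2` contributes `1/2` and turns the exponent `2z` into `s - 1`. -/
theorem pmt_zero_eq_mellin (f : ℂ → ℂ) (z : ℂ) :
    pmt 0 f z = Complex.cos (Real.pi * z) * mellin (fun y : ℝ => f (-y)) (z + 1 / 2) := by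
  have h1 := integral_eq_of_even_odd (P := pmtIntegrand 0 f z)
    (g := fun t : ℝ => (t : ℂ) ^ (2 * z) * f (-(t : ℂ) ^ 2))
    (a := Complex.exp (Real.pi * z * Complex.I)) (b := Complex.exp (-(Real.pi * z * Complex.I)))
    (Complex.exp_ne_zero _) (fun t ht => ?_) (fun t ht => ?_)
  · rw [pmt, h1]
    have h2 := mellin_comp_rpow (fun y : ℝ => f (-y)) (2 * z + 1) 2
    have h3 : mellin (fun t : ℝ => f (-((t ^ (2 : ℝ) : ℝ) : ℂ))) (2 * z + 1) =
        ∫ t in Ioi (0 : ℝ), (t : ℂ) ^ (2 * z) * f (-(t : ℂ) ^ 2) := by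
      rw [mellin]
      refine setIntegral_congr_fun measurableSet_Ioi fun t _ => ?_
      simp
    rw [← h3, h2, show (2 * z + 1) / ((2 : ℝ) : ℂ) = z + 1 / 2 by push_cast; ring, Complex.cos]
    simp only [abs_two, Complex.real_smul]
    push_cast
    ring_nf
  · rw [pmtIntegrand, Complex.ofReal_zero, zero_add, ofReal_mul_I_cpow ht, mul_pow, Complex.I_sq]
    ring_nf
  · rw [pmtIntegrand, Complex.ofReal_zero, zero_add, Complex.ofReal_neg, neg_ofReal_mul_I_cpow ht,
      mul_pow, Complex.I_sq]
    ring_nf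

/-! ### Exponential weights -/

theorem integrableOn_rpow_mul_exp_neg_mul {p c : ℝ} (hp : -1 < p) (hc : 0 < c) :
    IntegrableOn (fun y : ℝ => y ^ p * Real.exp (-c * y)) (Ioi 0) := by
  simpa using integrableOn_rpow_mul_exp_neg_mul_rpow hp one_pos hc

theorem norm_cpow_mul_exp_neg {α s : ℂ} {y : ℝ} (hy : 0 < y) :
    ‖(y : ℂ) ^ (s - 1) * Complex.exp (-(α * y))‖ =
      y ^ (s.re - 1) * Real.exp (-α.re * y) := by
  rw [norm_mul, Complex.norm_cpow_eq_rpow_re_of_pos hy, Complex.norm_exp]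
  simp

theorem aestronglyMeasurable_cpow_mul_exp_neg (α s : ℂ) (μ : Measure ℝ) :
    AEStronglyMeasurable (fun y : ℝ => (y : ℂ) ^ (s - 1) * Complex.exp (-(α * y))) μ := by
  refine (Measurable.mul ?_ (by fun_prop)).aestronglyMeasurable
  exact Complex.measurable_ofReal.pow_const _

theorem integrableOn_cpow_mul_exp_neg {α s : ℂ} (hα : 0 < α.re) (hs : 0 < s.re) :
    IntegrableOn (fun y : ℝ => (y : ℂ) ^ (s - 1) * Complex.exp (-(α * y))) (Ioi 0) := by
  refine (integrableOn_rpow_mul_exp_neg_mul (p := s.re - 1) (by linarith) hα).mono'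
    (aestronglyMeasurable_cpow_mul_exp_neg _ _ _) ?_
  exact ae_restrict_of_forall_mem measurableSet_Ioi fun y hy => (norm_cpow_mul_exp_neg hy).le

theorem isOpen_re_pos : IsOpen {α : ℂ | 0 < α.re} := isOpen_lt continuous_const Complex.continuous_re

theorem differentiableOn_const_cpow_neg (s : ℂ) :
    DifferentiableOn ℂ (fun α : ℂ => α ^ (-s)) {α : ℂ | 0 < α.re} := fun _ hα =>
  (differentiableAt_id.cpow_const (Or.inl hα)).differentiableWithinAt

/-- Euler's integral with a complex scale. -/
theorem integral_cpow_mul_exp_neg_mul_Ioi_of_re_pos {α s : ℂ} (hα : 0 < α.re) (hs : 0 < s.re) :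
    ∫ y in Ioi (0 : ℝ), (y : ℂ) ^ (s - 1) * Complex.exp (-(α * y)) =
      α ^ (-s) * Complex.Gamma s := by
  have hdiff : DifferentiableOn ℂ (fun α : ℂ => ∫ y in Ioi (0 : ℝ),
      (y : ℂ) ^ (s - 1) * Complex.exp (-(α * y))) {α : ℂ | 0 < α.re} := by
    intro α₀ hα₀
    have hα₀ : 0 < α₀.re := hα₀
    refine (hasDerivAt_integral_of_norm_le
      (F := fun α (y : ℝ) => (y : ℂ) ^ (s - 1) * Complex.exp (-(α * y))) (half_pos hα₀)
      (fun α _ => aestronglyMeasurable_cpow_mul_exp_neg _ _ _)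
      (Eventually.of_forall fun y => Differentiable.differentiableOn (by fun_prop))
      (integrableOn_rpow_mul_exp_neg_mul (p := s.re - 1) (by linarith) (half_pos hα₀))
      (ae_restrict_of_forall_mem measurableSet_Ioi fun y hy α h =>
        ?_)).2.differentiableAt.differentiableWithinAt
    have hy : 0 < y := hy
    rw [norm_cpow_mul_exp_neg hy]
    have hre : α₀.re / 2 ≤ α.re := by
      rw [Metric.mem_ball, dist_eq_norm] at h
      have := (abs_le.1 ((Complex.abs_re_le_norm (α - α₀)).trans h.le)).1
      rw [Complex.sub_re] at this
      linarith
    gcongr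
  -- For real scales the formula is known. These accumulate at `1`, so the identity theorem extends
  -- it to the half plane.
  have hseq : Tendsto (fun n : ℕ => ((1 + 1 / ((n : ℝ) + 1) : ℝ) : ℂ)) atTop (𝓝[≠] 1) := by
    refine tendsto_nhdsWithin_iff.2 ⟨?_, Eventually.of_forall fun n => ?_⟩
    · have := (tendsto_one_div_add_atTop_nhds_zero_nat (𝕜 := ℝ)).const_add 1
      rw [add_zero] at this
      simpa [Function.comp_def] using (Complex.continuous_ofReal.tendsto 1).comp this
    · have : (0 : ℝ) < 1 / ((n : ℝ) + 1) := by positivity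
      intro h
      have h' := congrArg Complex.re (mem_singleton_iff.1 h)
      rw [Complex.ofReal_re, Complex.one_re] at h'
      linarith
  refine (hdiff.analyticOnNhd isOpen_re_pos).eqOn_of_preconnected_of_frequently_eq
    (((differentiableOn_const_cpow_neg s).mul_const _).analyticOnNhd isOpen_re_pos)
    (convex_halfSpace_re_gt 0).isPreconnected (z₀ := 1) (by simp) ?_ hα
  refine hseq.frequently (Frequently.of_forall fun n => ?_)
  set r : ℝ := 1 + 1 / ((n : ℝ) + 1) with hr
  have hr0 : 0 < r := by positivity
  simp only [Complex.integral_cpow_mul_exp_neg_mul_Ioi hs hr0]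
  rw [one_div, Complex.inv_cpow _ _ (by rw [Complex.arg_ofReal_of_nonneg hr0.le]; exact
    Real.pi_pos.ne), Complex.cpow_neg]

/-- Euler's reflection formula with `sin (π s) = cos (πz)`. At a pole of `Γ(1/2 - z)` the cosine
vanishes, which matches the value `0` of the inverse there. -/
theorem cos_mul_Gamma_eq {z : ℂ} (hz : ∀ m : ℕ, z + 1 / 2 ≠ -m) :
    Complex.cos (Real.pi * z) * Complex.Gamma (z + 1 / 2) =
      Real.pi * (Complex.Gamma (1 / 2 - z))⁻¹ := by
  by_cases h : Complex.Gamma (1 / 2 - z) = 0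
  · obtain ⟨m, hm⟩ := (Complex.Gamma_eq_zero_iff _).1 h
    have : z = m + 1 / 2 := by linear_combination -hm
    have hc : Complex.cos (Real.pi * z) = 0 := by
      rw [Complex.cos_eq_zero_iff]
      exact ⟨m, by rw [this]; push_cast; ring⟩
    rw [h, hc, inv_zero, zero_mul, mul_zero]
  · have hG : Complex.Gamma (z + 1 / 2) ≠ 0 := Complex.Gamma_ne_zero hz
    have hr := Complex.Gamma_mul_Gamma_one_sub (z + 1 / 2)
    have hs : Complex.sin (Real.pi * (z + 1 / 2)) = Complex.cos (Real.pi * z) := by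
      rw [← Complex.sin_add_pi_div_two]; ring_nf
    rw [show 1 - (z + 1 / 2) = 1 / 2 - z by ring, hs] at hr
    have hc : Complex.cos (Real.pi * z) ≠ 0 := fun h0 => by
      rw [h0, div_zero] at hr
      exact mul_ne_zero hG h hr
    rw [eq_div_iff hc] at hr
    rw [← div_eq_mul_inv, eq_div_iff h]
    linear_combination hr

/-- With `w = σ + it`, `Re (α w ^ 2) = Re α (σ ^ 2 - t ^ 2) - 2 (Im α) σ t`. The cross term is
linear in `t` and costs half of the Gaussian decay. -/
theorem re_mul_sq_le {α w : ℂ} {s : ℝ} (hα : 0 < α.re) (hw : 0 < w.re) (hws : w.re ≤ s) :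
    Real.exp ((α * w ^ 2).re) ≤ Real.exp (α.re * s ^ 2) *
      Real.exp ((2 * |α.im| * s) ^ 2 / (2 * α.re)) * Real.exp (-(α.re / 2) * w.im ^ 2) := by
  have h1 := exp_mul_abs_le (2 * |α.im| * s) hα w.im
  have h2 : (α * w ^ 2).re ≤ α.re * s ^ 2 + 2 * |α.im| * s * |w.im| + -α.re * w.im ^ 2 := by
    have e : (α * w ^ 2).re = α.re * w.re ^ 2 - α.re * w.im ^ 2 - 2 * (α.im * (w.re * w.im)) := by
      simp [pow_two]; ring
    have h3 : -(α.im * (w.re * w.im)) ≤ |α.im| * (s * |w.im|) := by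
      calc -(α.im * (w.re * w.im)) ≤ |α.im * (w.re * w.im)| := neg_le_abs _
        _ = |α.im| * (w.re * |w.im|) := by rw [abs_mul, abs_mul, abs_of_pos hw]
        _ ≤ _ := by gcongr
    have h4 : α.re * w.re ^ 2 ≤ α.re * s ^ 2 := by gcongr
    rw [e]; linarith
  calc Real.exp ((α * w ^ 2).re)
      ≤ Real.exp (α.re * s ^ 2) * Real.exp (2 * |α.im| * s * |w.im|) *
          Real.exp (-α.re * w.im ^ 2) := by
        rw [← Real.exp_add, ← Real.exp_add]
        exact Real.exp_le_exp.2 h2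
    _ ≤ Real.exp (α.re * s ^ 2) * (Real.exp ((2 * |α.im| * s) ^ 2 / (2 * α.re)) *
          Real.exp (α.re / 2 * w.im ^ 2)) * Real.exp (-α.re * w.im ^ 2) := by gcongr
    _ = _ := by
        have : Real.exp (α.re / 2 * w.im ^ 2) * Real.exp (-α.re * w.im ^ 2) =
            Real.exp (-(α.re / 2) * w.im ^ 2) := by
          rw [← Real.exp_add]; ring_nf
        rw [← this]; ring

theorem isGaussianWeight_exp_mul {α : ℂ} (hα : 0 < α.re) (b : ℝ) :
    IsGaussianWeight (fun u => Complex.exp (α * u)) b 0 where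
  differentiableOn := Differentiable.differentiableOn (by fun_prop)
  bound := fun s _ _ => ⟨Real.exp (α.re * s ^ 2) * Real.exp ((2 * |α.im| * s) ^ 2 / (2 * α.re)),
    α.re / 2, by positivity, half_pos hα, fun w hw hws => by
      rw [Complex.norm_exp, neg_zero, Real.rpow_zero, one_mul]
      exact re_mul_sq_le hα hw hws⟩
  continuousAt := fun t _ => by fun_prop

theorem pmt_zero_exp_mul {α z : ℂ} (hα : 0 < α.re) (hz : 0 < (z + 1 / 2).re) :
    pmt 0 (fun u => Complex.exp (α * u)) z =
      α ^ (-(z + 1 / 2)) * (Real.pi * (Complex.Gamma (1 / 2 - z))⁻¹) := by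
  have hs : ∀ m : ℕ, z + 1 / 2 ≠ -m := fun m h => by
    rw [h] at hz
    simp at hz
    linarith [(m.cast_nonneg : (0 : ℝ) ≤ m)]
  rw [pmt_zero_eq_mellin, ← cos_mul_Gamma_eq hs]
  have := integral_cpow_mul_exp_neg_mul_Ioi_of_re_pos hα hz
  simp only [mellin, smul_eq_mul, mul_neg]
  rw [this]
  ring

theorem differentiable_Gamma_half_sub_inv :
    Differentiable ℂ fun z : ℂ => (Complex.Gamma (1 / 2 - z))⁻¹ :=
  Complex.differentiable_one_div_Gamma.comp (by fun_prop)

theorem ne_zero_of_re_pos {α : ℂ} (hα : 0 < α.re) : α ≠ 0 := fun h => by simp [h] at hα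

/-- Both sides are entire and agree with the boundary integral for `Re z > 0`. The strip may be
arbitrarily wide; `σ + 1` is just some width beyond `σ`. -/
theorem pmt_exp_mul_aux {α : ℂ} (hα : 0 < α.re) {σ : ℝ} (hσ : 0 < σ) (z : ℂ) :
    pmt σ (fun u => Complex.exp (α * u)) z =
      α ^ (-(z + 1 / 2)) * (Real.pi * (Complex.Gamma (1 / 2 - z))⁻¹) := by
  refine (isGaussianWeight_exp_mul hα (σ + 1)).pmt_eqOn (x₀ := 0) hσ (lt_add_one σ) isOpen_univ
    isPreconnected_univ (Φ := fun z => α ^ (-(z + 1 / 2)) *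
      (Real.pi * (Complex.Gamma (1 / 2 - z))⁻¹)) ?_ (by simp) (fun z hz => ⟨mem_univ _, ?_⟩)
    (mem_univ z)
  · refine Differentiable.differentiableOn (Differentiable.mul ?_
      (differentiable_Gamma_half_sub_inv.const_mul _))
    intro z
    exact DifferentiableAt.const_cpow (by fun_prop) (Or.inl (ne_zero_of_re_pos hα))
  · exact pmt_zero_exp_mul hα (by simp; linarith)

theorem pmtG_eq (z : ℂ) : pmtG z = Real.pi * (Complex.Gamma (1 / 2 - z))⁻¹ := by
  have := pmt_exp_mul_aux (α := 1) (by simp) one_pos z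
  simpa [pmtG] using this

theorem differentiable_pmtG : Differentiable ℂ pmtG := by
  rw [funext pmtG_eq]
  exact differentiable_Gamma_half_sub_inv.const_mul _

theorem pmtG_eq_cos_mul_Gamma {z : ℂ} (hz : ∀ m : ℕ, z + 1 / 2 ≠ -m) :
    pmtG z = Complex.cos (Real.pi * z) * Complex.Gamma (z + 1 / 2) := by
  rw [pmtG_eq, cos_mul_Gamma_eq hz]

theorem pmtG_eq_pi_div_Gamma (z : ℂ) : pmtG z = Real.pi / Complex.Gamma (1 - (z + 1 / 2)) := by
  rw [pmtG_eq, div_eq_mul_inv]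
  ring_nf

theorem pmt_exp_mul {α : ℂ} (hα : 0 < α.re) {σ : ℝ} (hσ : 0 < σ) (z : ℂ) :
    pmt σ (fun u => Complex.exp (α * u)) z = α ^ (-(z + 1 / 2)) * pmtG z := by
  rw [pmt_exp_mul_aux hα hσ, pmtG_eq]

theorem hasPMT_exp_mul {α : ℂ} (hα : 0 < α.re) {σ : ℝ} (hσ : 0 < σ) (z : ℂ) :
    HasPMT σ (fun u => Complex.exp (α * u)) z (α ^ (-(z + 1 / 2)) * pmtG z) :=
  ⟨(isGaussianWeight_exp_mul hα (σ + 1)).integrable hσ (lt_add_one σ) z, pmt_exp_mul hα hσ z⟩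

theorem pmt_boundary_exp_mul {α z : ℂ} (hα : 0 < α.re) (hz : 0 < (z + 1 / 2).re) :
    pmt 0 (fun u => Complex.exp (α * u)) z = α ^ (-(z + 1 / 2)) * pmtG z := by
  rw [pmt_zero_exp_mul hα hz, pmtG_eq]

theorem hasPMT_exp {σ : ℝ} (hσ : 0 < σ) (z : ℂ) : HasPMT σ Complex.exp z (pmtG z) := by
  have := hasPMT_exp_mul (α := 1) (by simp) hσ z
  simpa using this

/-- At the boundary `σ = 0` the transform of `e ^ (α u)` converges absolutely for `Re s > 0`. -/
theorem integrable_boundary_exp_mul {α z : ℂ} (hα : 0 < α.re) (hz : 0 < (z + 1 / 2).re) :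
    Integrable (pmtIntegrand 0 (fun u => Complex.exp (α * u)) z) ∧
      ∀ t : ℝ, t ≠ 0 → ‖pmtIntegrand 0 (fun u => Complex.exp (α * u)) z t‖ ≤
        Real.exp (Real.pi * |z.im|) * (|t| ^ (2 * z.re) * Real.exp (-α.re * t ^ 2)) := by
  have hz' : -1 < 2 * z.re := by simp at hz; linarith
  have hle : ∀ t : ℝ, t ≠ 0 → ‖pmtIntegrand 0 (fun u => Complex.exp (α * u)) z t‖ ≤
        Real.exp (Real.pi * |z.im|) * (|t| ^ (2 * z.re) * Real.exp (-α.re * t ^ 2)) := by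
    intro t ht
    refine (norm_pmtIntegrand_le le_rfl ht _ z).trans (le_of_eq ?_)
    rw [Complex.norm_exp, mul_assoc, Complex.ofReal_zero, zero_add, mul_pow, Complex.I_sq]
    congr 3
    · simp
    · simp [← Complex.ofReal_pow]
  refine ⟨((integrable_abs_rpow_mul_exp_neg_mul_sq hz' hα).const_mul _).mono'
    (aestronglyMeasurable_pmtIntegrand ?_ z) (ae_ne_zero.mono hle), hle⟩
  exact Continuous.aestronglyMeasurable (by fun_prop)

/-! ### Monomial and logarithmic weights -/

theorem cpow_two_mul_mul_pow {w : ℂ} (hw : w ≠ 0) (z : ℂ) (k : ℕ) :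
    w ^ (2 * z) * (w ^ 2) ^ k = w ^ (2 * (z + k)) := by
  rw [mul_add, Complex.cpow_add _ _ hw, ← pow_mul, ← Complex.cpow_natCast w (2 * k)]
  push_cast
  rfl

theorem hasPMT_pow_mul_exp (k : ℕ) {σ : ℝ} (hσ : 0 < σ) (z : ℂ) :
    HasPMT σ (fun u => u ^ k * Complex.exp u) z (pmtG (z + k)) := by
  have h : pmtIntegrand σ (fun u => u ^ k * Complex.exp u) z =
      pmtIntegrand σ Complex.exp (z + k) := by
    ext t
    simp only [pmtIntegrand]
    rw [← mul_assoc, cpow_two_mul_mul_pow (line_ne_zero hσ t)]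
  have h1 := hasPMT_exp hσ (z + k)
  exact ⟨h ▸ h1.1, by rw [pmt, h]; exact h1.2⟩

theorem log_sq_of_re_pos {w : ℂ} (hw : 0 < w.re) : Complex.log (w ^ 2) = 2 * Complex.log w := by
  have h := abs_lt.1 (Complex.abs_arg_lt_pi_div_two_iff.2 (Or.inl hw))
  have hw0 := ne_zero_of_re_pos hw
  rw [pow_two, Complex.log_mul_eq_add_log_iff hw0 hw0 |>.2 ⟨by linarith, by linarith⟩]
  ring

/-- The `z`-derivative of `w ^ (2z)` is `w ^ (2z) * (2 log w)`, and `2 log w = log (w ^ 2)` because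
`|arg w| < π / 2`. So this is `G` differentiated under the integral. -/
theorem hasPMT_exp_mul_log {σ : ℝ} (hσ : 0 < σ) (z : ℂ) :
    HasPMT σ (fun u => Complex.exp u * Complex.log u) z (deriv pmtG z) := by
  have hw : IsGaussianWeight Complex.exp (σ + 1) 0 := by
    simpa using isGaussianWeight_exp_mul (α := 1) (by simp) (σ + 1)
  have hG : pmt σ Complex.exp = pmtG := funext fun z => (hasPMT_exp hσ z).2
  obtain ⟨h1, h2⟩ := hw.hasDerivAt hσ (lt_add_one σ) z
  have hd : (fun t => deriv (fun z => pmtIntegrand σ Complex.exp z t) z) =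
      pmtIntegrand σ (fun u => Complex.exp u * Complex.log u) z := by
    ext t
    have h0 := line_ne_zero hσ t
    have h3 := (((hasDerivAt_id z).const_mul 2).const_cpow (c := (σ : ℂ) + t * Complex.I)
      (Or.inl h0)).mul_const (Complex.exp (((σ : ℂ) + t * Complex.I) ^ 2))
    simp only [id_eq] at h3
    refine h3.deriv.trans ?_
    rw [pmtIntegrand, log_sq_of_re_pos (by simpa using hσ)]
    ring
  rw [hd] at h1 h2
  rw [hG] at h2
  exact ⟨h1, h2.deriv.symm⟩

theorem cos_pi_mul_ne_zero_add_half {z : ℂ} (hz : Complex.cos (Real.pi * z) ≠ 0) (m : ℕ) :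
    z + 1 / 2 ≠ -m := by
  intro h
  refine hz (Complex.cos_eq_zero_iff.2 ⟨-m - 1, ?_⟩)
  rw [show z = -m - 1 / 2 by linear_combination h]
  push_cast
  ring

/-- Logarithmic derivative of `cos (πz) Γ(s)`. Nonvanishing of the cosine is an open condition and
excludes the poles of `Γ(s)`. -/
theorem deriv_pmtG {z : ℂ} (hz : Complex.cos (Real.pi * z) ≠ 0) :
    deriv pmtG z = pmtG z * (Complex.digamma (z + 1 / 2) -
      Real.pi * Complex.tan (Real.pi * z)) := by
  have hs := cos_pi_mul_ne_zero_add_half hz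
  have hev : pmtG =ᶠ[𝓝 z] fun z => Complex.cos (Real.pi * z) * Complex.Gamma (z + 1 / 2) := by
    have hc : Continuous fun z : ℂ => Complex.cos (Real.pi * z) := by fun_prop
    filter_upwards [hc.continuousAt.eventually_ne hz] with y hy
    exact pmtG_eq_cos_mul_Gamma (cos_pi_mul_ne_zero_add_half hy)
  have h1 : HasDerivAt (fun z : ℂ => Complex.cos (Real.pi * z))
      (-Complex.sin (Real.pi * z) * Real.pi) z := by
    simpa using ((hasDerivAt_id z).const_mul (Real.pi : ℂ)).ccos
  have h2 : HasDerivAt (fun z : ℂ => Complex.Gamma (z + 1 / 2))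
      (deriv Complex.Gamma (z + 1 / 2)) z :=
    ((Complex.differentiableAt_Gamma _ hs).hasDerivAt).comp_add_const z (1 / 2)
  rw [hev.deriv_eq, hev.self_of_nhds, (h1.fun_mul h2).deriv, Complex.digamma_def, logDeriv_apply,
    Complex.tan]
  have hΓ := Complex.Gamma_ne_zero hs
  beta_reduce
  generalize Complex.Gamma (z + 1 / 2) = g at hΓ ⊢
  generalize deriv Complex.Gamma (z + 1 / 2) = g'
  field_simp
  ring

/-! ### Fresnel weights -/

theorem hasPMT_exp_mul_of_nonneg {α : ℂ} (hα : 0 < α.re) {σ : ℝ} (hσ : 0 ≤ σ) {z : ℂ}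
    (h : 0 < σ ∨ 0 < (z + 1 / 2).re) :
    HasPMT σ (fun u => Complex.exp (α * u)) z (α ^ (-(z + 1 / 2)) * pmtG z) := by
  rcases hσ.eq_or_lt with rfl | hσ
  · have hz := h.resolve_left (lt_irrefl _)
    exact ⟨(integrable_boundary_exp_mul hα hz).1, pmt_boundary_exp_mul hα hz⟩
  · exact hasPMT_exp_mul hα hσ z

theorem HasPMT.add {σ : ℝ} {f g : ℂ → ℂ} {z c c' : ℂ} (hf : HasPMT σ f z c)
    (hg : HasPMT σ g z c') : HasPMT σ (fun u => f u + g u) z (c + c') := by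
  have h : pmtIntegrand σ (fun u => f u + g u) z =
      fun t => pmtIntegrand σ f z t + pmtIntegrand σ g z t := by
    ext t; simp only [pmtIntegrand]; ring
  refine ⟨h ▸ hf.1.add hg.1, ?_⟩
  rw [pmt, h, integral_add hf.1 hg.1, ← hf.2, ← hg.2, pmt, pmt]

theorem HasPMT.const_mul {σ : ℝ} {f : ℂ → ℂ} {z c : ℂ} (a : ℂ) (hf : HasPMT σ f z c) :
    HasPMT σ (fun u => a * f u) z (a * c) := by
  have h : pmtIntegrand σ (fun u => a * f u) z = fun t => a * pmtIntegrand σ f z t := by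
    ext t; simp only [pmtIntegrand]; ring
  refine ⟨h ▸ hf.1.const_mul a, ?_⟩
  rw [pmt, h, integral_const_mul, ← hf.2, pmt]

section Fresnel

variable (a b : ℂ)

/-- The Abel factor moves the purely oscillating exponents `± i` to `ε ± i`, where the scaled
Gaussian formula applies. -/
theorem abelWeight_eq (ε : ℝ) :
    abelWeight ε (fun u => a * Complex.exp (Complex.I * u) + b * Complex.exp (-Complex.I * u)) =
      fun u => a * Complex.exp ((ε + Complex.I) * u) + b * Complex.exp ((ε - Complex.I) * u) := by
  ext u
  rw [abelWeight, add_mul (ε : ℂ), sub_mul (ε : ℂ), sub_eq_add_neg, Complex.exp_add,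
    Complex.exp_add, neg_mul]
  ring

theorem hasPMT_abelWeight {ε : ℝ} (hε : 0 < ε) {σ : ℝ} (hσ : 0 ≤ σ) {z : ℂ}
    (h : 0 < σ ∨ 0 < (z + 1 / 2).re) :
    HasPMT σ (abelWeight ε
      (fun u => a * Complex.exp (Complex.I * u) + b * Complex.exp (-Complex.I * u))) z
      (a * ((ε + Complex.I) ^ (-(z + 1 / 2)) * pmtG z) +
        b * ((ε - Complex.I) ^ (-(z + 1 / 2)) * pmtG z)) := by
  rw [abelWeight_eq]
  exact ((hasPMT_exp_mul_of_nonneg (by simpa using hε) hσ h).const_mul a).add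
    ((hasPMT_exp_mul_of_nonneg (by simpa using hε) hσ h).const_mul b)

/-- The points `± i` are off the branch cut, so `(ε ± i) ^ (-s)` tends to `e ^ (∓ iπs/2)`. -/
theorem tendsto_abel_value (z : ℂ) :
    Tendsto (fun ε : ℝ => a * ((ε + Complex.I) ^ (-(z + 1 / 2)) * pmtG z) +
        b * ((ε - Complex.I) ^ (-(z + 1 / 2)) * pmtG z)) (𝓝[>] 0)
      (𝓝 (a * (Complex.exp (-(Real.pi / 2 * (z + 1 / 2) * Complex.I)) * pmtG z) +
        b * (Complex.exp (Real.pi / 2 * (z + 1 / 2) * Complex.I) * pmtG z))) := by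
  have h0 : Tendsto (fun ε : ℝ => (ε : ℂ)) (𝓝[>] 0) (𝓝 0) := by
    simpa using (Complex.continuous_ofReal.tendsto 0).mono_left nhdsWithin_le_nhds
  have hI : Complex.I ^ (-(z + 1 / 2)) =
      Complex.exp (-(Real.pi / 2 * (z + 1 / 2) * Complex.I)) := by
    rw [Complex.cpow_def_of_ne_zero Complex.I_ne_zero, Complex.log_I]
    ring_nf
  have hI' : (-Complex.I) ^ (-(z + 1 / 2)) =
      Complex.exp (Real.pi / 2 * (z + 1 / 2) * Complex.I) := by
    rw [Complex.cpow_def_of_ne_zero (neg_ne_zero.2 Complex.I_ne_zero), Complex.log_neg_I]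
    ring_nf
  have h1 : Tendsto (fun ε : ℝ => ((ε : ℂ) + Complex.I) ^ (-(z + 1 / 2))) (𝓝[>] 0)
      (𝓝 (Complex.I ^ (-(z + 1 / 2)))) := by
    refine (continuousAt_cpow_const (Or.inr (by simp))).tendsto.comp ?_
    simpa using h0.add_const Complex.I
  have h2 : Tendsto (fun ε : ℝ => ((ε : ℂ) - Complex.I) ^ (-(z + 1 / 2))) (𝓝[>] 0)
      (𝓝 ((-Complex.I) ^ (-(z + 1 / 2)))) := by
    refine (continuousAt_cpow_const (Or.inr (by simp))).tendsto.comp ?_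
    simpa using h0.sub_const Complex.I
  rw [← hI, ← hI']
  exact ((h1.mul_const _).const_mul a).add ((h2.mul_const _).const_mul b)

theorem hasAbelPMT_exp {σ : ℝ} (hσ : 0 ≤ σ) {z : ℂ} (h : 0 < σ ∨ 0 < (z + 1 / 2).re) :
    HasAbelPMT σ (fun u => a * Complex.exp (Complex.I * u) + b * Complex.exp (-Complex.I * u)) z
      (a * (Complex.exp (-(Real.pi / 2 * (z + 1 / 2) * Complex.I)) * pmtG z) +
        b * (Complex.exp (Real.pi / 2 * (z + 1 / 2) * Complex.I) * pmtG z)) := by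
  refine ⟨fun ε hε => (hasPMT_abelWeight a b hε hσ h).1,
    (tendsto_abel_value a b z).congr' ?_⟩
  filter_upwards [self_mem_nhdsWithin] with ε hε
  exact (hasPMT_abelWeight a b hε hσ h).2.symm

theorem hasAbelBoundaryPMT_exp (z : ℂ) :
    HasAbelBoundaryPMT
      (fun u => a * Complex.exp (Complex.I * u) + b * Complex.exp (-Complex.I * u)) z
      (a * (Complex.exp (-(Real.pi / 2 * (z + 1 / 2) * Complex.I)) * pmtG z) +
        b * (Complex.exp (Real.pi / 2 * (z + 1 / 2) * Complex.I) * pmtG z)) := by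
  refine ⟨_, fun ε hε => ⟨?_, ?_⟩, tendsto_abel_value a b z⟩
  · filter_upwards [self_mem_nhdsWithin] with σ hσ
    exact (hasPMT_abelWeight a b hε (le_of_lt hσ) (Or.inl hσ)).1
  · refine tendsto_const_nhds.congr' ?_
    filter_upwards [self_mem_nhdsWithin] with σ hσ
    exact (hasPMT_abelWeight a b hε (le_of_lt hσ) (Or.inl hσ)).2.symm

end Fresnel

theorem sin_eq_exp : Complex.sin = fun u => (-Complex.I / 2) * Complex.exp (Complex.I * u) +
    (Complex.I / 2) * Complex.exp (-Complex.I * u) := by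
  ext u
  rw [Complex.sin, mul_comm u Complex.I, neg_mul, mul_comm u Complex.I]
  ring_nf

theorem cos_eq_exp : Complex.cos = fun u => (1 / 2) * Complex.exp (Complex.I * u) +
    (1 / 2) * Complex.exp (-Complex.I * u) := by
  ext u
  rw [Complex.cos, neg_mul, neg_mul, mul_comm u Complex.I]
  ring

theorem fresnel_sin_value (z : ℂ) :
    (-Complex.I / 2) * (Complex.exp (-(Real.pi / 2 * (z + 1 / 2) * Complex.I)) * pmtG z) +
      (Complex.I / 2) * (Complex.exp (Real.pi / 2 * (z + 1 / 2) * Complex.I) * pmtG z) =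
      -pmtG z * Complex.sin (Real.pi / 2 * (z + 1 / 2)) := by
  rw [Complex.sin, neg_mul _ Complex.I]
  ring

theorem fresnel_cos_value (z : ℂ) :
    (1 / 2) * (Complex.exp (-(Real.pi / 2 * (z + 1 / 2) * Complex.I)) * pmtG z) +
      (1 / 2) * (Complex.exp (Real.pi / 2 * (z + 1 / 2) * Complex.I) * pmtG z) =
      pmtG z * Complex.cos (Real.pi / 2 * (z + 1 / 2)) := by
  rw [Complex.cos, neg_mul _ Complex.I]
  ring

/-! ### The rational weight -/

theorem continuous_line_cpow {σ : ℝ} (hσ : 0 < σ) (z : ℂ) :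
    Continuous fun t : ℝ => ((σ : ℂ) + t * Complex.I) ^ (2 * z) :=
  Continuous.cpow (by fun_prop) continuous_const (line_mem_slitPlane hσ)

theorem one_sub_line_sq_re (σ t : ℝ) :
    (1 - ((σ : ℂ) + t * Complex.I) ^ 2).re = 1 - σ ^ 2 + t ^ 2 := by
  simp [pow_two]
  ring

/-- The integrand decays like `|t| ^ (2 Re z - 2)`, which is integrable for `Re z < 1/2`. Since `σ <
1`, `σ ^ 2 + t ^ 2` lies between `σ ^ 2 (1 + t ^ 2)` and `1 + t ^ 2`, which handles both signs of
`Re z`. -/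
theorem integrable_rational_bound {σ : ℝ} (hσ : 0 < σ) (hσ1 : σ < 1) {z : ℂ} (hz : z.re < 1 / 2) :
    Integrable fun t : ℝ => ‖((σ : ℂ) + t * Complex.I) ^ (2 * z)‖ * (1 - σ ^ 2 + t ^ 2)⁻¹ := by
  have hσ2 : 0 < 1 - σ ^ 2 := by nlinarith
  have hpos : ∀ t : ℝ, 0 < 1 - σ ^ 2 + t ^ 2 := fun t => by positivity
  have hB : Integrable fun t : ℝ => (1 + ‖t‖ ^ 2) ^ (-(2 - 2 * z.re) / 2) :=
    integrable_rpow_neg_one_add_norm_sq (by simp; linarith)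
  refine (hB.const_mul (Real.exp (Real.pi * |z.im|) * ((1 + (σ ^ 2) ^ z.re) *
    (1 - σ ^ 2)⁻¹))).mono' ?_ (Eventually.of_forall fun t => ?_)
  · exact ((continuous_line_cpow hσ z).norm.mul
      (Continuous.inv₀ (by fun_prop) fun t => (hpos t).ne')).aestronglyMeasurable
  · have h1 := norm_cpow_two_mul_le (w := (σ : ℂ) + t * Complex.I) (by simpa using hσ.le)
      (line_ne_zero hσ t) z
    have hn : ‖(σ : ℂ) + t * Complex.I‖ ^ (2 * z.re) = (σ ^ 2 + t ^ 2) ^ z.re := by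
      rw [Real.rpow_mul (norm_nonneg _), Real.rpow_two, ← Complex.normSq_eq_norm_sq,
        Complex.normSq_add_mul_I]
    have hpow : (σ ^ 2 + t ^ 2) ^ z.re ≤ (1 + (σ ^ 2) ^ z.re) * (1 + t ^ 2) ^ z.re := by
      rcases le_or_gt 0 z.re with h | h
      · calc (σ ^ 2 + t ^ 2) ^ z.re ≤ (1 + t ^ 2) ^ z.re := by gcongr; linarith
          _ ≤ _ := le_mul_of_one_le_left (by positivity) (by simp; positivity)
      · calc (σ ^ 2 + t ^ 2) ^ z.re ≤ (σ ^ 2 * (1 + t ^ 2)) ^ z.re := by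
              refine Real.rpow_le_rpow_of_nonpos (by positivity) ?_ h.le
              nlinarith [sq_nonneg t]
          _ = (σ ^ 2) ^ z.re * (1 + t ^ 2) ^ z.re := Real.mul_rpow (by positivity) (by positivity)
          _ ≤ _ := by gcongr; simp
    have hinv : (1 - σ ^ 2 + t ^ 2)⁻¹ ≤ (1 - σ ^ 2)⁻¹ * (1 + t ^ 2)⁻¹ := by
      rw [← mul_inv]
      exact inv_anti₀ (by positivity) (by nlinarith [sq_nonneg t, sq_nonneg σ])
    rw [hn] at h1
    rw [norm_mul, norm_norm, Real.norm_of_nonneg (inv_nonneg.2 (hpos t).le)]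
    calc ‖((σ : ℂ) + t * Complex.I) ^ (2 * z)‖ * (1 - σ ^ 2 + t ^ 2)⁻¹
        ≤ (Real.exp (Real.pi * |z.im|) * ((1 + (σ ^ 2) ^ z.re) * (1 + t ^ 2) ^ z.re)) *
            ((1 - σ ^ 2)⁻¹ * (1 + t ^ 2)⁻¹) := by
          refine mul_le_mul (h1.trans ?_) hinv (inv_nonneg.2 (hpos t).le) (by positivity)
          gcongr
      _ = _ := by
          rw [show -(2 - 2 * z.re) / 2 = z.re + -1 by ring, Real.rpow_add (by positivity),
            Real.rpow_neg_one, Real.norm_eq_abs, sq_abs]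
          ring

/-- On the line `Re (1 - w ^ 2) = 1 - σ ^ 2 + t ^ 2 > 0`, so `1 / (1 - u)` is the integral of `e ^
(-r) e ^ (ru)` over `r > 0`. By Fubini and the scaled Gaussian, the transform is `G(z)` times the
integral of `r ^ (-s) e ^ (-r)`. That is `G(z) Γ(1 - s) = π`. -/
theorem hasPMT_rational {σ : ℝ} (hσ : 0 < σ) (hσ1 : σ < 1) {z : ℂ} (hz : z.re < 1 / 2) :
    HasPMT σ (fun u => 1 / (1 - u)) z Real.pi := by
  have hσ2 : 0 < 1 - σ ^ 2 := by nlinarith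
  have hpos : ∀ t : ℝ, 0 < 1 - σ ^ 2 + t ^ 2 := fun t => by positivity
  have hre := one_sub_line_sq_re σ
  have hne : ∀ t : ℝ, 1 - ((σ : ℂ) + t * Complex.I) ^ 2 ≠ 0 := fun t =>
    ne_zero_of_re_pos (by rw [hre]; exact hpos t)
  have hbound := integrable_rational_bound hσ hσ1 hz
  set F : ℝ → ℝ → ℂ := fun t r => ((σ : ℂ) + t * Complex.I) ^ (2 * z) *
    Complex.exp (-(1 - ((σ : ℂ) + t * Complex.I) ^ 2) * r) with hF
  have hneg : ∀ t : ℝ, (-(1 - ((σ : ℂ) + t * Complex.I) ^ 2)).re < 0 := fun t => by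
    rw [Complex.neg_re, hre]; linarith [hpos t]
  have hint : ∀ t : ℝ, ∫ r in Ioi (0 : ℝ), F t r = pmtIntegrand σ (fun u => 1 / (1 - u)) z t := by
    intro t
    rw [hF]
    simp only
    rw [integral_const_mul, integral_exp_mul_complex_Ioi (hneg t), pmtIntegrand,
      Complex.ofReal_zero, mul_zero, Complex.exp_zero, neg_div_neg_eq]
  have hnorm : ∀ t r : ℝ, ‖F t r‖ = ‖((σ : ℂ) + t * Complex.I) ^ (2 * z)‖ *
      Real.exp (-(1 - σ ^ 2 + t ^ 2) * r) := by
    intro t r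
    rw [hF]
    simp only
    rw [norm_mul, Complex.norm_exp, Complex.re_mul_ofReal, Complex.neg_re, hre]
  have hprod : Integrable (Function.uncurry F) (volume.prod (volume.restrict (Ioi 0))) := by
    have hmeas : AEStronglyMeasurable (Function.uncurry F)
        ((volume : Measure ℝ).prod (volume.restrict (Ioi 0))) := by
      refine Continuous.aestronglyMeasurable ?_
      refine Continuous.mul ((continuous_line_cpow hσ z).comp continuous_fst) ?_
      fun_prop
    refine (integrable_prod_iff hmeas).2 ⟨Eventually.of_forall fun t => ?_, ?_⟩
    · exact (integrableOn_exp_mul_complex_Ioi (hneg t) 0).const_mul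
        (((σ : ℂ) + t * Complex.I) ^ (2 * z))
    · refine hbound.congr (Eventually.of_forall fun t => ?_)
      simp only [Function.uncurry, hnorm]
      rw [integral_const_mul, integral_exp_mul_Ioi (by linarith [hpos t]), mul_zero, Real.exp_zero,
        neg_div_neg_eq, one_div]
  refine ⟨?_, ?_⟩
  · refine hbound.mono' (Continuous.aestronglyMeasurable ?_) (Eventually.of_forall fun t => ?_)
    · exact (continuous_line_cpow hσ z).mul (Continuous.div continuous_const (by fun_prop) hne)
    · rw [pmtIntegrand, norm_mul, norm_div, norm_one, one_div, ← hre]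
      gcongr
      · rw [hre]; exact hpos t
      · exact Complex.re_le_norm _
  · have hs : 0 < (1 - (z + 1 / 2)).re := by
      simp
      linarith
    rw [pmt, ← integral_congr_ae (Eventually.of_forall hint), integral_integral_swap hprod]
    have hinner : ∀ r ∈ Ioi (0 : ℝ), ∫ t : ℝ, F t r = pmtG z *
        ((r : ℂ) ^ ((1 - (z + 1 / 2)) - 1) * Complex.exp (-(1 * r))) := by
      intro r hr
      have h1 := pmt_exp_mul (α := r) (by simpa using hr) hσ z
      rw [show (1 - (z + 1 / 2)) - 1 = -(z + 1 / 2) by ring, ← mul_assoc, mul_comm (pmtG z), ← h1,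
        pmt, ← integral_mul_const]
      refine integral_congr_ae (Eventually.of_forall fun t => ?_)
      simp only [hF, pmtIntegrand]
      rw [mul_assoc, ← Complex.exp_add]
      ring_nf
    rw [setIntegral_congr_fun measurableSet_Ioi hinner, integral_const_mul,
      integral_cpow_mul_exp_neg_mul_Ioi_of_re_pos (by simp) hs, pmtG_eq_pi_div_Gamma,
      Complex.one_cpow, one_mul, div_mul_cancel₀ _ (Complex.Gamma_ne_zero_of_re_pos hs)]

/-! ### Kummer's transformation -/

theorem ascPochhammer_succ_eval_left (n : ℕ) (a : ℂ) :
    (ascPochhammer ℂ (n + 1)).eval a = a * (ascPochhammer ℂ n).eval (a + 1) := by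
  rw [ascPochhammer_succ_left]
  simp

theorem ascPochhammer_eval_ne_zero {b : ℂ} (hb : ∀ m : ℕ, b ≠ -m) (n : ℕ) :
    (ascPochhammer ℂ n).eval b ≠ 0 := by
  induction n with
  | zero => simp
  | succ n ih =>
    rw [ascPochhammer_succ_eval]
    exact mul_ne_zero ih fun h => hb n (eq_neg_of_add_eq_zero_left h)

/-- The Chu–Vandermonde identity. -/
theorem sum_choose_mul_ascPochhammer_div (n : ℕ) (b c : ℂ) (hb : ∀ m : ℕ, b ≠ -m) :
    ∑ k ∈ Finset.range (n + 1), (n.choose k : ℂ) * ((-1) ^ k * (ascPochhammer ℂ k).eval c /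
      (ascPochhammer ℂ k).eval b) = (ascPochhammer ℂ n).eval (b - c) / (ascPochhammer ℂ n).eval b := by
  induction n generalizing b c with
  | zero => simp
  | succ n ih =>
    have hb1 : ∀ m : ℕ, b + 1 ≠ -m := fun m h => hb (m + 1) (by push_cast; linear_combination h)
    have hb0 : b ≠ 0 := by simpa using hb 0
    have h1 := Finset.sum_choose_succ_mul (fun k _ => (-1 : ℂ) ^ k * (ascPochhammer ℂ k).eval c /
      (ascPochhammer ℂ k).eval b) n
    rw [h1, ih b c hb]
    -- Pascal's rule has split the sum in two. Pulling out the first factors `c` and `b`, the second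
    -- half is the induction hypothesis for `(b + 1, c + 1)`.
    have h2 : ∑ i ∈ Finset.range (n + 1), (n.choose i : ℂ) * ((-1 : ℂ) ^ (i + 1) *
        (ascPochhammer ℂ (i + 1)).eval c / (ascPochhammer ℂ (i + 1)).eval b) =
        -(c / b) * ((ascPochhammer ℂ n).eval (b - c) / (ascPochhammer ℂ n).eval (b + 1)) := by
      rw [show b - c = (b + 1) - (c + 1) by ring, ← ih (b + 1) (c + 1) hb1, Finset.mul_sum]
      refine Finset.sum_congr rfl fun i _ => ?_
      have := ascPochhammer_eval_ne_zero hb1 i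
      rw [ascPochhammer_succ_eval_left, ascPochhammer_succ_eval_left, pow_succ]
      field_simp
    rw [h2, ascPochhammer_succ_eval n (b - c)]
    have h3 := ascPochhammer_eval_ne_zero hb n
    have h4 := ascPochhammer_eval_ne_zero hb1 n
    have h5 : b + n ≠ 0 := fun h => hb n (eq_neg_of_add_eq_zero_left h)
    have h6 := ascPochhammer_succ_eval_left n b
    rw [ascPochhammer_succ_eval] at h6
    have h7 : (ascPochhammer ℂ n).eval (b + 1) = (ascPochhammer ℂ n).eval b * (b + n) / b := by
      rw [eq_div_iff hb0]; linear_combination -h6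
    rw [h7, ascPochhammer_succ_eval]
    field_simp
    ring

/-- Cauchy product of the series on the right; equality of the `n`-th coefficients is
Chu–Vandermonde with `c = b - a`. -/
theorem kummerM_neg (a b x : ℂ) (hb : ∀ m : ℕ, b ≠ -m) :
    kummerM a b (-x) = Complex.exp (-x) * kummerM (b - a) b x := by
  have h1 : HasSum (fun n : ℕ => (-x) ^ n / (n.factorial : ℂ)) (Complex.exp (-x)) := by
    rw [Complex.exp_eq_exp_ℂ]
    exact NormedSpace.expSeries_div_hasSum_exp (-x)
  have h2 := hasSum_kummerM (b - a) b x hb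
  have h3 := tsum_mul_tsum_eq_tsum_sum_range_of_summable_norm h2.summable.norm h1.summable.norm
  rw [h1.tsum_eq, h2.tsum_eq] at h3
  rw [mul_comm, h3, ← (hasSum_kummerM a b (-x) hb).tsum_eq]
  refine tsum_congr fun n => ?_
  have h4 := sum_choose_mul_ascPochhammer_div n b (b - a) hb
  rw [sub_sub_cancel] at h4
  rw [← h4, Finset.sum_mul, Finset.sum_div]
  refine Finset.sum_congr rfl fun k hk => ?_
  have hkn : k ≤ n := Nat.lt_succ_iff.1 (Finset.mem_range.1 hk)
  have hch : (n.choose k : ℂ) = n.factorial / (k.factorial * (n - k).factorial) := by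
    rw [eq_div_iff (by exact_mod_cast mul_ne_zero k.factorial_ne_zero (n - k).factorial_ne_zero)]
    have := Nat.choose_mul_factorial_mul_factorial hkn
    rw [← this]
    push_cast
    ring
  have hx : (-x) ^ n = (-1) ^ k * x ^ k * (-x) ^ (n - k) := by
    rw [← mul_pow, neg_one_mul, ← pow_add, Nat.add_sub_cancel' hkn]
  have hP := ascPochhammer_eval_ne_zero hb k
  have hn : (n.factorial : ℂ) ≠ 0 := by exact_mod_cast n.factorial_ne_zero
  have hk' : (k.factorial : ℂ) ≠ 0 := by exact_mod_cast k.factorial_ne_zero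
  have hnk : ((n - k).factorial : ℂ) ≠ 0 := by exact_mod_cast (n - k).factorial_ne_zero
  have hsq : ((-1 : ℂ) ^ k) * (-1) ^ k = 1 := by rw [← mul_pow]; simp
  rw [hch, hx]
  field_simp
  linear_combination (x ^ k * (-x) ^ (n - k) * Polynomial.eval (b - a) (ascPochhammer ℂ k)) * hsq

/-! ### Shifted reciprocal Gamma values and even and odd factorials as Pochhammer symbols -/

theorem Gamma_sub_nat_inv (b : ℂ) (m : ℕ) :
    (Complex.Gamma (b - m))⁻¹ =
      (-1) ^ m * (ascPochhammer ℂ m).eval (1 - b) * (Complex.Gamma b)⁻¹ := by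
  induction m with
  | zero => simp
  | succ m ih =>
    rw [Complex.one_div_Gamma_eq_self_mul_one_div_Gamma_add_one,
      show b - (m + 1 : ℕ) + 1 = b - m by push_cast; ring, ih, ascPochhammer_succ_eval]
    push_cast
    ring

theorem factorial_two_mul_eq (m : ℕ) :
    ((2 * m).factorial : ℂ) = 4 ^ m * m.factorial * (ascPochhammer ℂ m).eval (1 / 2) := by
  induction m with
  | zero => simp
  | succ m ih =>
    rw [show 2 * (m + 1) = 2 * m + 1 + 1 by ring, Nat.factorial_succ, Nat.factorial_succ,
      ascPochhammer_succ_eval, Nat.factorial_succ]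
    push_cast
    rw [ih]
    ring

theorem factorial_two_mul_add_one_eq (m : ℕ) :
    ((2 * m + 1).factorial : ℂ) = 4 ^ m * m.factorial * (ascPochhammer ℂ m).eval (3 / 2) := by
  induction m with
  | zero => simp
  | succ m ih =>
    rw [show 2 * (m + 1) + 1 = 2 * m + 1 + 1 + 1 by ring, Nat.factorial_succ, Nat.factorial_succ,
      ascPochhammer_succ_eval, Nat.factorial_succ m]
    push_cast
    rw [ih]
    ring

/-! ### The perturbed exponential -/

theorem half_cpow_neg (x : ℂ) : (1 / 2 : ℂ) ^ (-x) = 2 ^ x := by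
  rw [one_div, Complex.inv_cpow, Complex.cpow_neg, inv_inv]
  rw [← Complex.ofReal_ofNat, Complex.arg_ofReal_of_nonneg (by norm_num)]
  exact Real.pi_pos.ne

theorem cpow_two_mul_add_half_nat {w : ℂ} (hw : w ≠ 0) (z : ℂ) (n : ℕ) :
    w ^ (2 * (z + n / 2)) = w ^ (2 * z) * w ^ n := by
  rw [show 2 * (z + n / 2) = 2 * z + n by ring, Complex.cpow_add _ _ hw, Complex.cpow_natCast]

/-- In the right half plane the principal root of `w ^ 2` is `w`, so the perturbation is `e ^
(-λw)`, entire in `w`. -/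
theorem pmtIntegrand_perturbed {σ : ℝ} (hσ : 0 < σ) (l z : ℂ) (t : ℝ) :
    pmtIntegrand σ (fun u => Complex.exp (u / 2 - l * u ^ (1 / 2 : ℂ))) z t =
      pmtIntegrand σ (fun u => Complex.exp (1 / 2 * u)) z t *
        Complex.exp (-(l * ((σ : ℂ) + t * Complex.I))) := by
  have h := Complex.sq_cpow_two_inv (x := (σ : ℂ) + t * Complex.I) (by simpa using hσ)
  simp only [pmtIntegrand, one_div]
  rw [h, mul_assoc, ← Complex.exp_add]
  ring_nf

/-- Expand `e ^ (-λw)`. The partial sums are dominated by `‖E t‖ exp (‖λ‖ ‖w‖)`, integrable by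
Gaussian decay. A factor `w ^ n` shifts `z` to `z + n/2` in the transform of `e ^ (u/2)`. -/
theorem hasSum_pmt_perturbed {σ : ℝ} (hσ : 0 < σ) (l z : ℂ) :
    Integrable (pmtIntegrand σ (fun u => Complex.exp (u / 2 - l * u ^ (1 / 2 : ℂ))) z) ∧
    HasSum (fun n : ℕ => (-l) ^ n / (n.factorial : ℂ) *
        (2 ^ (z + n / 2 + 1 / 2) * pmtG (z + n / 2)))
      (pmt σ (fun u => Complex.exp (u / 2 - l * u ^ (1 / 2 : ℂ))) z) := by
  have hhalf : (0 : ℝ) < (1 / 2 : ℂ).re := by norm_num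
  have hw := isGaussianWeight_exp_mul hhalf (σ + 1)
  set W : ℝ → ℂ := fun t => (σ : ℂ) + t * Complex.I with hW
  set E : ℝ → ℂ := pmtIntegrand σ (fun u => Complex.exp (1 / 2 * u)) z with hE
  obtain ⟨K, c, hc, hle⟩ := hw.exists_bound hσ le_rfl (lt_add_one σ) ‖z‖
  have hEle : ∀ t, ‖E t‖ ≤ K * Real.exp (-c * t ^ 2) := fun t => by
    simpa [hE, hW, pmtIntegrand] using hle (W t) z (by simp [hW]) (by simp [hW]) le_rfl
  have hEm : AEStronglyMeasurable E := hw.aestronglyMeasurable hσ (lt_add_one σ) z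
  have hB : Integrable fun t => ‖E t‖ * Real.exp (‖l‖ * ‖W t‖) := by
    refine ((integrable_exp_neg_mul_sq (half_pos hc)).const_mul
      (K * (Real.exp (‖l‖ * σ) * Real.exp (‖l‖ ^ 2 / (2 * c))))).mono' ?_
      (Eventually.of_forall fun t => ?_)
    · refine hEm.norm.mul (Continuous.aestronglyMeasurable ?_)
      fun_prop
    · have h1 : ‖W t‖ ≤ σ + |t| := by
        have := Complex.norm_le_abs_re_add_abs_im (W t)
        simpa [hW, abs_of_pos hσ] using this
      have h2 : Real.exp (‖l‖ * ‖W t‖) ≤ Real.exp (‖l‖ * σ) *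
          (Real.exp (‖l‖ ^ 2 / (2 * c)) * Real.exp (c / 2 * t ^ 2)) := by
        refine le_trans ?_ (mul_le_mul_of_nonneg_left (exp_mul_abs_le ‖l‖ hc t)
          (Real.exp_pos _).le)
        rw [← Real.exp_add, ← mul_add]
        gcongr
      have h3 : Real.exp (-c * t ^ 2) * Real.exp (c / 2 * t ^ 2) =
          Real.exp (-(c / 2) * t ^ 2) := by
        rw [← Real.exp_add]; ring_nf
      rw [norm_mul, norm_norm, Real.norm_of_nonneg (Real.exp_pos _).le]
      calc _ ≤ (K * Real.exp (-c * t ^ 2)) * (Real.exp (‖l‖ * σ) *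
          (Real.exp (‖l‖ ^ 2 / (2 * c)) * Real.exp (c / 2 * t ^ 2))) :=
            mul_le_mul (hEle t) h2 (Real.exp_pos _).le ((norm_nonneg _).trans (hEle t))
        _ = _ := by rw [← h3]; ring
  have hexp : ∀ x : ℝ, HasSum (fun n : ℕ => x ^ n / (n.factorial : ℝ)) (Real.exp x) := fun x => by
    rw [Real.exp_eq_exp_ℝ]; exact NormedSpace.expSeries_div_hasSum_exp x
  have hcexp : ∀ x : ℂ, HasSum (fun n : ℕ => x ^ n / (n.factorial : ℂ)) (Complex.exp x) :=
    fun x => by rw [Complex.exp_eq_exp_ℂ]; exact NormedSpace.expSeries_div_hasSum_exp x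
  have hfun : pmtIntegrand σ (fun u => Complex.exp (u / 2 - l * u ^ (1 / 2 : ℂ))) z =
      fun t => E t * Complex.exp (-(l * W t)) := funext fun t => pmtIntegrand_perturbed hσ l z t
  refine ⟨?_, ?_⟩
  · rw [hfun]
    refine hB.mono' (hEm.mul (Continuous.aestronglyMeasurable (by fun_prop)))
      (Eventually.of_forall fun t => ?_)
    rw [norm_mul, Complex.norm_exp]
    gcongr
    calc (-(l * W t)).re ≤ ‖-(l * W t)‖ := Complex.re_le_norm _
      _ = _ := by rw [norm_neg, norm_mul]
  · have key := hasSum_integral_of_dominated_convergence (μ := volume)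
      (F := fun (n : ℕ) t => E t * ((-(l * W t)) ^ n / (n.factorial : ℂ)))
      (f := fun t => E t * Complex.exp (-(l * W t)))
      (fun (n : ℕ) t => ‖E t‖ * ((‖l‖ * ‖W t‖) ^ n / (n.factorial : ℝ)))
      (fun n => hEm.mul (Continuous.aestronglyMeasurable (by fun_prop)))
      (fun n => Eventually.of_forall fun t => by simp [mul_pow])
      (Eventually.of_forall fun t => ((hexp _).mul_left _).summable)
      (hB.congr (Eventually.of_forall fun t => (((hexp _).mul_left _).tsum_eq).symm))
      (Eventually.of_forall fun t => (hcexp _).mul_left _)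
    rw [pmt, hfun]
    refine key.congr_fun fun n => ?_
    have h1 := pmt_exp_mul hhalf hσ (z + n / 2)
    rw [half_cpow_neg] at h1
    rw [← h1, pmt, ← integral_const_mul]
    refine integral_congr_ae (Eventually.of_forall fun t => ?_)
    simp only [hE, pmtIntegrand]
    rw [cpow_two_mul_add_half_nat (line_ne_zero hσ t), neg_mul_eq_neg_mul, mul_pow]
    ring

theorem cpow_half_two : (2 : ℂ) ^ (1 / 2 : ℂ) = (√2 : ℂ) := by
  rw [Real.sqrt_eq_rpow, Complex.ofReal_cpow (by norm_num)]
  norm_num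

/-- For `n = 2m` the value `G(z + m)` contributes `(-1) ^ m (s)_m` and `(2m)! = 4 ^ m m! (1/2)_m`,
which is a Kummer series at `-λ ^ 2 / 2`. Odd `n` works in the same way with `(3/2)_m` and `1 /
Γ(-z)`. -/
theorem hasSum_even_part (l z : ℂ) :
    HasSum (fun m : ℕ => (-l) ^ (2 * m) / ((2 * m).factorial : ℂ) *
        (2 ^ (z + (2 * m : ℕ) / 2 + 1 / 2) * pmtG (z + (2 * m : ℕ) / 2)))
      (2 ^ z * (√2 : ℂ) * (Real.pi * (Complex.Gamma (1 / 2 - z))⁻¹) *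
        kummerM (z + 1 / 2) (1 / 2) (-(l ^ 2 / 2))) := by
  have hb : ∀ m : ℕ, (1 / 2 : ℂ) ≠ -m := fun m h => by
    have := congrArg Complex.re h
    norm_num at this
    linarith [(m.cast_nonneg : (0 : ℝ) ≤ m)]
  refine ((hasSum_kummerM (z + 1 / 2) (1 / 2) (-(l ^ 2 / 2)) hb).mul_left
    (2 ^ z * (√2 : ℂ) * (Real.pi * (Complex.Gamma (1 / 2 - z))⁻¹))).congr_fun fun m => ?_
  have hP := ascPochhammer_eval_ne_zero hb m
  have hm : (m.factorial : ℂ) ≠ 0 := by exact_mod_cast m.factorial_ne_zero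
  have hz : z + ((2 * m : ℕ) : ℂ) / 2 = z + m := by push_cast; ring
  have h2 : (2 : ℂ) ^ (z + m + 1 / 2) = 2 ^ z * (√2 : ℂ) * 2 ^ m := by
    rw [Complex.cpow_add _ _ two_ne_zero, Complex.cpow_add _ _ two_ne_zero, Complex.cpow_natCast,
      cpow_half_two]
    ring
  have h4 : (4 : ℂ) ^ m = 2 ^ m * 2 ^ m := by rw [← mul_pow]; norm_num
  rw [hz, h2, pmtG_eq, show 1 / 2 - (z + m) = (1 / 2 - z) - m by ring, Gamma_sub_nat_inv,
    factorial_two_mul_eq, h4, show 1 - (1 / 2 - z) = z + 1 / 2 by ring, pow_mul, neg_sq,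
    neg_pow (l ^ 2 / 2), div_pow]
  field_simp

theorem hasSum_odd_part (l z : ℂ) :
    HasSum (fun m : ℕ => (-l) ^ (2 * m + 1) / ((2 * m + 1).factorial : ℂ) *
        (2 ^ (z + (2 * m + 1 : ℕ) / 2 + 1 / 2) * pmtG (z + (2 * m + 1 : ℕ) / 2)))
      (-(l * 2 ^ z * 2 * (Real.pi * (Complex.Gamma (-z))⁻¹)) *
        kummerM (z + 1) (3 / 2) (-(l ^ 2 / 2))) := by
  have hb : ∀ m : ℕ, (3 / 2 : ℂ) ≠ -m := fun m h => by
    have := congrArg Complex.re h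
    norm_num at this
    linarith [(m.cast_nonneg : (0 : ℝ) ≤ m)]
  refine ((hasSum_kummerM (z + 1) (3 / 2) (-(l ^ 2 / 2)) hb).mul_left
    (-(l * 2 ^ z * 2 * (Real.pi * (Complex.Gamma (-z))⁻¹)))).congr_fun fun m => ?_
  have hP := ascPochhammer_eval_ne_zero hb m
  have hm : (m.factorial : ℂ) ≠ 0 := by exact_mod_cast m.factorial_ne_zero
  have hz : z + ((2 * m + 1 : ℕ) : ℂ) / 2 = z + m + 1 / 2 := by push_cast; ring
  have h2 : (2 : ℂ) ^ (z + m + 1 / 2 + 1 / 2) = 2 ^ z * 2 * 2 ^ m := by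
    rw [show z + m + 1 / 2 + 1 / 2 = z + 1 + m by ring, Complex.cpow_add _ _ two_ne_zero,
      Complex.cpow_add _ _ two_ne_zero, Complex.cpow_natCast, Complex.cpow_one]
  have h4 : (4 : ℂ) ^ m = 2 ^ m * 2 ^ m := by rw [← mul_pow]; norm_num
  rw [hz, h2, pmtG_eq, show 1 / 2 - (z + m + 1 / 2) = -z - m by ring, Gamma_sub_nat_inv,
    factorial_two_mul_add_one_eq, h4, show 1 - -z = z + 1 by ring, pow_succ, pow_mul, neg_sq,
    neg_pow (l ^ 2 / 2), div_pow]
  field_simp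

/-- Kummer's transformation moves both series to `+λ ^ 2 / 2` at the price of `e ^ (-λ ^ 2 / 2)`.
Half of that exponent is the stated prefactor, the other half belongs to `D_{2z}`. -/
theorem hasPMT_perturbed {σ : ℝ} (hσ : 0 < σ) (l z : ℂ) :
    HasPMT σ (fun u => Complex.exp (u / 2 - l * u ^ (1 / 2 : ℂ))) z
      ((√(2 * Real.pi) : ℂ) * Complex.exp (-l ^ 2 / 4) * parabolicCylinderD (2 * z) l) := by
  obtain ⟨h1, h2⟩ := hasSum_pmt_perturbed hσ l z
  refine ⟨h1, ?_⟩
  rw [h2.unique ((hasSum_even_part l z).even_add_odd (hasSum_odd_part l z)), kummerM_neg,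
    kummerM_neg, parabolicCylinderD]
  · have hs : ((√(2 * Real.pi) : ℝ) : ℂ) = (√2 : ℂ) * (√Real.pi : ℂ) := by
      rw [Real.sqrt_mul (by norm_num)]; push_cast; rfl
    have hs2 : ((√2 : ℝ) : ℂ) * (√2 : ℂ) = 2 := by
      rw [← Complex.ofReal_mul, Real.mul_self_sqrt (by norm_num)]; norm_num
    have hsp : ((√Real.pi : ℝ) : ℂ) * (√Real.pi : ℂ) = Real.pi := by
      rw [← Complex.ofReal_mul, Real.mul_self_sqrt Real.pi_pos.le]
    have he : Complex.exp (-(l ^ 2 / 2)) = Complex.exp (-l ^ 2 / 4) * Complex.exp (-l ^ 2 / 4) := by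
      rw [← Complex.exp_add]; ring_nf
    rw [hs, he, show 2 * z / 2 = z by ring, show (1 - 2 * z) / 2 = 1 / 2 - z by ring,
      show -(2 * z) / 2 = -z by ring, show (1 : ℂ) / 2 - (z + 1 / 2) = -z by ring,
      show (3 : ℂ) / 2 - (z + 1) = 1 / 2 - z by ring, ← hsp]
    generalize Complex.exp (-l ^ 2 / 4) = e
    generalize kummerM (-z) (1 / 2) (l ^ 2 / 2) = M₁
    generalize kummerM (1 / 2 - z) (3 / 2) (l ^ 2 / 2) = M₂
    rw [div_eq_mul_inv, div_eq_mul_inv]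
    linear_combination (2 ^ z * e * e * l * M₂ * (√Real.pi : ℂ) * (√Real.pi : ℂ) *
      (Complex.Gamma (-z))⁻¹) * hs2
  · intro m h
    have := congrArg Complex.re h
    norm_num at this
    linarith [(m.cast_nonneg : (0 : ℝ) ≤ m)]
  · intro m h
    have := congrArg Complex.re h
    norm_num at this
    linarith [(m.cast_nonneg : (0 : ℝ) ≤ m)]

/-! ### Termwise integration on the boundary -/

theorem integral_abs_rpow_mul_exp_neg_mul_sq {p c : ℝ} (hp : -1 < p) (hc : 0 < c) :
    ∫ t : ℝ, |t| ^ p * Real.exp (-c * t ^ 2) = c ^ (-(p + 1) / 2) * Real.Gamma ((p + 1) / 2) := by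
  have h1 := integral_comp_abs (f := fun t : ℝ => t ^ p * Real.exp (-c * t ^ (2 : ℝ)))
  rw [integral_rpow_mul_exp_neg_mul_rpow two_pos hp hc] at h1
  simp only [Real.rpow_two, sq_abs] at h1
  rw [h1]
  ring

/-- On the boundary the `L¹` norm of the `n`-th term is at most a constant times `‖a n‖ (Re α n) ^
(-Re s)`. So `hsum` is exactly what allows the sum and the integral to be exchanged. -/
theorem hasSum_pmt_zero {f : ℂ → ℂ} {a α : ℕ → ℂ} {z : ℂ} (hα : ∀ n, 0 < (α n).re)
    (hz : 0 < (z + 1 / 2).re)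
    (hf : ∀ t : ℝ, t ≠ 0 → HasSum (fun n => a n * Complex.exp (α n * -(t : ℂ) ^ 2))
      (f (-(t : ℂ) ^ 2)))
    (hsum : Summable fun n => ‖a n‖ * (α n).re ^ (-(z + 1 / 2).re)) :
    HasSum (fun n => a n * (α n) ^ (-(z + 1 / 2)) * pmtG z) (pmt 0 f z) := by
  have hz' : -1 < 2 * z.re := by simp at hz; linarith
  have hint := fun n => integrable_boundary_exp_mul (hα n) hz
  have key := hasSum_integral_of_summable_integral_norm (μ := volume)
    (F := fun n t => a n * pmtIntegrand 0 (fun u => Complex.exp (α n * u)) z t)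
    (fun n => (hint n).1.const_mul _) ?_
  · have e1 : ∫ t : ℝ, ∑' n, a n * pmtIntegrand 0 (fun u => Complex.exp (α n * u)) z t =
        pmt 0 f z := by
      refine integral_congr_ae (ae_ne_zero.mono fun t ht => ?_)
      have h2 : (((0 : ℝ) : ℂ) + t * Complex.I) ^ 2 = -(t : ℂ) ^ 2 := by
        rw [Complex.ofReal_zero, zero_add, mul_pow, Complex.I_sq]; ring
      simp only [pmtIntegrand, h2]
      rw [← ((hf t ht).mul_left _).tsum_eq]
      exact tsum_congr fun n => by ring
    rw [e1] at key
    refine key.congr_fun fun n => ?_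
    rw [integral_const_mul]
    have := pmt_boundary_exp_mul (hα n) hz
    rw [pmt] at this
    rw [this, mul_assoc]
  · refine Summable.of_nonneg_of_le (fun n => integral_nonneg fun t => norm_nonneg _) (fun n => ?_)
      (hsum.mul_left (Real.exp (Real.pi * |z.im|) * Real.Gamma (z.re + 1 / 2)))
    have hre : (z + 1 / 2).re = z.re + 1 / 2 := by simp
    calc ∫ t : ℝ, ‖a n * pmtIntegrand 0 (fun u => Complex.exp (α n * u)) z t‖
        ≤ ∫ t : ℝ, ‖a n‖ * (Real.exp (Real.pi * |z.im|) *
            (|t| ^ (2 * z.re) * Real.exp (-(α n).re * t ^ 2))) := by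
          refine integral_mono_ae ((hint n).1.const_mul _).norm
            (((integrable_abs_rpow_mul_exp_neg_mul_sq hz' (hα n)).const_mul _).const_mul _)
            (ae_ne_zero.mono fun t ht => ?_)
          simp only [norm_mul]
          exact mul_le_mul_of_nonneg_left ((hint n).2 t ht) (norm_nonneg _)
      _ = _ := by
          rw [integral_const_mul, integral_const_mul,
            integral_abs_rpow_mul_exp_neg_mul_sq hz' (hα n), hre,
            show -(2 * z.re + 1) / 2 = -(z.re + 1 / 2) by ring,
            show (2 * z.re + 1) / 2 = z.re + 1 / 2 by ring]
          ring

/-! ### Exponential quotients -/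

/-- If `w ^ 2 = 2πin`, then `|Re w| = |Im w|` and `(Re w) ^ 2 = π |n|`. Besides `w = 0`, the first
such points have real part `√π`, which limits the admissible lines. -/
theorem exp_sq_ne_one {w : ℂ} (hw : 0 ≤ w.re) (hw' : w.re < √Real.pi) (hw0 : w ≠ 0) :
    Complex.exp (w ^ 2) ≠ 1 := by
  intro h
  obtain ⟨n, hn⟩ := Complex.exp_eq_one_iff.1 h
  have h1 : w.re * w.re = w.im * w.im := by
    have := congrArg Complex.re hn
    simp [pow_two] at this
    linarith
  have h2 : w.re * w.im = n * Real.pi := by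
    have := congrArg Complex.im hn
    simp [pow_two] at this
    linarith
  have h3 : w.re * w.re < Real.pi := by
    have := (Real.lt_sqrt hw).1 hw'
    nlinarith
  rcases eq_or_ne n 0 with rfl | hn0
  · have h4 : w.re = 0 := by
      rcases mul_eq_zero.1 (h2.trans (by simp)) with h | h
      · exact h
      · rw [h] at h1; simpa using h1
    have h5 : w.im = 0 := by rw [h4] at h1; simpa using h1.symm
    exact hw0 (Complex.ext h4 h5)
  · have h6 : (1 : ℝ) ≤ |(n : ℝ)| := by
      rw [← Int.cast_abs]
      exact_mod_cast Int.one_le_abs hn0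
    have h7 : |w.im| = w.re := by
      rw [← abs_of_nonneg hw]
      exact (abs_eq_abs.2 (mul_self_eq_mul_self_iff.1 h1)).symm
    have h8 : w.re * w.re = |(n : ℝ)| * Real.pi := by
      rw [← abs_of_pos Real.pi_pos, ← abs_mul, ← h2, abs_mul, abs_of_nonneg hw, h7]
    nlinarith [Real.pi_pos]

theorem exp_sq_ne_neg_one {w : ℂ} (hw : 0 ≤ w.re) (hw' : w.re < √(Real.pi / 2)) :
    Complex.exp (w ^ 2) ≠ -1 := by
  intro h
  have h2 : ((√2 : ℝ) : ℂ) ^ 2 = 2 := by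
    rw [← Complex.ofReal_pow, Real.sq_sqrt (by norm_num)]; norm_num
  refine exp_sq_ne_one (w := (√2 : ℝ) * w) (by simpa using by positivity) ?_ ?_ ?_
  · rw [Complex.re_ofReal_mul]
    calc √2 * w.re < √2 * √(Real.pi / 2) := by gcongr
      _ = √Real.pi := by rw [← Real.sqrt_mul (by norm_num)]; congr 1; ring
  · refine mul_ne_zero (by simp) fun h0 => ?_
    rw [h0] at h
    norm_num at h
  · rw [mul_pow, h2, two_mul, Complex.exp_add, h]
    norm_num

theorem isCompact_strip (s T : ℝ) : IsCompact (Icc 0 s ×ℂ Icc (-T) T) :=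
  isCompact_Icc.reProdIm isCompact_Icc

theorem exists_le_norm_of_continuous {g : ℂ → ℂ} (hg : Continuous g) {s : ℝ} (T : ℝ)
    (h : ∀ w : ℂ, 0 ≤ w.re → w.re ≤ s → g w ≠ 0) :
    ∃ m : ℝ, 0 < m ∧ ∀ w : ℂ, 0 ≤ w.re → w.re ≤ s → |w.im| ≤ T → m ≤ ‖g w‖ := by
  by_cases hne : (Icc 0 s ×ℂ Icc (-T) T).Nonempty
  · obtain ⟨w₀, hw₀, hmin⟩ := (isCompact_strip s T).exists_isMinOn hne hg.norm.continuousOn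
    refine ⟨‖g w₀‖, norm_pos_iff.2 (h w₀ hw₀.1.1 hw₀.1.2), fun w h1 h2 h3 => ?_⟩
    exact hmin ⟨⟨h1, h2⟩, abs_le.1 h3⟩
  · exact ⟨1, one_pos, fun w h1 h2 h3 => absurd ⟨w, ⟨h1, h2⟩, abs_le.1 h3⟩ hne⟩

theorem norm_exp_neg_sq_lt_one {t : ℝ} (ht : t ≠ 0) : ‖Complex.exp (-(t : ℂ) ^ 2)‖ < 1 := by
  rw [Complex.norm_exp, ← Complex.ofReal_pow, ← Complex.ofReal_neg, Complex.ofReal_re,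
    Real.exp_lt_one_iff]
  have : 0 < t ^ 2 := by positivity
  linarith

theorem one_sub_ne_zero_of_norm_lt_one {x : ℂ} (hx : ‖x‖ < 1) : 1 - x ≠ 0 := fun h => by
  rw [← sub_eq_zero.1 h] at hx
  simp at hx

theorem one_add_ne_zero_of_norm_lt_one {x : ℂ} (hx : ‖x‖ < 1) : 1 + x ≠ 0 := by
  have := one_sub_ne_zero_of_norm_lt_one (x := -x) (by simpa using hx)
  simpa using this

theorem sq_re (w : ℂ) : (w ^ 2).re = w.re ^ 2 - w.im ^ 2 := by
  simp [pow_two]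

theorem norm_exp_sq_le_half {w : ℂ} {s : ℝ} (hw : 0 ≤ w.re) (hws : w.re ≤ s)
    (ht : s + 1 ≤ |w.im|) : ‖Complex.exp (w ^ 2)‖ ≤ 1 / 2 := by
  rw [Complex.norm_exp, sq_re]
  have h1 : w.re ^ 2 - w.im ^ 2 ≤ -1 := by
    rw [← sq_abs w.im]
    nlinarith
  calc Real.exp (w.re ^ 2 - w.im ^ 2) ≤ Real.exp (-1) := Real.exp_le_exp.2 h1
    _ ≤ 1 / 2 := by
      rw [Real.exp_neg, one_div]
      refine inv_anti₀ two_pos ?_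
      linarith [Real.add_one_le_exp 1]

/-- This is `(e ^ (w ^ 2) - 1) / w ^ 2` with the singularity at `0` removed. It has no zeros in the
strip, so compactness bounds it from below up to the origin. -/
theorem continuous_dslope_exp : Continuous fun w : ℂ => dslope Complex.exp 0 (w ^ 2) := by
  have : ContinuousOn (dslope Complex.exp 0) univ :=
    (continuousOn_dslope univ_mem).2
      ⟨Complex.continuous_exp.continuousOn, Complex.differentiable_exp.differentiableAt⟩
  exact (continuousOn_univ.1 this).comp (by fun_prop)

/-- The growth exponent `2` comes from the double zero of `1 - e ^ (w ^ 2)` at the origin. The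
denominator is bounded below by compactness for `|Im w| ≤ s + 1`, and beyond that by `|e ^ (w ^ 2)|
≤ 1/2`. -/
theorem isGaussianWeight_hurwitzWeight {a : ℝ} (ha : 0 < a) :
    IsGaussianWeight (hurwitzWeight a) (√Real.pi) 2 where
  differentiableOn := by
    intro w hw
    refine DifferentiableAt.differentiableWithinAt ?_
    simp only [hurwitzWeight]
    refine DifferentiableAt.div (by fun_prop) (by fun_prop) ?_
    exact sub_ne_zero.2 (exp_sq_ne_one hw.1.le hw.2 (ne_zero_of_re_pos hw.1)).symm
  continuousAt := by
    intro t ht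
    unfold hurwitzWeight
    exact ContinuousAt.div (by fun_prop) (by fun_prop)
      (one_sub_ne_zero_of_norm_lt_one (norm_exp_neg_sq_lt_one ht))
  bound := by
    intro s hs hsπ
    have hd : ∀ w : ℂ, w ^ 2 * dslope Complex.exp 0 (w ^ 2) = Complex.exp (w ^ 2) - 1 := fun w => by
      have := sub_smul_dslope Complex.exp 0 (w ^ 2)
      simpa using this
    obtain ⟨m, hm, hmle⟩ := exists_le_norm_of_continuous continuous_dslope_exp (s := s) (s + 1)
      fun w h1 h2 h0 => by
        rcases eq_or_ne w 0 with rfl | hw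
        · simp [dslope_same] at h0
        · refine exp_sq_ne_one h1 (h2.trans_lt hsπ) hw ?_
          have := hd w
          rw [h0, mul_zero] at this
          exact (sub_eq_zero.1 this.symm)
    refine ⟨Real.exp (a * s ^ 2) * Real.exp (a / 2 * (s + 1) ^ 2) * m⁻¹ +
      2 * (s ^ 2 + 2 / a) * Real.exp (a * s ^ 2), a / 2, by positivity, half_pos ha,
      fun w hw hws => ?_⟩
    have hw0 : w ≠ 0 := ne_zero_of_re_pos hw
    have hn : 0 < ‖w‖ := norm_pos_iff.2 hw0
    have hnum : ‖Complex.exp (a * w ^ 2)‖ ≤ Real.exp (a * s ^ 2) * Real.exp (-a * w.im ^ 2) := by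
      rw [Complex.norm_exp, Complex.re_ofReal_mul, sq_re, ← Real.exp_add, Real.exp_le_exp]
      have : a * w.re ^ 2 ≤ a * s ^ 2 := by gcongr
      linarith
    have hrp : ‖w‖ ^ (-2 : ℝ) = (‖w‖ ^ 2)⁻¹ := by
      rw [Real.rpow_neg hn.le, Real.rpow_two]
    rw [hurwitzWeight, norm_div, hrp]
    rcases le_or_gt |w.im| (s + 1) with ht | ht
    · have h1 : ‖1 - Complex.exp (w ^ 2)‖ = ‖w‖ ^ 2 * ‖dslope Complex.exp 0 (w ^ 2)‖ := by
        rw [← norm_pow, ← norm_mul, hd, norm_sub_rev]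
      have h2 := hmle w hw.le hws ht
      have h3 : 1 ≤ Real.exp (a / 2 * (s + 1) ^ 2) * Real.exp (-(a / 2) * w.im ^ 2) := by
        rw [← Real.exp_add]
        refine Real.one_le_exp ?_
        have : w.im ^ 2 ≤ (s + 1) ^ 2 := by rw [← sq_abs]; gcongr
        nlinarith
      rw [h1]
      calc _ ≤ (Real.exp (a * s ^ 2) * 1) / (‖w‖ ^ 2 * m) := by
            gcongr
            refine hnum.trans ?_
            gcongr
            rw [Real.exp_le_one_iff]
            nlinarith [sq_nonneg w.im]
        _ ≤ (Real.exp (a * s ^ 2) * (Real.exp (a / 2 * (s + 1) ^ 2) *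
              Real.exp (-(a / 2) * w.im ^ 2))) / (‖w‖ ^ 2 * m) := by gcongr
        _ = (Real.exp (a * s ^ 2) * Real.exp (a / 2 * (s + 1) ^ 2) * m⁻¹) *
              ((‖w‖ ^ 2)⁻¹ * Real.exp (-(a / 2) * w.im ^ 2)) := by
            rw [div_eq_mul_inv, mul_inv]; ring
        _ ≤ _ := by
            gcongr
            exact le_add_of_nonneg_right (by positivity)
    · have h1 : 1 / 2 ≤ ‖1 - Complex.exp (w ^ 2)‖ := by
        have := norm_exp_sq_le_half hw.le hws ht.le
        have h2 := norm_sub_norm_le (1 : ℂ) (Complex.exp (w ^ 2))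
        rw [norm_one] at h2
        linarith
      -- Far from the origin the factor `‖w‖ ^ (-2)` in the target bound is a loss, paid for by half
      -- of the Gaussian.
      have h3 : ‖w‖ ^ 2 * Real.exp (-(a / 2) * w.im ^ 2) ≤ s ^ 2 + 2 / a := by
        have h4 : ‖w‖ ^ 2 = w.re ^ 2 + w.im ^ 2 := by
          rw [← Complex.normSq_eq_norm_sq, Complex.normSq_apply]; ring
        have h5 : w.re ^ 2 ≤ s ^ 2 := by gcongr
        have h6 : Real.exp (-(a / 2) * w.im ^ 2) ≤ 1 := by
          rw [Real.exp_le_one_iff]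
          nlinarith [sq_nonneg w.im]
        have h7 : w.im ^ 2 * Real.exp (-(a / 2) * w.im ^ 2) ≤ 2 / a := by
          rw [neg_mul, Real.exp_neg, ← div_eq_mul_inv, div_le_div_iff₀ (Real.exp_pos _) ha]
          nlinarith [Real.add_one_le_exp (a / 2 * w.im ^ 2)]
        rw [h4, add_mul]
        refine add_le_add ?_ h7
        calc _ ≤ s ^ 2 * 1 := by gcongr
          _ = _ := mul_one _
      have h8 : Real.exp (-a * w.im ^ 2) =
          Real.exp (-(a / 2) * w.im ^ 2) * Real.exp (-(a / 2) * w.im ^ 2) := by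
        rw [← Real.exp_add]; ring_nf
      calc _ ≤ (Real.exp (a * s ^ 2) * Real.exp (-a * w.im ^ 2)) / (1 / 2) := by gcongr
        _ = 2 * (‖w‖ ^ 2 * Real.exp (-(a / 2) * w.im ^ 2)) * Real.exp (a * s ^ 2) *
              ((‖w‖ ^ 2)⁻¹ * Real.exp (-(a / 2) * w.im ^ 2)) := by
            rw [h8]; field_simp
        _ ≤ 2 * (s ^ 2 + 2 / a) * Real.exp (a * s ^ 2) *
              ((‖w‖ ^ 2)⁻¹ * Real.exp (-(a / 2) * w.im ^ 2)) := by gcongr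
        _ ≤ _ := by
            gcongr
            exact le_add_of_nonneg_left (by positivity)

/-- At the origin the denominator is `2`, so there is no singularity and the growth exponent is `0`.
-/
theorem isGaussianWeight_etaWeight : IsGaussianWeight etaWeight (√(Real.pi / 2)) 0 where
  differentiableOn := by
    intro w hw
    refine DifferentiableAt.differentiableWithinAt ?_
    simp only [etaWeight]
    refine DifferentiableAt.div (by fun_prop) (by fun_prop) fun h => ?_
    exact exp_sq_ne_neg_one hw.1.le hw.2 (by linear_combination h)
  continuousAt := by
    intro t ht
    unfold etaWeight
    exact ContinuousAt.div (by fun_prop) (by fun_prop)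
      (one_add_ne_zero_of_norm_lt_one (norm_exp_neg_sq_lt_one ht))
  bound := by
    intro s hs hsπ
    obtain ⟨m, hm, hmle⟩ := exists_le_norm_of_continuous (g := fun w => 1 + Complex.exp (w ^ 2))
      (by fun_prop) (s := s) (s + 1)
      fun w h1 h2 h0 => exp_sq_ne_neg_one h1 (h2.trans_lt hsπ) (by linear_combination h0)
    refine ⟨Real.exp (s ^ 2) * (m⁻¹ + 2), 1, by positivity, one_pos, fun w hw hws => ?_⟩
    have hnum : ‖Complex.exp (w ^ 2)‖ ≤ Real.exp (s ^ 2) * Real.exp (-1 * w.im ^ 2) := by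
      rw [Complex.norm_exp, sq_re, ← Real.exp_add, Real.exp_le_exp]
      have : w.re ^ 2 ≤ s ^ 2 := by gcongr
      linarith
    have hinv : ‖1 + Complex.exp (w ^ 2)‖⁻¹ ≤ m⁻¹ + 2 := by
      rcases le_or_gt |w.im| (s + 1) with ht | ht
      · exact (inv_anti₀ hm (hmle w hw.le hws ht)).trans (by simp)
      · have h1 : 1 / 2 ≤ ‖1 + Complex.exp (w ^ 2)‖ := by
          have := norm_exp_sq_le_half hw.le hws ht.le
          have h2 := norm_sub_norm_le (1 : ℂ) (-Complex.exp (w ^ 2))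
          rw [norm_one, norm_neg, sub_neg_eq_add] at h2
          linarith
        have h2 := inv_anti₀ (by norm_num) h1
        have : 0 < m⁻¹ := by positivity
        norm_num at h2
        linarith
    rw [etaWeight, norm_div, neg_zero, Real.rpow_zero, one_mul, div_eq_mul_inv]
    calc _ ≤ (Real.exp (s ^ 2) * Real.exp (-1 * w.im ^ 2)) * (m⁻¹ + 2) := by gcongr
      _ = _ := by ring

/-! ### Geometric, alternating and Hurwitz weights -/

theorem isOpen_preconnected_ne (p : ℂ) :
    IsOpen {z : ℂ | z ≠ p} ∧ IsPreconnected {z : ℂ | z ≠ p} :=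
  ⟨isOpen_ne, (isPathConnected_compl_singleton_of_one_lt_rank
    (by rw [Complex.rank_real_complex]; norm_num) p).isConnected.isPreconnected⟩

theorem hasSum_hurwitzWeight (a : ℝ) {u : ℂ} (hu : ‖Complex.exp u‖ < 1) :
    HasSum (fun n : ℕ => Complex.exp (((n : ℂ) + a) * u)) (hurwitzWeight a u) := by
  have := (hasSum_geometric_of_norm_lt_one hu).mul_left (Complex.exp (a * u))
  rw [hurwitzWeight, div_eq_mul_inv]
  refine this.congr_fun fun n => ?_
  rw [← Complex.exp_nat_mul, ← Complex.exp_add]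
  ring_nf

theorem pmt_zero_hurwitzWeight {a : ℝ} (ha : 0 < a) {z : ℂ} (hz : 1 < (z + 1 / 2).re) :
    pmt 0 (hurwitzWeight a) z = pmtG z * hurwitzZetaPos (z + 1 / 2) a := by
  have hα : ∀ n : ℕ, 0 < ((n : ℂ) + a).re := fun n => by simp; positivity
  have h1 := hasSum_pmt_zero (f := hurwitzWeight a) (a := fun _ => 1) (α := fun n : ℕ => (n : ℂ) + a)
    (z := z) hα (by linarith) (fun t ht => by
      simpa using hasSum_hurwitzWeight a (norm_exp_neg_sq_lt_one ht)) (by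
      refine ((Real.summable_one_div_nat_add_rpow a _).2 hz).congr fun n => ?_
      have hn : 0 < (n : ℝ) + a := by positivity
      simp only [norm_one, one_mul, Complex.add_re, Complex.natCast_re, Complex.ofReal_re]
      rw [abs_of_pos hn, Real.rpow_neg hn.le, one_div])
  refine h1.unique (((hasSum_hurwitzZetaPos ha hz).mul_left (pmtG z)).congr_fun fun n => ?_)
  rw [one_mul, Complex.cpow_neg]
  push_cast
  ring

theorem differentiableAt_hurwitzZetaPos {a : ℝ} (ha : 0 < a) {s : ℂ} (hs : s ≠ 1) :
    DifferentiableAt ℂ (fun s => hurwitzZetaPos s a) s := by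
  unfold hurwitzZetaPos
  refine (HurwitzZeta.differentiableAt_hurwitzZeta _ hs).sub (DifferentiableAt.fun_sum fun j hj => ?_)
  refine DifferentiableAt.const_cpow (by fun_prop) (Or.inl ?_)
  obtain ⟨m, hm⟩ : ∃ m : ℕ, ⌈a⌉₊ = m + 1 := ⟨⌈a⌉₊ - 1, by
    have := Nat.ceil_pos.2 ha; omega⟩
  rw [hm, Nat.add_sub_cancel, Finset.mem_Icc] at hj
  have hja : (j : ℝ) < a := Nat.lt_ceil.1 (by omega)
  exact Complex.ofReal_ne_zero.2 (by linarith)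

theorem one_lt_sqrt_pi : 1 < √Real.pi := by
  rw [Real.lt_sqrt (by norm_num)]
  linarith [Real.pi_gt_three]

theorem one_lt_sqrt_pi_div_two : 1 < √(Real.pi / 2) := by
  rw [Real.lt_sqrt (by norm_num)]
  linarith [Real.pi_gt_three]

theorem pmtRa_eq {a : ℝ} (ha : 0 < a) {z : ℂ} (hz : z + 1 / 2 ≠ 1) :
    pmtRa z a = pmtG z * hurwitzZetaPos (z + 1 / 2) a := by
  have hU : {z : ℂ | z + 1 / 2 ≠ 1} = {z : ℂ | z ≠ 1 / 2} := by
    ext z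
    simp only [mem_ofPred_eq, ne_eq, ← eq_sub_iff_add_eq]
    norm_num
  -- For `Re z > 1` the Dirichlet series converges, and the boundary integral does so despite the
  -- growth exponent `d = 2`.
  refine (isGaussianWeight_hurwitzWeight ha).pmt_eqOn (U := {z : ℂ | z + 1 / 2 ≠ 1}) (x₀ := 1)
    (Φ := fun z => pmtG z * hurwitzZetaPos (z + 1 / 2) a) one_pos one_lt_sqrt_pi
    (hU ▸ (isOpen_preconnected_ne _).1) (hU ▸ (isOpen_preconnected_ne _).2) (fun z hz => ?_)
    (by norm_num) (fun z hz => ?_) hz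
  · refine DifferentiableAt.differentiableWithinAt ((differentiable_pmtG z).mul ?_)
    exact DifferentiableAt.comp (g := fun s => hurwitzZetaPos s a) (f := fun z => z + 1 / 2) z
      (differentiableAt_hurwitzZetaPos ha hz) (by fun_prop)
  · have h1 : 1 < (z + 1 / 2).re := by simp; linarith
    refine ⟨fun h => ?_, pmt_zero_hurwitzWeight ha h1⟩
    rw [h] at h1
    simp at h1

theorem hasPMT_hurwitzWeight {a : ℝ} (ha : 0 < a) {σ : ℝ} (hσ : 0 < σ) (hσπ : σ < √Real.pi)
    (z : ℂ) : HasPMT σ (hurwitzWeight a) z (pmtRa z a) :=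
  ⟨(isGaussianWeight_hurwitzWeight ha).integrable hσ hσπ z,
    (isGaussianWeight_hurwitzWeight ha).pmt_eq hσ hσπ one_pos one_lt_sqrt_pi z⟩

theorem zetaWeight_eq : zetaWeight = hurwitzWeight 1 := by
  ext u
  simp [zetaWeight, hurwitzWeight]

theorem pmtR_eq_pmtRa (z : ℂ) : pmtR z = pmtRa z 1 := by
  rw [pmtR, pmtRa, zetaWeight_eq]

theorem hurwitzZetaPos_one (s : ℂ) : hurwitzZetaPos s 1 = riemannZeta s := by
  have h : ((1 : ℝ) : UnitAddCircle) = 0 := AddCircle.coe_period 1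
  rw [hurwitzZetaPos, h, HurwitzZeta.hurwitzZeta_zero]
  simp

theorem pmtR_eq {z : ℂ} (hz : z + 1 / 2 ≠ 1) : pmtR z = pmtG z * riemannZeta (z + 1 / 2) := by
  rw [pmtR_eq_pmtRa, pmtRa_eq one_pos hz, hurwitzZetaPos_one]

theorem hasPMT_zetaWeight {σ : ℝ} (hσ : 0 < σ) (hσπ : σ < √Real.pi) (z : ℂ) :
    HasPMT σ zetaWeight z (pmtR z) := by
  rw [pmtR_eq_pmtRa, zetaWeight_eq]
  exact hasPMT_hurwitzWeight one_pos hσ hσπ z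

theorem differentiable_dirichletEta : Differentiable ℂ dirichletEta := by
  refine (HurwitzZeta.differentiable_expZeta_of_ne_zero fun h => ?_).neg
  obtain ⟨n, hn⟩ := (AddCircle.coe_eq_zero_iff (1 : ℝ)).1 h
  have h2 : (2 * n : ℤ) = 1 := by
    have : (2 * n : ℝ) = 1 := by simp at hn; linarith
    exact_mod_cast this
  omega

theorem hasSum_etaWeight {u : ℂ} (hu : ‖Complex.exp u‖ < 1) :
    HasSum (fun n : ℕ => (-1) ^ n * Complex.exp (((n + 1 : ℕ) : ℂ) * u)) (etaWeight u) := by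
  have := (hasSum_geometric_of_norm_lt_one (ξ := -Complex.exp u) (by simpa using hu)).mul_left
    (Complex.exp u)
  rw [etaWeight, div_eq_mul_inv, ← sub_neg_eq_add]
  refine this.congr_fun fun n => ?_
  rw [neg_pow, Complex.exp_nat_mul, pow_succ]
  ring

theorem summable_nat_succ_rpow_neg {x : ℝ} (hx : 1 < x) :
    Summable fun n : ℕ => ((n + 1 : ℕ) : ℝ) ^ (-x) := by
  have := (summable_nat_add_iff 1).2 (Real.summable_nat_rpow.2 (show -x < -1 by linarith))
  exact this

theorem pmt_zero_etaWeight {z : ℂ} (hz : 1 < (z + 1 / 2).re) :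
    pmt 0 etaWeight z = pmtG z * dirichletEta (z + 1 / 2) := by
  have h1 := hasSum_pmt_zero (f := etaWeight) (a := fun n => (-1) ^ n)
    (α := fun n : ℕ => ((n + 1 : ℕ) : ℂ)) (z := z) (fun n => by
      rw [Complex.natCast_re]; positivity) (by linarith)
    (fun t ht => hasSum_etaWeight (norm_exp_neg_sq_lt_one ht)) (by
      refine (summable_nat_succ_rpow_neg hz).congr fun n => ?_
      simp)
  refine h1.unique (((hasSum_dirichletEta hz).mul_left (pmtG z)).congr_fun fun n => ?_)
  rw [Complex.cpow_neg]
  ring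

theorem pmtD_eq (z : ℂ) : pmtD z = pmtG z * dirichletEta (z + 1 / 2) := by
  refine isGaussianWeight_etaWeight.pmt_eqOn (U := univ) (x₀ := 1)
    (Φ := fun z => pmtG z * dirichletEta (z + 1 / 2)) one_pos one_lt_sqrt_pi_div_two
    isOpen_univ isPreconnected_univ (Differentiable.differentiableOn ?_)
    (by norm_num) (fun z hz => ⟨mem_univ _, pmt_zero_etaWeight (by simp; linarith)⟩) (mem_univ z)
  exact differentiable_pmtG.mul (differentiable_dirichletEta.comp (by fun_prop))

theorem hasPMT_etaWeight {σ : ℝ} (hσ : 0 < σ) (hσπ : σ < √(Real.pi / 2)) (z : ℂ) :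
    HasPMT σ etaWeight z (pmtD z) :=
  ⟨isGaussianWeight_etaWeight.integrable hσ hσπ z,
    isGaussianWeight_etaWeight.pmt_eq hσ hσπ one_pos one_lt_sqrt_pi_div_two z⟩

/-! ### Integrals with an integrable singularity -/

/-- The bound does not depend on the position `x` of the singularity: `|y| ^ p ≤ 1 + h y` with `h`
integrable on the whole line, whose integral is translation invariant. -/
theorem exists_integral_abs_sub_rpow_le {p c : ℝ} (hp : -1 < p) (hp0 : p ≤ 0) (hc : 0 < c) :
    ∃ K : ℝ, 0 ≤ K ∧ ∀ x : ℝ,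
      IntegrableOn (fun r : ℝ => |r - x| ^ p * Real.exp (-c * r)) (Ioi 0) ∧
      ∫ r in Ioi (0 : ℝ), |r - x| ^ p * Real.exp (-c * r) ≤ K := by
  set h : ℝ → ℝ := fun y => Real.exp 1 * (|y| ^ p * Real.exp (-1 * y ^ 2)) with hh
  have hint : Integrable h := (integrable_abs_rpow_mul_exp_neg_mul_sq hp one_pos).const_mul _
  have h0 : ∀ y, 0 ≤ h y := fun y => by positivity
  have hle : ∀ y : ℝ, |y| ^ p ≤ 1 + h y := by
    intro y
    rcases le_or_gt |y| 1 with hy | hy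
    · have : y ^ 2 ≤ 1 := by rw [← sq_abs]; nlinarith [abs_nonneg y]
      have h1 : 1 ≤ Real.exp 1 * Real.exp (-1 * y ^ 2) := by
        rw [← Real.exp_add]; exact Real.one_le_exp (by linarith)
      have h2 : |y| ^ p ≤ h y := by
        calc |y| ^ p ≤ |y| ^ p * (Real.exp 1 * Real.exp (-1 * y ^ 2)) :=
              le_mul_of_one_le_right (by positivity) h1
          _ = h y := by rw [hh]; ring
      linarith
    · have := Real.rpow_le_one_of_one_le_of_nonpos hy.le hp0
      linarith [h0 y]
  have hexp : IntegrableOn (fun r : ℝ => Real.exp (-c * r)) (Ioi 0) :=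
    integrableOn_exp_mul_Ioi (by linarith) 0
  refine ⟨(∫ r in Ioi (0 : ℝ), Real.exp (-c * r)) + ∫ y, h y,
    add_nonneg (integral_nonneg fun r => (Real.exp_pos _).le) (integral_nonneg h0), fun x => ?_⟩
  have hsh : Integrable fun r => h (r - x) := hint.comp_sub_right x
  have hpt : ∀ r ∈ Ioi (0 : ℝ), |r - x| ^ p * Real.exp (-c * r) ≤
      Real.exp (-c * r) + h (r - x) := by
    intro r hr
    have hr : 0 < r := hr
    have h1 : Real.exp (-c * r) ≤ 1 := by
      rw [Real.exp_le_one_iff]; nlinarith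
    calc _ ≤ (1 + h (r - x)) * Real.exp (-c * r) := by gcongr; exact hle _
      _ ≤ Real.exp (-c * r) + h (r - x) * 1 := by
        rw [add_mul, one_mul]
        gcongr
      _ = _ := by rw [mul_one]
  have hI : IntegrableOn (fun r : ℝ => |r - x| ^ p * Real.exp (-c * r)) (Ioi 0) := by
    refine Integrable.mono' (hexp.add hsh.integrableOn) ?_
      (ae_restrict_of_forall_mem measurableSet_Ioi fun r hr => ?_)
    · exact Measurable.aestronglyMeasurable (by fun_prop)
    · rw [Real.norm_of_nonneg (by positivity)]
      exact hpt r hr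
  refine ⟨hI, ?_⟩
  calc ∫ r in Ioi (0 : ℝ), |r - x| ^ p * Real.exp (-c * r)
      ≤ ∫ r in Ioi (0 : ℝ), (Real.exp (-c * r) + h (r - x)) :=
        setIntegral_mono_on hI (hexp.add hsh.integrableOn) measurableSet_Ioi hpt
    _ = (∫ r in Ioi (0 : ℝ), Real.exp (-c * r)) + ∫ r in Ioi (0 : ℝ), h (r - x) :=
        integral_add hexp hsh.integrableOn
    _ ≤ _ := by
        gcongr
        rw [← integral_sub_right_eq_self h x]
        exact setIntegral_le_integral hsh (Eventually.of_forall fun r => h0 _)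

theorem exists_one_add_mul_rpow_le {N b c : ℝ} (hN : 0 ≤ N) (hb : 0 ≤ b) (hc : 0 < c) :
    ∃ C : ℝ, 0 ≤ C ∧ ∀ y : ℝ, 0 ≤ y → (1 + b * y) ^ N ≤ C * Real.exp (c * y) := by
  -- Chosen so that `δ N ≤ c`; the `+ 1` keeps the quotient defined for `N = 0`.
  set δ := c / (N + 1) with hδ
  have hδ0 : 0 < δ := by positivity
  refine ⟨(1 + b / δ) ^ N, by positivity, fun y hy => ?_⟩
  have h1 : 1 + b * y ≤ (1 + b / δ) * Real.exp (δ * y) := by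
    calc 1 + b * y ≤ (1 + b / δ) * (1 + δ * y) := by
          have : b / δ * (δ * y) = b * y := by field_simp
          have h2 : 0 ≤ b / δ := by positivity
          nlinarith [mul_nonneg hδ0.le hy]
      _ ≤ _ := by
          gcongr
          linarith [Real.add_one_le_exp (δ * y)]
  calc (1 + b * y) ^ N ≤ ((1 + b / δ) * Real.exp (δ * y)) ^ N := by gcongr
    _ = (1 + b / δ) ^ N * Real.exp (δ * y * N) := by
        rw [Real.mul_rpow (by positivity) (Real.exp_pos _).le, ← Real.exp_mul]
    _ ≤ _ := by
        refine mul_le_mul_of_nonneg_left (Real.exp_le_exp.2 ?_) (by positivity)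
        have : δ * N ≤ c := by
          rw [hδ, div_mul_eq_mul_div, div_le_iff₀ (by positivity)]
          nlinarith
        nlinarith

/-! ### The incomplete Gamma function -/

/-- Two regimes in one format. If `Re ν ≤ 1`, the power may blow up on the ray, but at most like `|r
+ Re x| ^ (Re ν - 1)`. If `Re ν > 1`, it grows polynomially and half of `e ^ (-r)` absorbs the
growth in `r`. -/
theorem exists_norm_upperGamma_integrand_le {ν : ℂ} (hν : 0 < ν.re) :
    ∃ K N q : ℝ, 0 ≤ K ∧ 0 ≤ N ∧ -1 < q ∧ q ≤ 0 ∧ ∀ (x : ℂ) (r : ℝ), 0 ≤ r → r ≠ -x.re →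
      ‖(x + r) ^ (ν - 1) * Complex.exp (-(x + r))‖ ≤
        K * ((1 + ‖x‖) ^ N * Real.exp (-x.re)) *
          (|r - -x.re| ^ q * Real.exp (-(1 / 2) * r)) := by
  have hpow : ∀ y : ℂ, ‖y ^ (ν - 1)‖ ≤ Real.exp (Real.pi * |ν.im|) * ‖y‖ ^ (ν.re - 1) := by
    intro y
    refine (Complex.norm_cpow_le y (ν - 1)).trans ?_
    rw [div_eq_mul_inv, ← Real.exp_neg, mul_comm, Complex.sub_re, Complex.sub_im, Complex.one_re,
      Complex.one_im, sub_zero]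
    gcongr
    calc -(y.arg * ν.im) ≤ |y.arg * ν.im| := neg_le_abs _
      _ = |y.arg| * |ν.im| := abs_mul _ _
      _ ≤ _ := by gcongr; exact Complex.abs_arg_le_pi y
  have hexp : ∀ (x : ℂ) (r : ℝ), ‖Complex.exp (-(x + r))‖ = Real.exp (-x.re) * Real.exp (-r) := by
    intro x r
    rw [Complex.norm_exp, ← Real.exp_add]
    congr 1
    simp
    ring
  rcases le_or_gt (ν.re - 1) 0 with hp | hp
  · refine ⟨Real.exp (Real.pi * |ν.im|), 0, ν.re - 1, by positivity, le_rfl, by linarith, hp,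
      fun x r hr hx => ?_⟩
    have h0 : 0 < |r - -x.re| := abs_pos.2 (sub_ne_zero.2 hx)
    have h1 : |r - -x.re| ≤ ‖x + r‖ := by
      have := Complex.abs_re_le_norm (x + r)
      simp only [Complex.add_re, Complex.ofReal_re] at this
      rwa [sub_neg_eq_add, add_comm]
    rw [norm_mul, hexp, Real.rpow_zero, one_mul]
    calc _ ≤ (Real.exp (Real.pi * |ν.im|) * |r - -x.re| ^ (ν.re - 1)) *
          (Real.exp (-x.re) * Real.exp (-(1 / 2) * r)) := by
          refine mul_le_mul ((hpow _).trans ?_) ?_ (by positivity) (by positivity)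
          · gcongr _ * ?_
            exact Real.rpow_le_rpow_of_nonpos h0 h1 hp
          · gcongr
            linarith
      _ = _ := by ring
  · set p := ν.re - 1 with hpdef
    obtain ⟨C, hC, hCle⟩ := exists_one_add_mul_rpow_le hp.le zero_le_one
      (show (0 : ℝ) < 1 / 2 by norm_num)
    refine ⟨Real.exp (Real.pi * |ν.im|) * C, p, 0, by positivity, hp.le, by norm_num, le_rfl,
      fun x r hr _ => ?_⟩
    have h1 : ‖x + r‖ ≤ (1 + ‖x‖) * (1 + 1 * r) := by
      calc ‖x + r‖ ≤ ‖x‖ + ‖(r : ℂ)‖ := norm_add_le _ _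
        _ = ‖x‖ + r := by rw [Complex.norm_real, Real.norm_of_nonneg hr]
        _ ≤ _ := by nlinarith [norm_nonneg x, mul_nonneg (norm_nonneg x) hr]
    have h2 : ‖x + r‖ ^ p ≤ (1 + ‖x‖) ^ p * (C * Real.exp (1 / 2 * r)) := by
      calc ‖x + r‖ ^ p ≤ ((1 + ‖x‖) * (1 + 1 * r)) ^ p := by gcongr
        _ = (1 + ‖x‖) ^ p * (1 + 1 * r) ^ p := Real.mul_rpow (by positivity) (by positivity)
        _ ≤ _ := by gcongr; exact hCle r hr
    rw [norm_mul, hexp, Real.rpow_zero, one_mul]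
    calc _ ≤ (Real.exp (Real.pi * |ν.im|) * ((1 + ‖x‖) ^ p * (C * Real.exp (1 / 2 * r)))) *
          (Real.exp (-x.re) * Real.exp (-r)) := by
          refine mul_le_mul_of_nonneg_right ((hpow _).trans ?_) (by positivity)
          gcongr
      _ = _ := by
          have : Real.exp (1 / 2 * r) * Real.exp (-r) = Real.exp (-(1 / 2) * r) := by
            rw [← Real.exp_add]; ring_nf
          rw [← this]; ring

theorem ae_restrict_ne (x : ℝ) (s : Set ℝ) : ∀ᵐ r ∂(volume.restrict s), r ≠ x :=
  ae_restrict_of_ae (by simp [ae_iff, measure_singleton])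

theorem exists_norm_upperGamma_le {ν : ℂ} (hν : 0 < ν.re) :
    ∃ K N : ℝ, 0 ≤ K ∧ 0 ≤ N ∧ ∀ x : ℂ,
      ‖upperGamma ν x‖ ≤ K * ((1 + ‖x‖) ^ N * Real.exp (-x.re)) := by
  obtain ⟨K, N, q, hK, hN, hq, hq0, hle⟩ := exists_norm_upperGamma_integrand_le hν
  obtain ⟨K', hK', hle'⟩ := exists_integral_abs_sub_rpow_le hq hq0 (show (0 : ℝ) < 1 / 2 by norm_num)
  refine ⟨K * K', N, by positivity, hN, fun x => ?_⟩
  calc ‖upperGamma ν x‖ ≤ ∫ r in Ioi (0 : ℝ), K * ((1 + ‖x‖) ^ N * Real.exp (-x.re)) *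
        (|r - -x.re| ^ q * Real.exp (-(1 / 2) * r)) := by
        refine norm_integral_le_of_norm_le ((hle' _).1.const_mul _) ?_
        filter_upwards [ae_restrict_mem measurableSet_Ioi, ae_restrict_ne (-x.re) (Ioi 0)]
          with r hr hr'
        exact hle x r (le_of_lt hr) hr'
    _ = K * ((1 + ‖x‖) ^ N * Real.exp (-x.re)) *
        ∫ r in Ioi (0 : ℝ), (|r - -x.re| ^ q * Real.exp (-(1 / 2) * r)) := integral_const_mul _ _
    _ ≤ K * ((1 + ‖x‖) ^ N * Real.exp (-x.re)) * K' := by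
        gcongr
        exact (hle' _).2
    _ = _ := by ring

/-- Joint measurability of the integrand suffices, so nothing has to be known about `Γ(ν, ·)` across
the cut of the power. -/
theorem stronglyMeasurable_upperGamma_comp (ν : ℂ) {g : ℝ → ℂ} (hg : Measurable g) :
    StronglyMeasurable fun t => upperGamma ν (g t) := by
  refine StronglyMeasurable.integral_prod_right
    (f := fun (t : ℝ) (r : ℝ) => (g t + r) ^ (ν - 1) * Complex.exp (-(g t + r))) ?_
  refine Measurable.stronglyMeasurable ?_
  have h : Measurable fun p : ℝ × ℝ => g p.1 + (p.2 : ℂ) :=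
    (hg.comp measurable_fst).add (Complex.measurable_ofReal.comp measurable_snd)
  exact (h.pow_const _).mul h.neg.cexp

/-- The integrand depends on `x + r` only, so its `x`-derivative is its `r`-derivative and
integrates to minus its value at `r = 0`. For `Re x > 0` the ray avoids the cut. -/
theorem hasDerivAt_upperGamma {ν x : ℂ} (hν : 0 < ν.re) (hx : 0 < x.re) :
    HasDerivAt (upperGamma ν) (-(x ^ (ν - 1) * Complex.exp (-x))) x := by
  obtain ⟨K, N, q, hK, hN, hq, hq0, hle⟩ := exists_norm_upperGamma_integrand_le hν
  set h : ℂ → ℂ := fun y => y ^ (ν - 1) * Complex.exp (-y) with hh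
  have hhd : ∀ y : ℂ, 0 < y.re → DifferentiableAt ℂ h y := fun y hy =>
    (differentiableAt_id.cpow_const (Or.inl hy)).mul (by fun_prop)
  set ρ := x.re / 2 with hρ
  have hρ0 : 0 < ρ := half_pos hx
  set B : ℝ := K * ((1 + (‖x‖ + ρ)) ^ N * 1) * ρ ^ q with hB
  have hball : ∀ y ∈ Metric.ball x ρ, ρ < y.re ∧ ‖y‖ ≤ ‖x‖ + ρ := by
    intro y hy
    rw [Metric.mem_ball, dist_eq_norm] at hy
    have h1 := (abs_lt.1 ((Complex.abs_re_le_norm (y - x)).trans_lt hy)).1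
    rw [Complex.sub_re] at h1
    refine ⟨by linarith, ?_⟩
    linarith [norm_le_norm_add_norm_sub' y x]
  have hbd : ∀ y ∈ Metric.ball x ρ, ∀ r : ℝ, 0 ≤ r → ‖h (y + r)‖ ≤ B * Real.exp (-(1 / 2) * r) := by
    intro y hy r hr
    obtain ⟨h1, h2⟩ := hball y hy
    refine (hle y r hr (by linarith)).trans ?_
    have h3 : |r - -y.re| ^ q ≤ ρ ^ q := by
      refine Real.rpow_le_rpow_of_nonpos hρ0 ?_ hq0
      rw [abs_of_pos (by linarith)]; linarith
    have h4 : Real.exp (-y.re) ≤ 1 := Real.exp_le_one_iff.2 (by linarith)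
    calc _ ≤ K * ((1 + (‖x‖ + ρ)) ^ N * 1) * (ρ ^ q * Real.exp (-(1 / 2) * r)) := by gcongr
      _ = _ := by rw [hB]; ring
  have hexp : IntegrableOn (fun r : ℝ => B * Real.exp (-(1 / 2) * r)) (Ioi 0) :=
    (integrableOn_exp_mul_Ioi (by norm_num) 0).const_mul B
  have hmem : ∀ y ∈ Metric.ball x ρ, ∀ r : ℝ, 0 ≤ r → 0 < (y + (r : ℂ)).re := fun y hy r hr => by
    have := (hball y hy).1
    simp
    linarith
  have hxb : x ∈ Metric.ball x ρ := Metric.mem_ball_self hρ0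
  obtain ⟨hi, hd⟩ := hasDerivAt_integral_of_norm_le (μ := volume.restrict (Ioi (0 : ℝ)))
    (F := fun y (r : ℝ) => h (y + r)) (z₀ := x) hρ0
    (fun y _ => by
      refine Measurable.aestronglyMeasurable ?_
      have h1 : Measurable fun r : ℝ => y + (r : ℂ) := by fun_prop
      exact (h1.pow_const _).mul h1.neg.cexp)
    (ae_restrict_of_forall_mem measurableSet_Ioi fun r hr y hy =>
      (DifferentiableAt.comp (g := h) (f := fun y => y + (r : ℂ)) y
        (hhd _ (hmem y hy r (le_of_lt hr))) (by fun_prop)).differentiableWithinAt)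
    hexp (ae_restrict_of_forall_mem measurableSet_Ioi fun r hr y hy => hbd y hy r (le_of_lt hr))
  have hval : ∫ r in Ioi (0 : ℝ), deriv (fun y => h (y + r)) x = 0 - h (x + (0 : ℝ)) := by
    refine integral_Ioi_of_hasDerivAt_of_tendsto' (f := fun r : ℝ => h (x + r)) (fun r hr => ?_)
      hi ?_
    · have h1 := (hhd _ (hmem x hxb r hr)).hasDerivAt
      have h2 : deriv (fun y => h (y + r)) x = deriv h (x + r) := deriv_comp_add_const ..
      rw [h2]
      exact (HasDerivAt.comp_const_add x (r : ℂ) h1).comp_ofReal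
    · have h1 : Tendsto (fun r : ℝ => B * Real.exp (-(1 / 2) * r)) atTop (𝓝 0) := by
        simpa using (Real.tendsto_exp_atBot.comp
          (tendsto_id.const_mul_atTop_of_neg (show (-(1 / 2) : ℝ) < 0 by norm_num))).const_mul B
      refine squeeze_zero_norm' ?_ h1
      filter_upwards [eventually_ge_atTop 0] with r hr using hbd x hxb r hr
  rw [hval] at hd
  exact hd.congr_deriv (by simp [hh])

theorem mul_ofReal_cpow {l : ℂ} (hl : l ≠ 0) {y : ℝ} (hy : 0 < y) (a : ℂ) :
    (l * y) ^ a = l ^ a * (y : ℂ) ^ a := by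
  have hy0 : (y : ℂ) ≠ 0 := Complex.ofReal_ne_zero.2 hy.ne'
  rw [Complex.cpow_def_of_ne_zero (mul_ne_zero hl hy0), Complex.cpow_def_of_ne_zero hl,
    Complex.cpow_def_of_ne_zero hy0, Complex.log_mul_ofReal y hy l hl, ← Complex.exp_add,
    Complex.ofReal_log hy.le]
  ring_nf

/-- Integration by parts: `y ^ s Γ(ν, λy)` vanishes at both ends, which leaves Euler's integral with
exponent `ν + s`, divided by `s`. -/
theorem mellin_upperGamma {ν l s : ℂ} (hν : 0 < ν.re) (hl : 0 < l.re) (hs : 0 < s.re) :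
    mellin (fun y : ℝ => upperGamma ν (l * y)) s =
      l ^ (-s) * Complex.Gamma (ν + s) / s := by
  have hl0 := ne_zero_of_re_pos hl
  have hs0 := ne_zero_of_re_pos hs
  obtain ⟨K, N, hK, hN, hle⟩ := exists_norm_upperGamma_le hν
  obtain ⟨C, hC, hCle⟩ := exists_one_add_mul_rpow_le hN (norm_nonneg l) (half_pos hl)
  have hM : ∀ y : ℝ, 0 ≤ y → ‖upperGamma ν (l * y)‖ ≤ K * C * Real.exp (-(l.re / 2) * y) := by
    intro y hy
    refine (hle _).trans ?_
    rw [norm_mul, Complex.norm_real, Real.norm_of_nonneg hy, Complex.re_mul_ofReal]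
    calc _ ≤ K * ((C * Real.exp (l.re / 2 * y)) * Real.exp (-(l.re * y))) := by
          gcongr
          exact hCle y hy
      _ = _ := by
          have : Real.exp (l.re / 2 * y) * Real.exp (-(l.re * y)) =
              Real.exp (-(l.re / 2) * y) := by rw [← Real.exp_add]; ring_nf
          rw [← this]; ring
  have hder : ∀ y ∈ Ioi (0 : ℝ), HasDerivAt (fun y : ℝ => (y : ℂ) ^ s * upperGamma ν (l * y))
      (s * ((y : ℂ) ^ (s - 1) * upperGamma ν (l * y)) -
        l ^ ν * ((y : ℂ) ^ ((ν + s) - 1) * Complex.exp (-(l * y)))) y := by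
    intro y hy
    have hy : 0 < y := hy
    have hy0 : (y : ℂ) ≠ 0 := Complex.ofReal_ne_zero.2 hy.ne'
    have h1 : HasDerivAt (fun y : ℂ => y ^ s) (s * (y : ℂ) ^ (s - 1)) (y : ℂ) := by
      simpa using (hasDerivAt_id (y : ℂ)).cpow_const (c := s) (Or.inl (by simpa using hy))
    have h2 : HasDerivAt (fun y : ℂ => upperGamma ν (l * y))
        (-((l * y) ^ (ν - 1) * Complex.exp (-(l * y))) * l) (y : ℂ) := by
      have h3 : HasDerivAt (fun y : ℂ => l * y) l (y : ℂ) := by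
        simpa using (hasDerivAt_id (y : ℂ)).const_mul l
      exact (hasDerivAt_upperGamma hν (by simpa using mul_pos hl hy)).comp (y : ℂ) h3
    refine ((h1.mul h2).comp_ofReal).congr_deriv ?_
    have hlν : l ^ ν = l ^ (ν - 1) * l := by
      calc l ^ ν = l ^ (ν - 1 + 1) := by rw [sub_add_cancel]
        _ = l ^ (ν - 1) * l := by rw [Complex.cpow_add _ _ hl0, Complex.cpow_one]
    rw [mul_ofReal_cpow hl0 hy, show ν + s - 1 = (ν - 1) + s by ring, Complex.cpow_add _ _ hy0, hlν]
    ring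
  have hi1 : IntegrableOn (fun y : ℝ => (y : ℂ) ^ (s - 1) * upperGamma ν (l * y)) (Ioi 0) := by
    refine Integrable.mono' ((integrableOn_rpow_mul_exp_neg_mul (p := s.re - 1) (by linarith)
      (half_pos hl)).const_mul (K * C)) ?_
      (ae_restrict_of_forall_mem measurableSet_Ioi fun y hy => ?_)
    · exact (Complex.measurable_ofReal.pow_const _).aestronglyMeasurable.mul
        (stronglyMeasurable_upperGamma_comp ν (by fun_prop)).aestronglyMeasurable
    · have hy : 0 < y := hy
      rw [norm_mul, Complex.norm_cpow_eq_rpow_re_of_pos hy, Complex.sub_re, Complex.one_re]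
      calc _ ≤ y ^ (s.re - 1) * (K * C * Real.exp (-(l.re / 2) * y)) := by
            gcongr
            exact hM y hy.le
        _ = _ := by ring
  have hνs : 0 < (ν + s).re := by simpa using add_pos hν hs
  have hi2 := integrableOn_cpow_mul_exp_neg (α := l) hl hνs
  have hnorm : ∀ y : ℝ, 0 < y → ‖(y : ℂ) ^ s * upperGamma ν (l * y)‖ ≤
      K * C * (y ^ s.re * Real.exp (-(l.re / 2) * y)) := by
    intro y hy
    rw [norm_mul, Complex.norm_cpow_eq_rpow_re_of_pos hy]
    calc _ ≤ y ^ s.re * (K * C * Real.exp (-(l.re / 2) * y)) := by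
          gcongr
          exact hM y hy.le
      _ = _ := by ring
  have hFTC := integral_Ioi_of_hasDerivAt_of_tendsto
    (f := fun y : ℝ => (y : ℂ) ^ s * upperGamma ν (l * y)) (a := 0) (m := 0) ?_ hder
    ((hi1.const_mul s).sub (hi2.const_mul (l ^ ν))) ?_
  · rw [integral_sub (hi1.const_mul s) (hi2.const_mul (l ^ ν)), integral_const_mul,
      integral_const_mul, integral_cpow_mul_exp_neg_mul_Ioi_of_re_pos hl hνs, Complex.ofReal_zero,
      Complex.zero_cpow hs0, zero_mul, sub_zero] at hFTC
    rw [eq_div_iff hs0, show l ^ (-s) = l ^ ν * l ^ (-(ν + s)) by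
      rw [← Complex.cpow_add _ _ hl0]; ring_nf]
    simp only [mellin, smul_eq_mul]
    linear_combination hFTC
  · rw [ContinuousWithinAt, Complex.ofReal_zero, Complex.zero_cpow hs0, zero_mul]
    have h1 : Tendsto (fun y : ℝ => K * C * (y ^ s.re * Real.exp (-(l.re / 2) * y)))
        (𝓝[≥] 0) (𝓝 0) := by
      have : ContinuousAt (fun y : ℝ => K * C * (y ^ s.re * Real.exp (-(l.re / 2) * y))) 0 :=
        continuousAt_const.mul ((Real.continuousAt_rpow_const 0 _ (Or.inr hs.le)).mul
          (by fun_prop))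
      have h2 := this.tendsto
      rw [Real.zero_rpow hs.ne', zero_mul, mul_zero] at h2
      exact h2.mono_left nhdsWithin_le_nhds
    refine squeeze_zero_norm' ?_ h1
    filter_upwards [self_mem_nhdsWithin] with y hy
    rcases (mem_Ici.1 hy).eq_or_lt with rfl | hy
    · simp [Complex.zero_cpow hs0, Real.zero_rpow hs.ne']
    · exact hnorm y hy
  · have h1 : Tendsto (fun y : ℝ => K * C * (y ^ s.re * Real.exp (-(l.re / 2) * y)))
        atTop (𝓝 0) := by
      simpa using (tendsto_rpow_mul_exp_neg_mul_atTop_nhds_zero s.re _ (half_pos hl)).const_mul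
        (K * C)
    refine squeeze_zero_norm' ?_ h1
    filter_upwards [eventually_gt_atTop 0] with y hy using hnorm y hy

theorem pmt_zero_upperGamma {ν l z : ℂ} (hν : 0 < ν.re) (hl : 0 < l.re)
    (hz : 0 < (z + 1 / 2).re) :
    pmt 0 (fun u => upperGamma ν (-l * u)) z =
      pmtG z * l ^ (-(z + 1 / 2)) * (Complex.Gamma (ν + (z + 1 / 2)) /
          Complex.Gamma ((z + 1 / 2) + 1)) := by
  have hs0 := ne_zero_of_re_pos hz
  have hs : ∀ m : ℕ, z + 1 / 2 ≠ -m := fun m h => by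
    rw [h] at hz
    simp at hz
    linarith [(m.cast_nonneg : (0 : ℝ) ≤ m)]
  have hΓ := Complex.Gamma_ne_zero hs
  have hf : (fun y : ℝ => upperGamma ν (-l * -(y : ℂ))) = fun y : ℝ => upperGamma ν (l * y) := by
    ext y
    rw [neg_mul_neg]
  rw [pmt_zero_eq_mellin, pmtG_eq_cos_mul_Gamma hs, Complex.Gamma_add_one _ hs0, hf,
    mellin_upperGamma hν hl hz]
  generalize Complex.Gamma (ν + (z + 1 / 2)) = g'
  generalize Complex.Gamma (z + 1 / 2) = g at hΓ ⊢
  generalize z + 1 / 2 = s at hs0 ⊢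
  field_simp

theorem exists_norm_upperGamma_line_le {ν l : ℂ} (hν : 0 < ν.re) (hl : 0 < l.re) :
    ∃ C : ℝ, 0 ≤ C ∧ ∀ w : ℂ, 0 < w.re → w.re ≤ 1 →
      ‖upperGamma ν (-l * w ^ 2)‖ ≤ C * Real.exp (-(l.re / 4) * w.im ^ 2) := by
  obtain ⟨K, N, hK, hN, hle⟩ := exists_norm_upperGamma_le hν
  obtain ⟨C, hC, hCle⟩ := exists_one_add_mul_rpow_le hN zero_le_one
    (show 0 < l.re / 4 by linarith)
  obtain ⟨E, hE, hEle⟩ : ∃ E : ℝ, 0 ≤ E ∧ ∀ w : ℂ, 0 < w.re → w.re ≤ 1 →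
      Real.exp (l * w ^ 2).re ≤ E * Real.exp (-(l.re / 2) * w.im ^ 2) :=
    ⟨_, by positivity, fun w h0 h1 => re_mul_sq_le hl h0 h1⟩
  refine ⟨K * ((1 + ‖l‖) ^ N * C * E), by positivity, fun w h0 h1 => ?_⟩
  have h2 : 1 + ‖-l * w ^ 2‖ ≤ (1 + ‖l‖) * (1 + 1 * w.im ^ 2) := by
    have h3 : ‖w‖ ^ 2 ≤ 1 + w.im ^ 2 := by
      rw [← Complex.normSq_eq_norm_sq, Complex.normSq_apply]
      nlinarith
    rw [norm_mul, norm_neg, norm_pow]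
    nlinarith [norm_nonneg l, sq_nonneg w.im, mul_nonneg (norm_nonneg l) (sub_nonneg.2 h3)]
  refine (hle _).trans ?_
  have h3 : (1 + ‖-l * w ^ 2‖) ^ N ≤ (1 + ‖l‖) ^ N * (C * Real.exp (l.re / 4 * w.im ^ 2)) := by
    calc _ ≤ ((1 + ‖l‖) * (1 + 1 * w.im ^ 2)) ^ N := by gcongr
      _ = (1 + ‖l‖) ^ N * (1 + 1 * w.im ^ 2) ^ N :=
        Real.mul_rpow (by positivity) (by positivity)
      _ ≤ _ := by gcongr; exact hCle _ (sq_nonneg _)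
  have h4 : Real.exp (-(-l * w ^ 2).re) ≤ E * Real.exp (-(l.re / 2) * w.im ^ 2) := by
    rw [neg_mul, Complex.neg_re, neg_neg]
    exact hEle w h0 h1
  have h5 : Real.exp (l.re / 4 * w.im ^ 2) * Real.exp (-(l.re / 2) * w.im ^ 2) =
      Real.exp (-(l.re / 4) * w.im ^ 2) := by rw [← Real.exp_add]; ring_nf
  calc _ ≤ K * (((1 + ‖l‖) ^ N * (C * Real.exp (l.re / 4 * w.im ^ 2))) *
        (E * Real.exp (-(l.re / 2) * w.im ^ 2))) := by gcongr
    _ = _ := by rw [← h5]; ring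

theorem hasBoundaryPMT_upperGamma {ν l z : ℂ} (hν : 0 < ν.re) (hl : 0 < l.re)
    (hz : 0 < (z + 1 / 2).re) :
    HasBoundaryPMT (fun u => upperGamma ν (-l * u)) z
      (pmtG z * l ^ (-(z + 1 / 2)) * (Complex.Gamma (ν + (z + 1 / 2)) /
          Complex.Gamma ((z + 1 / 2) + 1))) := by
  have hz' : -1 < 2 * z.re := by simp at hz; linarith
  rw [← pmt_zero_upperGamma hν hl hz]
  obtain ⟨C, hC, hle⟩ := exists_norm_upperGamma_line_le hν hl
  have hbound : ∀ σ t : ℝ, 0 < σ → σ ≤ 1 → t ≠ 0 →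
      ‖upperGamma ν (-l * ((σ : ℂ) + t * Complex.I) ^ 2)‖ ≤
        C * (‖(σ : ℂ) + t * Complex.I‖ ^ (-0 : ℝ) * |t| ^ (-0 : ℝ) *
          Real.exp (-(l.re / 4) * t ^ 2)) := by
    intro σ t hσ hσ1 _
    have h := hle ((σ : ℂ) + t * Complex.I) (by simpa using hσ) (by simpa using hσ1)
    have him : ((σ : ℂ) + t * Complex.I).im = t := by simp
    rw [him] at h
    rwa [neg_zero, Real.rpow_zero, Real.rpow_zero, one_mul, one_mul]
  have hcont : ∀ t : ℝ, t ≠ 0 → ContinuousAt (fun u => upperGamma ν (-l * u)) (-(t : ℂ) ^ 2) := by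
    intro t ht
    have h1 : 0 < (-l * -(t : ℂ) ^ 2).re := by
      rw [neg_mul_neg, ← Complex.ofReal_pow, Complex.re_mul_ofReal]
      positivity
    exact ContinuousAt.comp (g := upperGamma ν) (f := fun u => -l * u)
      (hasDerivAt_upperGamma hν h1).continuousAt (by fun_prop)
  have hmeas : ∀ σ : ℝ, 0 < σ → σ ≤ 1 →
      AEStronglyMeasurable fun t : ℝ => upperGamma ν (-l * ((σ : ℂ) + t * Complex.I) ^ 2) :=
    fun σ _ _ => (stronglyMeasurable_upperGamma_comp ν (by fun_prop)).aestronglyMeasurable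
  exact hasBoundaryPMT_of_bound one_pos one_pos (by linarith) hC hmeas hbound hcont (by linarith)

/-- Open as the nonvanishing set of the entire function `1 / Γ(a + z)`; connected as the complement
of a countable set in the plane. -/
theorem isOpen_preconnected_ne_neg_nat (a : ℂ) :
    IsOpen {z : ℂ | ∀ m : ℕ, a + z ≠ -m} ∧ IsPreconnected {z : ℂ | ∀ m : ℕ, a + z ≠ -m} := by
  constructor
  · have h : {z : ℂ | ∀ m : ℕ, a + z ≠ -m} = {z : ℂ | (Complex.Gamma (a + z))⁻¹ ≠ 0} := by
      ext z
      simp only [mem_ofPred_eq, ne_eq, inv_eq_zero, Complex.Gamma_eq_zero_iff, not_exists]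
    rw [h]
    have hc : Continuous fun z : ℂ => (Complex.Gamma (a + z))⁻¹ :=
      Complex.differentiable_one_div_Gamma.continuous.comp (by fun_prop)
    exact isOpen_ne_fun hc continuous_const
  · have h : {z : ℂ | ∀ m : ℕ, a + z ≠ -m} = (range fun m : ℕ => (-m - a : ℂ))ᶜ := by
      ext z
      simp only [mem_ofPred_eq, mem_compl_iff, mem_range, not_exists]
      refine forall_congr' fun m => not_congr ⟨fun h => ?_, fun h => ?_⟩
      · linear_combination -h
      · linear_combination -h
    rw [h]
    exact ((countable_range _).isPathConnected_compl_of_one_lt_rank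
      (by rw [Complex.rank_real_complex]; norm_num)).isConnected.isPreconnected

theorem continuesTransform_upperGamma {ν l : ℂ} (hν : 0 < ν.re) (hl : 0 < l.re) :
    ContinuesTransform (HasBoundaryPMT (fun u => upperGamma ν (-l * u)))
      {z | 0 < (z + 1 / 2).re} {z | ∀ m : ℕ, ν + (z + 1 / 2) ≠ -m}
      (fun z => pmtG z * l ^ (-(z + 1 / 2)) * (Complex.Gamma (ν + (z + 1 / 2)) /
        Complex.Gamma ((z + 1 / 2) + 1))) where
  isOpen_dom := isOpen_lt continuous_const (by fun_prop)
  nonempty_dom := ⟨0, by simp⟩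
  subset := fun z hz m h => by
    have hz : 0 < (z + 1 / 2).re := hz
    have := congrArg Complex.re h
    simp only [Complex.add_re ν, Complex.neg_re, Complex.natCast_re] at this
    linarith [(m.cast_nonneg : (0 : ℝ) ≤ m)]
  isOpen := by
    have := (isOpen_preconnected_ne_neg_nat (ν + 1 / 2)).1
    convert this using 5 with z m
    ring_nf
  isPreconnected := by
    have := (isOpen_preconnected_ne_neg_nat (ν + 1 / 2)).2
    convert this using 5 with z m
    ring_nf
  eq_transform := fun z hz => hasBoundaryPMT_upperGamma hν hl hz
  differentiableOn := by
    intro z hz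
    refine DifferentiableAt.differentiableWithinAt ?_
    simp only [div_eq_mul_inv]
    refine (DifferentiableAt.mul (differentiable_pmtG z) ?_).mul (DifferentiableAt.mul ?_ ?_)
    · exact DifferentiableAt.const_cpow (by fun_prop) (Or.inl (ne_zero_of_re_pos hl))
    · exact DifferentiableAt.comp (g := Complex.Gamma) (f := fun z => ν + (z + 1 * 2⁻¹)) z
        (Complex.differentiableAt_Gamma _ (by simpa [div_eq_mul_inv] using hz)) (by fun_prop)
    · exact (Complex.differentiable_one_div_Gamma.comp
        (by fun_prop : Differentiable ℂ fun z : ℂ => z + 1 * 2⁻¹ + 1)).differentiableAt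

/-! ### Periodic polylogarithms near the boundary -/

/-- Factor `w ^ 2 - r = (w - √r)(w + √r)`; each factor has imaginary part `Im w`. The bound survives
`Re w → 0`. -/
theorem sq_im_le_norm_sq_sub (w : ℂ) {r : ℝ} (hr : 0 ≤ r) : w.im ^ 2 ≤ ‖w ^ 2 - r‖ := by
  have h : w ^ 2 - r = (w - (√r : ℝ)) * (w + (√r : ℝ)) := by
    have : ((√r : ℝ) : ℂ) ^ 2 = r := by
      rw [← Complex.ofReal_pow, Real.sq_sqrt hr]
    linear_combination this
  rw [h, norm_mul, ← sq_abs, sq]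
  refine mul_le_mul ?_ ?_ (abs_nonneg _) (norm_nonneg _)
  · simpa using Complex.abs_im_le_norm (w - (√r : ℝ))
  · simpa using Complex.abs_im_le_norm (w + (√r : ℝ))

theorem abs_sub_re_sq_le_norm (w : ℂ) (r : ℝ) : |r - (w ^ 2).re| ≤ ‖w ^ 2 - r‖ := by
  rw [abs_sub_comm]
  rw [← Complex.ofReal_re r, ← Complex.sub_re]
  exact Complex.abs_re_le_norm _

/-- Interpolation between the two lower bounds for `‖w ^ 2 - r‖`. One alone is not integrable in
`r`, the other costs `|Im w| ^ (-2)`. The geometric mean is integrable in `r` and nearly bounded in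
`Im w`. -/
theorem inv_norm_sq_sub_le {w : ℂ} {r δ : ℝ} (hr : 0 ≤ r) (hδ : 0 < δ) (hδ1 : δ ≤ 1)
    (hw : w.im ≠ 0) (hrw : r ≠ (w ^ 2).re) :
    ‖w ^ 2 - r‖⁻¹ ≤ |r - (w ^ 2).re| ^ (δ - 1) * |w.im| ^ (-(2 * δ)) := by
  have h1 := sq_im_le_norm_sq_sub w hr
  have h2 := abs_sub_re_sq_le_norm w r
  have h3 : 0 < |r - (w ^ 2).re| := abs_pos.2 (sub_ne_zero.2 hrw)
  have h4 : 0 < w.im ^ 2 := by positivity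
  have h5 : 0 < ‖w ^ 2 - r‖ := h4.trans_le h1
  calc ‖w ^ 2 - r‖⁻¹ = ‖w ^ 2 - r‖ ^ (δ - 1) * ‖w ^ 2 - r‖ ^ (-δ) := by
        rw [← Real.rpow_add h5, ← Real.rpow_neg_one]; ring_nf
    _ ≤ |r - (w ^ 2).re| ^ (δ - 1) * (w.im ^ 2) ^ (-δ) := by
        refine mul_le_mul (Real.rpow_le_rpow_of_nonpos h3 h2 (by linarith))
          (Real.rpow_le_rpow_of_nonpos h4 h1 (by linarith)) (by positivity) (by positivity)
    _ = _ := by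
        rw [← sq_abs w.im, ← Real.rpow_natCast |w.im|, ← Real.rpow_mul (abs_nonneg _)]
        push_cast
        ring_nf

theorem inv_norm_one_sub_exp_le {m : ℂ} (hm : m.re ≤ -(1 / 2) ∨ ‖m‖ ≤ 3 / 4) :
    ‖1 - Complex.exp m‖⁻¹ ≤ 3 + 4 * ‖m‖⁻¹ := by
  rcases hm with hm | hm
  · have h1 : Real.exp m.re ≤ 2 / 3 := by
      calc Real.exp m.re ≤ Real.exp (-(1 / 2)) := Real.exp_le_exp.2 hm
        _ = (Real.exp (1 / 2))⁻¹ := Real.exp_neg _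
        _ ≤ (3 / 2)⁻¹ := by
          gcongr
          linarith [Real.add_one_le_exp (1 / 2 : ℝ)]
        _ = 2 / 3 := by norm_num
    have h2 : 1 / 3 ≤ ‖1 - Complex.exp m‖ := by
      have := norm_sub_norm_le (1 : ℂ) (Complex.exp m)
      rw [norm_one, Complex.norm_exp] at this
      linarith
    have h3 : ‖1 - Complex.exp m‖⁻¹ ≤ (1 / 3)⁻¹ := by gcongr
    have h4 : 0 ≤ ‖m‖⁻¹ := by positivity
    norm_num at h3
    linarith
  · rcases eq_or_ne m 0 with rfl | h0
    · simp
    · have hpos : 0 < ‖m‖ := norm_pos_iff.2 h0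
      have h1 := Complex.norm_exp_sub_one_sub_id_le (x := m) (by linarith)
      have h2 : ‖m‖ / 4 ≤ ‖1 - Complex.exp m‖ := by
        have h3 : ‖m‖ ≤ ‖1 - Complex.exp m‖ + ‖Complex.exp m - 1 - m‖ := by
          rw [← norm_neg m]
          refine le_trans (le_of_eq ?_) (norm_add_le _ _)
          congr 1
          ring
        nlinarith
      calc ‖1 - Complex.exp m‖⁻¹ ≤ (‖m‖ / 4)⁻¹ := by gcongr
        _ = 4 * ‖m‖⁻¹ := by rw [inv_div]; rfl
        _ ≤ _ := by linarith

/-- The condition `Re w ≤ 1 / (8q)` keeps `q (w ^ 2 - r)` away from the zeros `2πin`, `n ≠ 0`, of `1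
- exp`. Either its real part is at most `-1/2`, or its real and imaginary parts are at most `1/2`
and `1/4` in absolute value, so only the zero at the origin matters. -/
theorem inv_norm_one_sub_exp_nat_mul_le {q : ℕ} (hq : 1 ≤ q) {w : ℂ} {r δ : ℝ} (hr : 0 ≤ r)
    (hδ : 0 < δ) (hδ1 : δ ≤ 1) (hw : 0 < w.re) (hwq : w.re ≤ 1 / (8 * q)) (him : w.im ≠ 0)
    (hrw : r ≠ (w ^ 2).re) :
    ‖1 - Complex.exp (q * (w ^ 2 - r))‖⁻¹ ≤
      2 * |w.im| ^ (-(2 * δ)) * Real.exp (w.im ^ 2 / 2) * (3 + 4 * |r - (w ^ 2).re| ^ (δ - 1)) := by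
  have hq1 : (1 : ℝ) ≤ q := by exact_mod_cast hq
  have hqw : q * w.re ≤ 1 / 8 := by
    rw [le_div_iff₀ (by positivity)] at hwq
    linarith
  have hre : (q * (w ^ 2 - r) : ℂ).re = q * (w.re ^ 2 - w.im ^ 2 - r) := by
    rw [← Complex.ofReal_natCast, Complex.re_ofReal_mul, Complex.sub_re, sq_re, Complex.ofReal_re]
  have himm : (q * (w ^ 2 - r) : ℂ).im = 2 * (q * w.re) * w.im := by
    rw [← Complex.ofReal_natCast, Complex.im_ofReal_mul]
    simp [sq]
    ring
  have hcase : (q * (w ^ 2 - r) : ℂ).re ≤ -(1 / 2) ∨ ‖(q * (w ^ 2 - r) : ℂ)‖ ≤ 3 / 4 := by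
    rcases le_or_gt (q * (w ^ 2 - r) : ℂ).re (-(1 / 2)) with h | h
    · exact Or.inl h
    right
    have hw8 : w.re ≤ 1 / 8 := by nlinarith
    have hqww : q * w.re ^ 2 ≤ 1 / 64 := by nlinarith
    rw [hre] at h
    have ht : w.im ^ 2 < 1 := by nlinarith [mul_nonneg (by linarith : (0 : ℝ) ≤ q) hr, sq_nonneg w.im]
    have ht1 : |w.im| < 1 := by rwa [sq_lt_one_iff_abs_lt_one] at ht
    have h1 : |(q * (w ^ 2 - r) : ℂ).re| ≤ 1 / 2 := by
      rw [hre, abs_le]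
      refine ⟨h.le, ?_⟩
      nlinarith [mul_nonneg (by linarith : (0 : ℝ) ≤ q) hr, mul_nonneg (by linarith : (0 : ℝ) ≤ q)
        (sq_nonneg w.im)]
    have h2 : |(q * (w ^ 2 - r) : ℂ).im| ≤ 1 / 4 := by
      have h3 : 0 ≤ q * w.re := by positivity
      rw [himm, abs_mul, abs_of_nonneg (by positivity)]
      nlinarith [abs_nonneg w.im]
    linarith [Complex.norm_le_abs_re_add_abs_im (q * (w ^ 2 - r) : ℂ)]
  have hle := inv_norm_one_sub_exp_le hcase
  have h1 : ‖(q * (w ^ 2 - r) : ℂ)‖⁻¹ ≤ ‖w ^ 2 - r‖⁻¹ := by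
    have h0 : 0 < ‖w ^ 2 - r‖ := lt_of_lt_of_le (by positivity) (sq_im_le_norm_sq_sub w hr)
    refine inv_anti₀ h0 ?_
    rw [norm_mul, Complex.norm_natCast]
    exact le_mul_of_one_le_left h0.le hq1
  have h2 := inv_norm_sq_sub_le hr hδ hδ1 him hrw
  have hp : 0 < |w.im| ^ (-(2 * δ)) := Real.rpow_pos_of_pos (abs_pos.2 him) _
  have h3 : 1 ≤ 2 * |w.im| ^ (-(2 * δ)) * Real.exp (w.im ^ 2 / 2) := by
    have h4 : (w.im ^ 2) ^ δ ≤ 2 * Real.exp (w.im ^ 2 / 2) := by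
      calc (w.im ^ 2) ^ δ ≤ (1 + w.im ^ 2) ^ δ := by gcongr; linarith
        _ ≤ (1 + w.im ^ 2) ^ (1 : ℝ) :=
          Real.rpow_le_rpow_of_exponent_le (by linarith [sq_nonneg w.im]) hδ1
        _ ≤ _ := by
          rw [Real.rpow_one]
          linarith [Real.add_one_le_exp (w.im ^ 2 / 2)]
    have h5 : |w.im| ^ (-(2 * δ)) * (w.im ^ 2) ^ δ = 1 := by
      rw [← sq_abs, ← Real.rpow_natCast |w.im|, ← Real.rpow_mul (abs_nonneg _),
        ← Real.rpow_add (abs_pos.2 him)]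
      simp
    calc (1 : ℝ) = |w.im| ^ (-(2 * δ)) * (w.im ^ 2) ^ δ := h5.symm
      _ ≤ |w.im| ^ (-(2 * δ)) * (2 * Real.exp (w.im ^ 2 / 2)) := by gcongr
      _ = _ := by ring
  have h4 : 0 ≤ |r - (w ^ 2).re| ^ (δ - 1) := by positivity
  have h5 : |w.im| ^ (-(2 * δ)) ≤ 2 * |w.im| ^ (-(2 * δ)) * Real.exp (w.im ^ 2 / 2) := by
    have : 1 ≤ Real.exp (w.im ^ 2 / 2) := Real.one_le_exp (by positivity)
    nlinarith
  calc _ ≤ 3 + 4 * (|r - (w ^ 2).re| ^ (δ - 1) * |w.im| ^ (-(2 * δ))) := by linarith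
    _ ≤ 3 * (2 * |w.im| ^ (-(2 * δ)) * Real.exp (w.im ^ 2 / 2)) +
        4 * (|r - (w ^ 2).re| ^ (δ - 1) *
          (2 * |w.im| ^ (-(2 * δ)) * Real.exp (w.im ^ 2 / 2))) := by gcongr; linarith
    _ = _ := by ring

theorem norm_periodicPolylog_numerator_le {c : ℕ → ℂ} (q : ℕ) (hc : ∀ n, ‖c n‖ ≤ 1) {v : ℂ}
    (hv : v.re ≤ 1) :
    ‖∑ n ∈ Finset.range q, c (n + 1) * Complex.exp v ^ (n + 1)‖ ≤
      (∑ n ∈ Finset.range q, Real.exp n) * Real.exp v.re := by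
  rw [Finset.sum_mul]
  refine (norm_sum_le _ _).trans (Finset.sum_le_sum fun n _ => ?_)
  rw [norm_mul, norm_pow, Complex.norm_exp, pow_succ, ← Real.exp_nat_mul]
  calc _ ≤ 1 * (Real.exp (n * v.re) * Real.exp v.re) := by
        gcongr; exact hc _
    _ ≤ _ := by
        rw [one_mul]
        gcongr
        exact mul_le_of_le_one_right (Nat.cast_nonneg n) hv

theorem exists_norm_periodicPolylog_integrand_le {c : ℕ → ℂ} {q : ℕ} (k : ℕ) (hq : 1 ≤ q)
    (hc : ∀ n, ‖c n‖ ≤ 1) {δ : ℝ} (hδ : 0 < δ) (hδ1 : δ ≤ 1) :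
    ∃ C : ℝ, 0 ≤ C ∧ ∀ w : ℂ, 0 < w.re → w.re ≤ 1 / (8 * q) → w.im ≠ 0 →
      ∀ r : ℝ, 0 < r → r ≠ (w ^ 2).re →
      ‖(r : ℂ) ^ (k - 1) * ((∑ n ∈ Finset.range q, c (n + 1) *
        (Complex.exp (w ^ 2) * Complex.exp (-r)) ^ (n + 1)) /
        (1 - (Complex.exp (w ^ 2) * Complex.exp (-r)) ^ q))‖ ≤
      C * (|w.im| ^ (-(2 * δ)) * Real.exp (-(1 / 2) * w.im ^ 2)) *
        (3 * Real.exp (-(1 / 2) * r) +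
          4 * (|r - (w ^ 2).re| ^ (δ - 1) * Real.exp (-(1 / 2) * r))) := by
  obtain ⟨B, hB, hBle⟩ := exists_one_add_mul_rpow_le (N := (k - 1 : ℕ)) (Nat.cast_nonneg _)
    zero_le_one (show (0 : ℝ) < 1 / 2 by norm_num)
  obtain ⟨A, hA0, hA⟩ : ∃ A : ℝ, 0 ≤ A ∧ ∀ v : ℂ, v.re ≤ 1 →
      ‖∑ n ∈ Finset.range q, c (n + 1) * Complex.exp v ^ (n + 1)‖ ≤ A * Real.exp v.re :=
    ⟨_, Finset.sum_nonneg fun n _ => (Real.exp_pos _).le, fun v hv =>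
      norm_periodicPolylog_numerator_le q hc hv⟩
  have hq1 : (1 : ℝ) ≤ q := by exact_mod_cast hq
  refine ⟨A * B * Real.exp 1 * 2, by positivity, fun w hw hwq him r hr hrw => ?_⟩
  have hw1 : w.re ≤ 1 := hwq.trans (by rw [div_le_one (by positivity)]; linarith)
  have hre : (w ^ 2).re ≤ 1 - w.im ^ 2 := by rw [sq_re]; nlinarith
  have hvre : (w ^ 2 - r : ℂ).re = (w ^ 2).re - r := by rw [Complex.sub_re, Complex.ofReal_re]
  have hnum := hA (w ^ 2 - r) (by rw [hvre]; linarith [sq_nonneg w.im])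
  rw [hvre] at hnum
  have hden := inv_norm_one_sub_exp_nat_mul_le hq hr.le hδ hδ1 hw hwq him hrw
  have hrk : r ^ (k - 1) ≤ B * Real.exp (1 / 2 * r) := by
    have h1 := hBle r hr.le
    rw [Real.rpow_natCast] at h1
    exact (pow_le_pow_left₀ hr.le (by linarith) _).trans h1
  -- Half of the decay in `r` has paid for `r ^ (k - 1)`, half of the decay in `Im w` for the factor
  -- in `hden`; the other halves remain.
  have he : Real.exp (1 / 2 * r) * Real.exp ((w ^ 2).re - r) * Real.exp (w.im ^ 2 / 2) ≤
      Real.exp 1 * Real.exp (-(1 / 2) * w.im ^ 2) * Real.exp (-(1 / 2) * r) := by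
    rw [← Real.exp_add, ← Real.exp_add, ← Real.exp_add, ← Real.exp_add]
    exact Real.exp_le_exp.2 (by linarith)
  rw [← Complex.exp_add, ← sub_eq_add_neg, ← Complex.exp_nat_mul _ q, norm_mul, norm_div,
    div_eq_mul_inv, norm_pow, Complex.norm_real, Real.norm_of_nonneg hr.le]
  have hX : 0 ≤ |r - (w ^ 2).re| ^ (δ - 1) := by positivity
  have hT : 0 ≤ |w.im| ^ (-(2 * δ)) := by positivity
  generalize |r - (w ^ 2).re| ^ (δ - 1) = X at hden hX ⊢
  generalize |w.im| ^ (-(2 * δ)) = T at hden hT ⊢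
  calc _ ≤ (B * Real.exp (1 / 2 * r)) * ((A * Real.exp ((w ^ 2).re - r)) *
        (2 * T * Real.exp (w.im ^ 2 / 2) * (3 + 4 * X))) := by gcongr
    _ = A * B * 2 * T * (3 + 4 * X) * (Real.exp (1 / 2 * r) * Real.exp ((w ^ 2).re - r) *
        Real.exp (w.im ^ 2 / 2)) := by ring
    _ ≤ A * B * 2 * T * (3 + 4 * X) *
        (Real.exp 1 * Real.exp (-(1 / 2) * w.im ^ 2) * Real.exp (-(1 / 2) * r)) := by gcongr
    _ = _ := by ring

/-- Uniform in `Re w`, with an arbitrarily weak singularity at `Im w = 0`. The freedom in `δ` is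
what reaches every `z` with `Re s > 0`. -/
theorem exists_norm_periodicPolylog_line_le {c : ℕ → ℂ} {q : ℕ} (k : ℕ) (hq : 1 ≤ q)
    (hc : ∀ n, ‖c n‖ ≤ 1) {δ : ℝ} (hδ : 0 < δ) (hδ1 : δ ≤ 1) :
    ∃ C : ℝ, 0 ≤ C ∧ ∀ w : ℂ, 0 < w.re → w.re ≤ 1 / (8 * q) → w.im ≠ 0 →
      ‖periodicPolylog c q k (Complex.exp (w ^ 2))‖ ≤
        C * (|w.im| ^ (-(2 * δ)) * Real.exp (-(1 / 2) * w.im ^ 2)) := by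
  obtain ⟨C, hC, hCle⟩ := exists_norm_periodicPolylog_integrand_le k hq hc hδ hδ1
  obtain ⟨K, hK, hKle⟩ := exists_integral_abs_sub_rpow_le (p := δ - 1) (by linarith) (by linarith)
    (show (0 : ℝ) < 1 / 2 by norm_num)
  have hJi : IntegrableOn (fun r : ℝ => Real.exp (-(1 / 2) * r)) (Ioi 0) :=
    integrableOn_exp_mul_Ioi (by norm_num) 0
  have hJ0 : 0 ≤ ∫ r in Ioi (0 : ℝ), Real.exp (-(1 / 2) * r) :=
    integral_nonneg fun r => (Real.exp_pos _).le
  refine ⟨C * (3 * (∫ r in Ioi (0 : ℝ), Real.exp (-(1 / 2) * r)) + 4 * K), by positivity,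
    fun w hw hwq him => ?_⟩
  obtain ⟨hi, hile⟩ := hKle (w ^ 2).re
  have hW : 0 ≤ |w.im| ^ (-(2 * δ)) * Real.exp (-(1 / 2) * w.im ^ 2) := by positivity
  have hfac : ‖(1 / ((k - 1).factorial : ℂ))‖ ≤ 1 := by
    rw [norm_div, norm_one, Complex.norm_natCast]
    refine div_le_one_of_le₀ ?_ (by positivity)
    exact_mod_cast Nat.succ_le_of_lt (Nat.factorial_pos _)
  unfold periodicPolylog
  rw [norm_mul]
  refine (mul_le_of_le_one_left (norm_nonneg _) hfac).trans ?_
  refine (norm_integral_le_of_norm_le (((hJi.const_mul 3).add (hi.const_mul 4)).const_mul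
    (C * (|w.im| ^ (-(2 * δ)) * Real.exp (-(1 / 2) * w.im ^ 2)))) ?_).trans ?_
  · filter_upwards [ae_restrict_mem measurableSet_Ioi, ae_restrict_ne (w ^ 2).re (Ioi 0)]
      with r hr hr'
    exact hCle w hw hwq him r hr hr'
  · rw [integral_const_mul]
    simp only [Pi.add_apply]
    rw [integral_add (hJi.const_mul 3) (hi.const_mul 4), integral_const_mul, integral_const_mul]
    generalize |w.im| ^ (-(2 * δ)) * Real.exp (-(1 / 2) * w.im ^ 2) = W at hW ⊢
    calc _ ≤ C * W * (3 * (∫ r in Ioi (0 : ℝ), Real.exp (-(1 / 2) * r)) + 4 * K) := by gcongr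
      _ = _ := by ring

theorem stronglyMeasurable_periodicPolylog_comp (c : ℕ → ℂ) (q k : ℕ) {g : ℝ → ℂ}
    (hg : Measurable g) : StronglyMeasurable fun t => periodicPolylog c q k (g t) := by
  refine StronglyMeasurable.const_mul (StronglyMeasurable.integral_prod_right
    (f := fun (t : ℝ) (r : ℝ) => (r : ℂ) ^ (k - 1) *
      ((∑ n ∈ Finset.range q, c (n + 1) * (g t * Complex.exp (-r)) ^ (n + 1)) /
      (1 - (g t * Complex.exp (-r)) ^ q))) ?_) _
  refine Measurable.stronglyMeasurable ?_
  have h : Measurable fun p : ℝ × ℝ => g p.1 * Complex.exp (-(p.2 : ℂ)) :=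
    (hg.comp measurable_fst).mul (by fun_prop)
  refine Measurable.mul (by fun_prop) (Measurable.div ?_ ?_)
  · exact Finset.measurable_sum _ fun n _ => (h.pow_const _).const_mul _
  · exact measurable_const.sub (h.pow_const _)

theorem differentiableOn_periodicPolylog {c : ℕ → ℂ} {q k : ℕ} (hq : 1 ≤ q)
    (hcq : ∀ n, c (n + q) = c n) (hc : ∀ n, ‖c n‖ ≤ 1) (hk : 1 ≤ k) :
    DifferentiableOn ℂ (periodicPolylog c q k) (Metric.ball 0 1) := by
  intro x hx
  obtain ⟨ρ, hxρ, hρ⟩ := exists_between (mem_ball_zero_iff.1 hx)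
  have hρ0 : 0 < ρ := (norm_nonneg x).trans_lt hxρ
  have h : DifferentiableOn ℂ (fun x : ℂ => ∑' n : ℕ, c (n + 1) * x ^ (n + 1) / ((n + 1 : ℕ) : ℂ) ^ k)
      (Metric.ball 0 ρ) := by
    refine Complex.differentiableOn_tsum_of_summable_norm (u := fun n : ℕ => ρ ^ (n + 1))
      ((summable_nat_add_iff 1).2 (summable_geometric_of_lt_one hρ0.le hρ))
      (fun n => by fun_prop) Metric.isOpen_ball fun n y hy => ?_
    rw [norm_div, norm_mul, norm_pow, norm_pow, Complex.norm_natCast]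
    have hy : ‖y‖ < ρ := by simpa using hy
    have h1 : (1 : ℝ) ≤ ((n + 1 : ℕ) : ℝ) ^ k := one_le_pow₀ (by push_cast; linarith [(n.cast_nonneg : (0 : ℝ) ≤ n)])
    calc _ ≤ ‖c (n + 1)‖ * ‖y‖ ^ (n + 1) := div_le_self (by positivity) h1
      _ ≤ 1 * ρ ^ (n + 1) := by gcongr; exact hc _
      _ = _ := one_mul _
  have hmem : Metric.ball (0 : ℂ) ρ ∈ 𝓝 x := Metric.isOpen_ball.mem_nhds (by simpa using hxρ)
  refine ((h.differentiableAt hmem).congr_of_eventuallyEq ?_).differentiableWithinAt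
  filter_upwards [hmem] with y hy
  exact (hasSum_periodicPolylog hq hcq hk ((mem_ball_zero_iff.1 hy).trans hρ)).tsum_eq.symm

/-- One statement serves the Dirichlet weights and `Li_k(e ^ u)` with `b = 0`, and `e ^ (iu) Li_k(e
^ u)` with `b = 1`. On a line `|e ^ (ibu)| = e ^ (-2bσt)`, which the Gaussian absorbs. -/
theorem hasBoundaryPMT_exp_mul_periodicPolylog {c : ℕ → ℂ} {q k : ℕ} (hq : 1 ≤ q)
    (hcq : ∀ n, c (n + q) = c n) (hc : ∀ n, ‖c n‖ ≤ 1) (hk : 1 ≤ k) (b : ℝ) {z : ℂ}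
    (hz : 0 < (z + 1 / 2).re) :
    ∃ S : ℂ, HasSum (fun n : ℕ => c (n + 1) / ((n + 1 : ℕ) : ℂ) ^ k *
      (((n + 1 : ℕ) : ℂ) + b * Complex.I) ^ (-(z + 1 / 2)) * pmtG z) S ∧
      HasBoundaryPMT (fun u => Complex.exp (b * Complex.I * u) *
        periodicPolylog c q k (Complex.exp u)) z S := by
  have hexp : ∀ t : ℝ, t ≠ 0 → ‖Complex.exp (-(t : ℂ) ^ 2)‖ < 1 := fun t ht =>
    norm_exp_neg_sq_lt_one ht
  refine ⟨_, hasSum_pmt_zero (f := fun u => Complex.exp (b * Complex.I * u) *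
        periodicPolylog c q k (Complex.exp u)) (fun n => ?_) hz (fun t ht => ?_) ?_, ?_⟩
  · simp
    positivity
  · have h := (hasSum_periodicPolylog hq hcq hk (hexp t ht)).mul_left
      (Complex.exp (b * Complex.I * -(t : ℂ) ^ 2))
    refine h.congr_fun fun n => ?_
    rw [← Complex.exp_nat_mul, add_mul, Complex.exp_add]
    ring
  · have hs : Summable fun n : ℕ => ((n + 1 : ℕ) : ℝ) ^ (-(k + (z + 1 / 2).re)) := by
      have : (1 : ℝ) ≤ k := by exact_mod_cast hk
      exact summable_nat_succ_rpow_neg (by linarith)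
    refine Summable.of_nonneg_of_le (fun n => mul_nonneg (norm_nonneg _)
      (Real.rpow_nonneg (by simp; positivity) _)) (fun n => ?_) hs
    have hn : (0 : ℝ) < ((n + 1 : ℕ) : ℝ) := by positivity
    have hre : (((n + 1 : ℕ) : ℂ) + b * Complex.I).re = ((n + 1 : ℕ) : ℝ) := by simp
    rw [hre, neg_add, Real.rpow_add hn, norm_div, norm_pow, Complex.norm_natCast,
      Real.rpow_neg hn.le (k : ℝ), Real.rpow_natCast]
    gcongr ?_ * _
    rw [div_eq_mul_inv]
    exact mul_le_of_le_one_left (by positivity) (hc _)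
  -- The singularity of the majorant is `|t| ^ (-2δ)`. Its integrability needs `2δ < 1` and, with
  -- the factor `|t| ^ (2 Re z)`, also `δ < Re s`.
  · set δ : ℝ := min (1 / 4) ((z + 1 / 2).re / 2) with hδ
    have hδ0 : 0 < δ := lt_min (by norm_num) (by linarith)
    have hδ1 : δ ≤ 1 / 4 := min_le_left _ _
    have hδ2 : δ ≤ (z + 1 / 2).re / 2 := min_le_right _ _
    have hzre : (z + 1 / 2).re = z.re + 1 / 2 := by simp
    have hq1 : (1 : ℝ) ≤ q := by exact_mod_cast hq
    obtain ⟨C, hC, hle⟩ := exists_norm_periodicPolylog_line_le k hq hc hδ0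
      (by linarith : δ ≤ 1)
    have hs0 : (0 : ℝ) < 1 / (8 * q) := by positivity
    have hs1 : 1 / (8 * q) ≤ (1 : ℝ) := by rw [div_le_one (by positivity)]; linarith
    set E : ℝ := Real.exp ((2 * |b|) ^ 2 / (2 * (1 / 2))) with hE
    have hbound : ∀ σ t : ℝ, 0 < σ → σ ≤ 1 / (8 * q) → t ≠ 0 →
        ‖Complex.exp (b * Complex.I * ((σ : ℂ) + t * Complex.I) ^ 2) *
          periodicPolylog c q k (Complex.exp (((σ : ℂ) + t * Complex.I) ^ 2))‖ ≤
        C * E * (‖(σ : ℂ) + t * Complex.I‖ ^ (-0 : ℝ) * |t| ^ (-(2 * δ)) *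
          Real.exp (-(1 / 4) * t ^ 2)) := by
      intro σ t hσ hσ1 ht
      have h := hle ((σ : ℂ) + t * Complex.I) (by simpa using hσ) (by simpa using hσ1)
        (by simpa using ht)
      have him : ((σ : ℂ) + t * Complex.I).im = t := by simp
      rw [him] at h
      have h1 : ‖Complex.exp (b * Complex.I * ((σ : ℂ) + t * Complex.I) ^ 2)‖ ≤
          E * Real.exp (1 / 4 * t ^ 2) := by
        have h2 : (b * Complex.I * ((σ : ℂ) + t * Complex.I) ^ 2).re = -(2 * b * (σ * t)) := by
          simp [sq]; ring
        rw [Complex.norm_exp, h2]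
        refine le_trans (Real.exp_le_exp.2 ?_)
          ((exp_mul_abs_le (2 * |b|) (show (0 : ℝ) < 1 / 2 by norm_num) t).trans (le_of_eq ?_))
        · calc -(2 * b * (σ * t)) ≤ |2 * b * (σ * t)| := neg_le_abs _
            _ = 2 * |b| * (σ * |t|) := by
              rw [abs_mul, abs_mul, abs_mul, abs_of_pos hσ, abs_two]
            _ ≤ 2 * |b| * (1 * |t|) := by gcongr; exact hσ1.trans hs1
            _ = _ := by ring
        · rw [hE]; norm_num
      rw [norm_mul, neg_zero, Real.rpow_zero, one_mul]
      calc _ ≤ (E * Real.exp (1 / 4 * t ^ 2)) *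
            (C * (|t| ^ (-(2 * δ)) * Real.exp (-(1 / 2) * t ^ 2))) := by gcongr
        _ = C * E * (|t| ^ (-(2 * δ)) *
            (Real.exp (1 / 4 * t ^ 2) * Real.exp (-(1 / 2) * t ^ 2))) := by ring
        _ = _ := by rw [← Real.exp_add]; ring_nf
    have hcont : ∀ t : ℝ, t ≠ 0 → ContinuousAt (fun u => Complex.exp (b * Complex.I * u) *
        periodicPolylog c q k (Complex.exp u)) (-(t : ℂ) ^ 2) := by
      intro t ht
      refine ContinuousAt.mul (by fun_prop) ?_
      refine ContinuousAt.comp (g := periodicPolylog c q k) (f := Complex.exp) ?_ (by fun_prop)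
      exact ((differentiableOn_periodicPolylog hq hcq hc hk).differentiableAt
        (Metric.isOpen_ball.mem_nhds (by simpa using hexp t ht))).continuousAt
    have hmeas : ∀ σ : ℝ, 0 < σ → σ ≤ 1 / (8 * q) → AEStronglyMeasurable fun t : ℝ =>
        Complex.exp (b * Complex.I * ((σ : ℂ) + t * Complex.I) ^ 2) *
          periodicPolylog c q k (Complex.exp (((σ : ℂ) + t * Complex.I) ^ 2)) := by
      intro σ _ _
      refine AEStronglyMeasurable.mul ?_
        (stronglyMeasurable_periodicPolylog_comp c q k (by fun_prop)).aestronglyMeasurable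
      exact Measurable.aestronglyMeasurable (by fun_prop)
    exact hasBoundaryPMT_of_bound hs0 (by linarith) (by norm_num) (by positivity) hmeas hbound hcont
      (by linarith)

/-! ### Dirichlet `L`-weights and polylogarithms -/

theorem hasSum_riemannZeta {s : ℂ} (hs : 1 < s.re) :
    HasSum (fun n : ℕ => 1 / ((n + 1 : ℕ) : ℂ) ^ s) (riemannZeta s) := by
  have h := hasSum_hurwitzZetaPos one_pos hs
  rw [hurwitzZetaPos_one] at h
  simpa using h

theorem hasSum_dirichletLFunction {q : ℕ} [NeZero q] (χ : DirichletCharacter ℂ q) {s : ℂ}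
    (hs : 1 < s.re) :
    HasSum (fun n : ℕ => χ ((n + 1 : ℕ) : ZMod q) / ((n + 1 : ℕ) : ℂ) ^ s)
      (DirichletCharacter.LFunction χ s) := by
  have h := (ZMod.LSeriesSummable_of_one_lt_re (fun n : ZMod q => χ n) hs).LSeriesHasSum
  rw [LSeriesHasSum, ← DirichletCharacter.LFunction_eq_LSeries χ hs] at h
  have h1 := (hasSum_nat_add_iff' 1).2 h
  simp only [Finset.sum_range_one, LSeries.term_zero, sub_zero] at h1
  refine h1.congr_fun fun n => ?_
  rw [LSeries.term_of_ne_zero (Nat.succ_ne_zero n)]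

theorem natCast_succ_cpow_neg_div_pow (n k : ℕ) (s : ℂ) :
    1 / ((n + 1 : ℕ) : ℂ) ^ k * ((n + 1 : ℕ) : ℂ) ^ (-s) = 1 / ((n + 1 : ℕ) : ℂ) ^ (s + k) := by
  rw [Complex.cpow_add _ _ (Nat.cast_ne_zero.2 n.succ_ne_zero), Complex.cpow_natCast,
    Complex.cpow_neg]
  field_simp

theorem add_natCast_ne_one {s : ℂ} (hs : 0 < s.re) {k : ℕ} (hk : 1 ≤ k) : s + k ≠ 1 := fun h => by
  have h1 := congrArg Complex.re h
  have h2 : (1 : ℝ) ≤ k := by exact_mod_cast hk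
  simp at h1
  linarith

theorem one_lt_add_natCast_re {s : ℂ} (hs : 0 < s.re) {k : ℕ} (hk : 1 ≤ k) : 1 < (s + k).re := by
  have h2 : (1 : ℝ) ≤ k := by exact_mod_cast hk
  simp
  linarith

theorem setOf_add_natCast_ne_one (k : ℕ) :
    {z : ℂ | (z + 1 / 2) + k ≠ 1} = {z : ℂ | z ≠ 1 / 2 - k} := by
  ext z
  refine not_congr ⟨fun h => ?_, fun h => ?_⟩ <;> linear_combination h

theorem hasBoundaryPMT_dirichletWeight {q : ℕ} [NeZero q] (χ : DirichletCharacter ℂ q) {k : ℕ}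
    (hk : 1 ≤ k) {z : ℂ} (hz : 0 < (z + 1 / 2).re) :
    HasBoundaryPMT (dirichletWeight χ k) z
      (pmtG z * DirichletCharacter.LFunction χ ((z + 1 / 2) + k)) := by
  obtain ⟨S, hS, h⟩ := hasBoundaryPMT_exp_mul_periodicPolylog (c := fun n : ℕ => χ n) (q := q)
    NeZero.one_le (fun n => by simp) (fun n => χ.norm_le_one _) hk 0 hz
  have h1 := (hasSum_dirichletLFunction χ (one_lt_add_natCast_re hz hk)).mul_left (pmtG z)
  have hSeq : S = pmtG z * DirichletCharacter.LFunction χ ((z + 1 / 2) + k) := by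
    refine hS.unique (h1.congr_fun fun n => ?_)
    rw [div_eq_mul_one_div _ (_ ^ ((z + 1 / 2) + (k : ℂ))), ← natCast_succ_cpow_neg_div_pow]
    simp only [Complex.ofReal_zero, zero_mul, add_zero]
    ring
  rw [← hSeq, show dirichletWeight χ k = fun u => periodicPolylog (fun n => χ n) q k
    (Complex.exp u) from rfl]
  simpa using h

theorem continuesTransform_dirichletWeight {q : ℕ} [NeZero q] (χ : DirichletCharacter ℂ q) {k : ℕ}
    (hk : 1 ≤ k) :
    ContinuesTransform (HasBoundaryPMT (dirichletWeight χ k))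
      {z | 0 < (z + 1 / 2).re} {z | (z + 1 / 2) + k ≠ 1 ∨ χ ≠ 1}
      (fun z => pmtG z * DirichletCharacter.LFunction χ ((z + 1 / 2) + k)) := by
  have hU : IsOpen {z : ℂ | (z + 1 / 2) + k ≠ 1 ∨ χ ≠ 1} ∧
      IsPreconnected {z : ℂ | (z + 1 / 2) + k ≠ 1 ∨ χ ≠ 1} := by
    by_cases hχ : χ = 1
    · simp only [hχ, ne_eq, not_true_eq_false, or_false]
      have h := isOpen_preconnected_ne (1 / 2 - (k : ℂ))
      rwa [← setOf_add_natCast_ne_one] at h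
    · simp only [ne_eq, hχ, not_false_eq_true, or_true]
      exact ⟨isOpen_univ, isPreconnected_univ⟩
  exact
  { isOpen_dom := isOpen_lt continuous_const (by fun_prop)
    nonempty_dom := ⟨0, by simp⟩
    subset := fun z hz => Or.inl (add_natCast_ne_one hz hk)
    isOpen := hU.1
    isPreconnected := hU.2
    eq_transform := fun z hz => hasBoundaryPMT_dirichletWeight χ hk hz
    differentiableOn := fun z hz => DifferentiableAt.differentiableWithinAt
      ((differentiable_pmtG z).mul (DifferentiableAt.comp (g := DirichletCharacter.LFunction χ)
        (f := fun z => (z + 1 / 2) + (k : ℂ)) z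
        (DirichletCharacter.differentiableAt_LFunction χ _ hz) (by fun_prop))) }

theorem hasBoundaryPMT_polylog {k : ℕ} (hk : 1 ≤ k) {z : ℂ} (hz : 0 < (z + 1 / 2).re) :
    HasBoundaryPMT (fun u => polylog k (Complex.exp u)) z
      (pmtG z * riemannZeta ((z + 1 / 2) + k)) := by
  obtain ⟨S, hS, h⟩ := hasBoundaryPMT_exp_mul_periodicPolylog (c := fun _ => 1) (q := 1)
    le_rfl (fun n => rfl) (fun n => by simp) hk 0 hz
  have h1 := (hasSum_riemannZeta (one_lt_add_natCast_re hz hk)).mul_left (pmtG z)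
  have hSeq : S = pmtG z * riemannZeta ((z + 1 / 2) + k) := by
    refine hS.unique (h1.congr_fun fun n => ?_)
    rw [← natCast_succ_cpow_neg_div_pow]
    simp only [Complex.ofReal_zero, zero_mul, add_zero]
    ring
  rw [← hSeq]
  simpa [polylog] using h

theorem continuesTransform_polylog {k : ℕ} (hk : 1 ≤ k) :
    ContinuesTransform (HasBoundaryPMT (fun u => polylog k (Complex.exp u)))
      {z | 0 < (z + 1 / 2).re} {z | (z + 1 / 2) + k ≠ 1}
      (fun z => pmtG z * riemannZeta ((z + 1 / 2) + k)) where
  isOpen_dom := isOpen_lt continuous_const (by fun_prop)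
  nonempty_dom := ⟨0, by simp⟩
  subset := fun z hz => add_natCast_ne_one hz hk
  isOpen := setOf_add_natCast_ne_one k ▸ (isOpen_preconnected_ne _).1
  isPreconnected := setOf_add_natCast_ne_one k ▸ (isOpen_preconnected_ne _).2
  eq_transform := fun z hz => hasBoundaryPMT_polylog hk hz
  differentiableOn := fun z hz => DifferentiableAt.differentiableWithinAt
    ((differentiable_pmtG z).mul (DifferentiableAt.comp (g := riemannZeta)
      (f := fun z => (z + 1 / 2) + (k : ℂ)) z (differentiableAt_riemannZeta hz) (by fun_prop)))

theorem ascPochhammer_eval_eq_prod (k : ℕ) (s : ℂ) :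
    (ascPochhammer ℂ k).eval s = ∏ j ∈ Finset.range k, (s + j) := by
  induction k with
  | zero => simp
  | succ k ih => rw [ascPochhammer_succ_eval, Finset.prod_range_succ, ih]

theorem pmtG_add_natCast (z : ℂ) (k : ℕ) :
    pmtG (z + k) = (-1) ^ k * (∏ j ∈ Finset.range k, ((z + 1 / 2) + j)) * pmtG z := by
  have h := Gamma_sub_nat_inv (1 / 2 - z) k
  rw [show 1 - (1 / 2 - z) = z + 1 / 2 by ring, ascPochhammer_eval_eq_prod] at h
  rw [pmtG_eq, pmtG_eq, show 1 / 2 - (z + k) = 1 / 2 - z - k by ring, h]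
  ring

theorem pmtG_mul_riemannZeta_add_natCast {k : ℕ} (hk : 1 ≤ k) {z : ℂ}
    (hz : ∀ j : ℕ, j < k → (z + 1 / 2) + j ≠ 0) :
    pmtG z * riemannZeta ((z + 1 / 2) + k) =
      pmtR (z + k) / ((-1) ^ k * ∏ j ∈ Finset.range k, ((z + 1 / 2) + j)) := by
  -- The pole `s = 1 - k` is already excluded by the factor with `j = k - 1`.
  have h1 : (z + k) + 1 / 2 ≠ 1 := fun h => by
    refine hz (k - 1) (by omega) ?_
    rw [Nat.cast_sub hk]
    push_cast
    linear_combination h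
  have h2 : ∏ j ∈ Finset.range k, ((z + 1 / 2) + (j : ℂ)) ≠ 0 :=
    Finset.prod_ne_zero_iff.2 fun j hj => hz j (Finset.mem_range.1 hj)
  rw [pmtR_eq h1, pmtG_add_natCast, show z + k + 1 / 2 = z + 1 / 2 + k by ring]
  have h3 : (-1 : ℂ) ^ k ≠ 0 := by simp
  generalize ∏ j ∈ Finset.range k, ((z + 1 / 2) + (j : ℂ)) = p at h2 ⊢
  field_simp

/-! ### The alternating polylogarithm -/

theorem polylog_neg (k : ℕ) (x : ℂ) :
    polylog k (-x) = -(1 / ((k - 1).factorial : ℂ) * ∫ r in Ioi (0 : ℝ), (r : ℂ) ^ (k - 1) *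
      (x * Complex.exp (-r) / (1 + x * Complex.exp (-r)))) := by
  rw [polylog, periodicPolylog, ← mul_neg, ← integral_neg]
  congr 2
  ext r
  simp only [Finset.range_one, Finset.sum_singleton, one_mul, zero_add, pow_one, neg_mul,
    sub_neg_eq_add]
  ring

theorem integrableOn_pow_mul_exp_neg (n : ℕ) :
    IntegrableOn (fun r : ℝ => r ^ n * Real.exp (-r)) (Ioi 0) := by
  have h := integrableOn_rpow_mul_exp_neg_mul (p := n) (c := 1)
    (by linarith [(n.cast_nonneg : (0 : ℝ) ≤ n)]) one_pos
  simpa using h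

theorem norm_exp_neg_ofReal (r : ℝ) : ‖Complex.exp (-(r : ℂ))‖ = Real.exp (-r) := by
  rw [Complex.norm_exp]
  simp

theorem norm_pow_mul_div_one_add_le {n : ℕ} {x : ℂ} {r : ℝ} (hr : 0 ≤ r)
    (h : 1 / 3 ≤ ‖1 + x * Complex.exp (-r)‖) :
    ‖(r : ℂ) ^ n * (x * Complex.exp (-r) / (1 + x * Complex.exp (-r)))‖ ≤
      3 * ‖x‖ * (r ^ n * Real.exp (-r)) := by
  rw [norm_mul, norm_div, norm_mul, norm_pow, Complex.norm_real, Real.norm_of_nonneg hr,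
    norm_exp_neg_ofReal, div_eq_mul_inv]
  have h1 : ‖1 + x * Complex.exp (-r)‖⁻¹ ≤ (1 / 3)⁻¹ := inv_anti₀ (by norm_num) h
  calc _ ≤ r ^ n * (‖x‖ * Real.exp (-r) * (1 / 3)⁻¹) := by gcongr
    _ = _ := by ring

theorem one_le_norm_one_add_mul_exp {x : ℂ} (hx : 0 ≤ x.re) (r : ℝ) :
    1 ≤ ‖1 + x * Complex.exp (-r)‖ := by
  have h : (1 + x * Complex.exp (-r)).re = 1 + x.re * Real.exp (-r) := by
    rw [← Complex.ofReal_neg, ← Complex.ofReal_exp, Complex.add_re, Complex.re_mul_ofReal,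
      Complex.one_re]
  refine le_trans ?_ ((le_abs_self _).trans (Complex.abs_re_le_norm _))
  rw [h]
  have := mul_nonneg hx (Real.exp_pos (-r)).le
  linarith

/-- With the denominator bounded below, `Li_k(-x)` is `O(‖x‖)`; for `x = e ^ (w ^ 2)` this is the
Gaussian decay. -/
theorem exists_norm_polylog_neg_le (k : ℕ) :
    ∃ C : ℝ, 0 ≤ C ∧ ∀ x : ℂ, (∀ r : ℝ, 0 < r → 1 / 3 ≤ ‖1 + x * Complex.exp (-r)‖) →
      ‖polylog k (-x)‖ ≤ C * ‖x‖ := by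
  have hJ : 0 ≤ ∫ r in Ioi (0 : ℝ), r ^ (k - 1) * Real.exp (-r) :=
    setIntegral_nonneg measurableSet_Ioi fun r hr => by
      have hr : 0 < r := hr
      positivity
  refine ⟨‖(1 / ((k - 1).factorial : ℂ))‖ *
    (3 * ∫ r in Ioi (0 : ℝ), r ^ (k - 1) * Real.exp (-r)), by positivity, fun x hx => ?_⟩
  rw [polylog_neg, norm_neg, norm_mul, mul_assoc]
  refine mul_le_mul_of_nonneg_left ?_ (norm_nonneg _)
  refine (norm_integral_le_of_norm_le ((integrableOn_pow_mul_exp_neg (k - 1)).const_mul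
    (3 * ‖x‖)) ?_).trans (le_of_eq ?_)
  · exact ae_restrict_of_forall_mem measurableSet_Ioi fun r hr =>
      norm_pow_mul_div_one_add_le (le_of_lt hr) (hx r hr)
  · rw [integral_const_mul]
    ring

theorem differentiableAt_polylog_neg_of_re_pos (k : ℕ) {x : ℂ} (hx : 0 < x.re) :
    DifferentiableAt ℂ (fun x => polylog k (-x)) x := by
  have hre : ∀ y ∈ Metric.ball x x.re, 0 ≤ y.re ∧ ‖y‖ ≤ ‖x‖ + x.re := by
    intro y hy
    rw [Metric.mem_ball, dist_eq_norm] at hy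
    have h1 := (abs_lt.1 ((Complex.abs_re_le_norm (y - x)).trans_lt hy)).1
    rw [Complex.sub_re] at h1
    exact ⟨by linarith, by linarith [norm_le_norm_add_norm_sub' y x]⟩
  have h := (hasDerivAt_integral_of_norm_le (μ := volume.restrict (Ioi (0 : ℝ)))
    (F := fun x (r : ℝ) => (r : ℂ) ^ (k - 1) *
      (x * Complex.exp (-r) / (1 + x * Complex.exp (-r)))) (z₀ := x) hx
    (bound := fun r => 3 * (‖x‖ + x.re) * (r ^ (k - 1) * Real.exp (-r)))
    (fun y _ => Measurable.aestronglyMeasurable (by fun_prop))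
    (ae_restrict_of_forall_mem measurableSet_Ioi fun r _ y hy => by
      refine DifferentiableAt.differentiableWithinAt ?_
      refine DifferentiableAt.const_mul (DifferentiableAt.div (by fun_prop) (by fun_prop) ?_) _
      exact norm_pos_iff.1 (one_pos.trans_le (one_le_norm_one_add_mul_exp (hre y hy).1 r)))
    ((integrableOn_pow_mul_exp_neg (k - 1)).const_mul _)
    (ae_restrict_of_forall_mem measurableSet_Ioi fun r hr y hy => by
      have hr : 0 < r := hr
      refine (norm_pow_mul_div_one_add_le hr.le
        ((by norm_num : (1 / 3 : ℝ) ≤ 1).trans (one_le_norm_one_add_mul_exp (hre y hy).1 r))).trans ?_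
      gcongr
      exact (hre y hy).2)).2.differentiableAt
  simp only [polylog_neg]
  exact (h.const_mul _).neg

theorem differentiableAt_polylog_of_norm_lt_one {k : ℕ} (hk : 1 ≤ k) {x : ℂ} (hx : ‖x‖ < 1) :
    DifferentiableAt ℂ (polylog k) x :=
  (differentiableOn_periodicPolylog (c := fun _ => 1) (q := 1) le_rfl (fun _ => rfl)
    (fun _ => by simp) hk).differentiableAt (Metric.isOpen_ball.mem_nhds (by simpa using hx))

/-- If `|Im w| ≤ 1`, then `|Im (w ^ 2)| ≤ 1 < π / 2`; otherwise `Re (w ^ 2) ≤ -3/4`. In both cases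
`-e ^ (w ^ 2)` stays away from the cut `[1, ∞)`. -/
theorem exp_sq_re_pos_or_norm_le {w : ℂ} (hw : 0 < w.re) (hwb : w.re < 1 / 2) :
    0 < (Complex.exp (w ^ 2)).re ∨ ‖Complex.exp (w ^ 2)‖ ≤ 4 / 7 := by
  rcases le_or_gt |w.im| 1 with ht | ht
  · left
    have him : (w ^ 2).im = 2 * w.re * w.im := by
      simp [sq]; ring
    have h1 : |(w ^ 2).im| ≤ 1 := by
      rw [him, abs_mul, abs_of_pos (by positivity)]
      nlinarith [abs_nonneg w.im]
    rw [Complex.exp_re]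
    refine mul_pos (Real.exp_pos _) (Real.cos_pos_of_mem_Ioo ?_)
    have := Real.pi_gt_three
    rw [abs_le] at h1
    exact ⟨by linarith, by linarith⟩
  · right
    have h1 : (w ^ 2).re ≤ -(3 / 4) := by
      rw [sq_re]
      have : 1 < w.im ^ 2 := by rwa [one_lt_sq_iff_one_lt_abs]
      nlinarith
    rw [Complex.norm_exp]
    calc Real.exp (w ^ 2).re ≤ Real.exp (-(3 / 4)) := Real.exp_le_exp.2 h1
      _ = (Real.exp (3 / 4))⁻¹ := Real.exp_neg _
      _ ≤ (7 / 4)⁻¹ := by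
        gcongr
        linarith [Real.add_one_le_exp (3 / 4 : ℝ)]
      _ = 4 / 7 := by norm_num

theorem isGaussianWeight_polylog_neg {k : ℕ} (hk : 1 ≤ k) :
    IsGaussianWeight (fun u => polylog k (-Complex.exp u)) (1 / 2) 0 where
  differentiableOn := by
    intro w hw
    refine DifferentiableAt.differentiableWithinAt ?_
    refine DifferentiableAt.comp (g := fun x => polylog k (-x))
      (f := fun w => Complex.exp (w ^ 2)) w ?_ (by fun_prop)
    rcases exp_sq_re_pos_or_norm_le hw.1 hw.2 with h | h
    · exact differentiableAt_polylog_neg_of_re_pos k h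
    · exact DifferentiableAt.comp (g := polylog k) (f := fun x => -x) _
        (differentiableAt_polylog_of_norm_lt_one hk (by rw [norm_neg]; linarith)) (by fun_prop)
  continuousAt := by
    intro t ht
    exact ContinuousAt.comp (g := polylog k) (f := fun u => -Complex.exp u)
      (differentiableAt_polylog_of_norm_lt_one hk
        (by rw [norm_neg]; exact norm_exp_neg_sq_lt_one ht)).continuousAt (by fun_prop)
  bound := by
    intro s hs hsb
    obtain ⟨C, hC, hle⟩ := exists_norm_polylog_neg_le k
    refine ⟨C * Real.exp 1, 1, by positivity, one_pos, fun w hw hws => ?_⟩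
    have hx : ∀ r : ℝ, 0 < r → 1 / 3 ≤ ‖1 + Complex.exp (w ^ 2) * Complex.exp (-r)‖ := by
      intro r hr
      rcases exp_sq_re_pos_or_norm_le hw (hws.trans_lt hsb) with h | h
      · exact (by norm_num : (1 / 3 : ℝ) ≤ 1).trans (one_le_norm_one_add_mul_exp h.le r)
      · have h1 : ‖Complex.exp (w ^ 2) * Complex.exp (-r)‖ ≤ 4 / 7 := by
          rw [norm_mul, norm_exp_neg_ofReal]
          have : Real.exp (-r) ≤ 1 := Real.exp_le_one_iff.2 (by linarith)
          exact (mul_le_of_le_one_right (norm_nonneg _) this).trans h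
        have h2 := norm_sub_norm_le (1 : ℂ) (-(Complex.exp (w ^ 2) * Complex.exp (-r)))
        rw [norm_one, norm_neg, sub_neg_eq_add] at h2
        linarith
    have hnum : ‖Complex.exp (w ^ 2)‖ ≤ Real.exp 1 * Real.exp (-1 * w.im ^ 2) := by
      rw [Complex.norm_exp, sq_re, ← Real.exp_add, Real.exp_le_exp]
      nlinarith
    rw [neg_zero, Real.rpow_zero, one_mul]
    calc _ ≤ C * ‖Complex.exp (w ^ 2)‖ := hle _ hx
      _ ≤ C * (Real.exp 1 * Real.exp (-1 * w.im ^ 2)) := by gcongr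
      _ = _ := by ring

theorem pmt_zero_polylog_neg {k : ℕ} (hk : 1 ≤ k) {z : ℂ} (hz : 0 < (z + 1 / 2).re) :
    pmt 0 (fun u => polylog k (-Complex.exp u)) z =
      -pmtG z * dirichletEta ((z + 1 / 2) + k) := by
  have h1 := hasSum_pmt_zero (f := fun u => polylog k (-Complex.exp u))
    (a := fun n => (-1) ^ (n + 1) / ((n + 1 : ℕ) : ℂ) ^ k)
    (α := fun n : ℕ => ((n + 1 : ℕ) : ℂ)) (z := z) (fun n => by
      rw [Complex.natCast_re]; positivity) hz
    (fun t ht => by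
      refine (hasSum_polylog hk (x := -Complex.exp (-(t : ℂ) ^ 2))
        (by rw [norm_neg]; exact norm_exp_neg_sq_lt_one ht)).congr_fun fun n => ?_
      rw [← neg_one_mul (Complex.exp _), mul_pow, ← Complex.exp_nat_mul]
      ring) (by
      have hs : Summable fun n : ℕ => ((n + 1 : ℕ) : ℝ) ^ (-((z + 1 / 2) + (k : ℂ)).re) :=
        summable_nat_succ_rpow_neg (one_lt_add_natCast_re hz hk)
      refine hs.congr fun n => ?_
      have hn : (0 : ℝ) < ((n + 1 : ℕ) : ℝ) := by positivity
      rw [norm_div, norm_pow, norm_neg, norm_one, one_pow, norm_pow, Complex.norm_natCast,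
        Complex.natCast_re, Complex.add_re _ (k : ℂ), Complex.natCast_re, neg_add,
        Real.rpow_add hn, Real.rpow_neg hn.le (k : ℝ), Real.rpow_natCast]
      ring)
  refine h1.unique (((hasSum_dirichletEta (one_lt_add_natCast_re hz hk)).mul_left
    (-pmtG z)).congr_fun fun n => ?_)
  rw [div_eq_mul_one_div _ (_ ^ ((z + 1 / 2) + (k : ℂ))), ← natCast_succ_cpow_neg_div_pow]
  ring

/-- The weight is holomorphic in a strip, so its transform is constant in `σ` on `(0, 1/2)`. The
boundary limit therefore exists for every `z`, even where the integral at `σ = 0` diverges. -/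
theorem hasBoundaryPMT_polylog_neg {k : ℕ} (hk : 1 ≤ k) (z : ℂ) :
    HasBoundaryPMT (fun u => polylog k (-Complex.exp u)) z
      (-pmtG z * dirichletEta ((z + 1 / 2) + k)) := by
  have hev : ∀ᶠ σ in 𝓝[>] (0 : ℝ), 0 < σ ∧ σ < 1 / 2 :=
    Ioo_mem_nhdsGT (by norm_num)
  refine ⟨hev.mono fun σ h => (isGaussianWeight_polylog_neg hk).integrable h.1 h.2 z,
    tendsto_const_nhds.congr' (hev.mono fun σ h => ?_)⟩
  refine ((isGaussianWeight_polylog_neg hk).pmt_eqOn (U := univ) (x₀ := 0)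
    (Φ := fun z => -pmtG z * dirichletEta ((z + 1 / 2) + k)) h.1 h.2
    isOpen_univ isPreconnected_univ (Differentiable.differentiableOn ?_)
    (by norm_num) (fun z hz => ⟨mem_univ _, pmt_zero_polylog_neg hk (by simp; linarith)⟩)
    (mem_univ z)).symm
  exact differentiable_pmtG.neg.mul (differentiable_dirichletEta.comp (by fun_prop))

/-! ### The polylogarithm with a complex shift -/

/-- The coefficient of `x ^ m` in the binomial series of `(1 + x) ^ (-s)`. -/
noncomputable def binomialCoeffNeg (m : ℕ) (s : ℂ) : ℂ :=
  (-1) ^ m * (ascPochhammer ℂ m).eval s / (m.factorial : ℂ)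

theorem choose_neg_eq_binomialCoeffNeg (s : ℂ) (m : ℕ) :
    Ring.choose (-s) m = binomialCoeffNeg m s := by
  have h := Ring.factorial_nsmul_multichoose_eq_ascPochhammer s m
  rw [Polynomial.ascPochhammer_smeval_eq_eval, nsmul_eq_mul] at h
  have hm : (m.factorial : ℂ) ≠ 0 := by exact_mod_cast m.factorial_ne_zero
  rw [Ring.choose_neg', binomialCoeffNeg, ← h, Int.negOnePow_def, Units.smul_def]
  simp
  field_simp

theorem hasSum_one_add_cpow_neg (s : ℂ) {x : ℂ} (hx : ‖x‖ < 1) :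
    HasSum (fun m : ℕ => binomialCoeffNeg m s * x ^ m) ((1 + x) ^ (-s)) := by
  have h := (Complex.one_add_cpow_hasFPowerSeriesOnBall_zero (a := -s)).hasSum (y := x)
    (by simpa [← enorm_eq_nnnorm, ← ofReal_norm] using hx)
  rw [zero_add] at h
  refine h.congr_fun fun m => ?_
  rw [binomialSeries_apply]
  simp [choose_neg_eq_binomialCoeffNeg]

/-- Comparing the Pochhammer product factor by factor gives polynomial growth in `m`, locally
uniformly in `s`. -/
theorem norm_binomialCoeffNeg_le {N : ℕ} {s : ℂ} (hs : ‖s‖ ≤ N) (m : ℕ) :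
    ‖binomialCoeffNeg m s‖ ≤ ((m + N).choose N : ℝ) := by
  have h : ∀ m : ℕ, ‖(ascPochhammer ℂ m).eval s‖ ≤ ((N + 1).ascFactorial m : ℝ) := by
    intro m
    induction m with
    | zero => simp
    | succ m ih =>
      rw [ascPochhammer_succ_eval, norm_mul, Nat.ascFactorial_succ, mul_comm]
      push_cast
      gcongr
      calc ‖s + m‖ ≤ ‖s‖ + ‖(m : ℂ)‖ := norm_add_le _ _
        _ ≤ _ := by rw [Complex.norm_natCast]; linarith
  have hm : (0 : ℝ) < m.factorial := by exact_mod_cast m.factorial_pos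
  rw [binomialCoeffNeg, norm_div, norm_mul, norm_pow, norm_neg, norm_one, one_pow, one_mul,
    Complex.norm_natCast, div_le_iff₀ hm]
  refine (h m).trans (le_of_eq ?_)
  rw [Nat.ascFactorial_eq_factorial_mul_choose, add_comm m N, Nat.choose_symm_add]
  push_cast
  ring

theorem summable_choose_mul_half_pow (N : ℕ) :
    Summable fun m : ℕ => ((m + N).choose N : ℝ) * (1 / 2) ^ m :=
  summable_choose_mul_geometric_of_norm_lt_one N (by norm_num)

theorem hasSum_riemannZeta_sub_one {x : ℂ} (hx : 1 < x.re) :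
    HasSum (fun n : ℕ => 1 / ((n + 2 : ℕ) : ℂ) ^ x) (riemannZeta x - 1) := by
  have h := (hasSum_nat_add_iff' 1).2 (hasSum_riemannZeta hx)
  simpa [add_assoc, one_add_one_eq_two] using h

theorem norm_natCast_add_two_cpow_le (n m : ℕ) {x : ℂ} {p : ℝ} (hx : p + m ≤ x.re) :
    ‖1 / ((n + 2 : ℕ) : ℂ) ^ x‖ ≤ ((n + 2 : ℕ) : ℝ) ^ (-p) * (1 / 2) ^ m := by
  have hn : (0 : ℝ) < ((n + 2 : ℕ) : ℝ) := by positivity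
  have hn2 : (2 : ℝ) ≤ ((n + 2 : ℕ) : ℝ) := by push_cast; linarith [(n.cast_nonneg : (0 : ℝ) ≤ n)]
  rw [norm_div, norm_one, Complex.norm_natCast_cpow_of_pos (by omega), one_div, ← Real.rpow_neg hn.le]
  calc ((n + 2 : ℕ) : ℝ) ^ (-x.re) ≤ ((n + 2 : ℕ) : ℝ) ^ (-p + -(m : ℝ)) :=
        Real.rpow_le_rpow_of_exponent_le (by linarith) (by linarith)
    _ = ((n + 2 : ℕ) : ℝ) ^ (-p) * (1 / ((n + 2 : ℕ) : ℝ)) ^ m := by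
        rw [Real.rpow_add hn, Real.rpow_neg hn.le (m : ℝ), Real.rpow_natCast, one_div, inv_pow]
    _ ≤ _ := by gcongr

theorem summable_nat_add_two_rpow_neg {p : ℝ} (hp : 1 < p) :
    Summable fun n : ℕ => ((n + 2 : ℕ) : ℝ) ^ (-p) := by
  have := (summable_nat_add_iff 1).2 (summable_nat_succ_rpow_neg hp)
  simpa [add_assoc, one_add_one_eq_two] using this

/-- Without the term `n = 1`, each further unit of `Re x` gains a factor of at most `1/2`. This
geometric decay beats the binomial coefficients. -/
theorem exists_norm_riemannZeta_sub_one_le :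
    ∃ C : ℝ, 0 ≤ C ∧ ∀ (x : ℂ) (m : ℕ), 2 + m ≤ x.re → ‖riemannZeta x - 1‖ ≤ C * (1 / 2) ^ m := by
  refine ⟨∑' n : ℕ, ((n + 2 : ℕ) : ℝ) ^ (-2 : ℝ), tsum_nonneg fun n => by positivity,
    fun x m hx => ?_⟩
  have hs := (summable_nat_add_two_rpow_neg one_lt_two).mul_right ((1 / 2 : ℝ) ^ m)
  rw [← (hasSum_riemannZeta_sub_one (by linarith [(m.cast_nonneg : (0 : ℝ) ≤ m)] :
    1 < x.re)).tsum_eq, ← tsum_mul_right]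
  exact tsum_of_norm_bounded hs.hasSum fun n => norm_natCast_add_two_cpow_le n m hx

theorem meromorphicAt_riemannZeta (s : ℂ) : MeromorphicAt riemannZeta s := by
  have hev : ∀ p : ℂ, p ≠ 1 → AnalyticAt ℂ riemannZeta p := fun p hp => by
    refine DifferentiableOn.analyticAt (s := {1}ᶜ) (fun x hx =>
      (differentiableAt_riemannZeta hx).differentiableWithinAt) ?_
    exact isOpen_compl_singleton.mem_nhds hp
  rcases eq_or_ne s 1 with rfl | hs
  -- The pole is simple, but with exponent `1` the product would be `0` at the point `1` and tend to
  -- `1` near it. The exponent `2` makes limit and value agree, so the singularity is removable as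
  -- it stands.
  · refine ⟨2, ?_⟩
    refine Complex.analyticAt_of_differentiable_on_punctured_nhds_of_continuousAt ?_ ?_
    · filter_upwards [self_mem_nhdsWithin] with x hx
      have h : DifferentiableAt ℂ (fun x : ℂ => (x - 1) ^ 2) x := by fun_prop
      exact h.smul (differentiableAt_riemannZeta hx)
    · rw [continuousAt_iff_punctured_nhds]
      have h1 : Tendsto (fun x : ℂ => x - 1) (𝓝[≠] 1) (𝓝 0) := by
        have : ContinuousAt (fun x : ℂ => x - 1) 1 := by fun_prop
        simpa using this.tendsto.mono_left nhdsWithin_le_nhds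
      have h2 := h1.mul riemannZeta_residue_one
      simp only [zero_mul] at h2
      simp only [sub_self, ne_eq, OfNat.ofNat_ne_zero, not_false_eq_true, zero_pow, zero_smul]
      refine h2.congr fun x => ?_
      rw [smul_eq_mul]
      ring
  · exact (hev s hs).meromorphicAt

/-- The terms of the expansion of `∑ n ^ (-k) (n + i) ^ (-s)`, `n ≥ 2`, in powers of `i / n`. -/
noncomputable def shiftedZetaTerm (k m : ℕ) (s : ℂ) : ℂ :=
  binomialCoeffNeg m s * Complex.I ^ m * (riemannZeta (s + k + m) - 1)

/-- The meromorphic continuation of `∑ n ^ (-k) (n + i) ^ (-s)`, `n ≥ 1`. -/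
noncomputable def shiftedZeta (k : ℕ) (s : ℂ) : ℂ :=
  (1 + Complex.I) ^ (-s) + ∑' m : ℕ, shiftedZetaTerm k m s

theorem differentiable_binomialCoeffNeg (m : ℕ) : Differentiable ℂ (binomialCoeffNeg m) :=
  ((Polynomial.differentiable _).const_mul _).div_const _

theorem differentiableAt_shiftedZetaTerm {k m : ℕ} {s : ℂ} (hs : s + k + m ≠ 1) :
    DifferentiableAt ℂ (shiftedZetaTerm k m) s := by
  refine ((differentiable_binomialCoeffNeg m s).mul_const _).mul (DifferentiableAt.sub_const ?_ 1)
  exact DifferentiableAt.comp (g := riemannZeta) (f := fun s => s + (k : ℂ) + m) s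
    (differentiableAt_riemannZeta hs) (by fun_prop)

theorem meromorphicAt_shiftedZetaTerm (k m : ℕ) (s : ℂ) :
    MeromorphicAt (shiftedZetaTerm k m) s := by
  have h1 : MeromorphicAt (fun s => binomialCoeffNeg m s * Complex.I ^ m) s :=
    (((differentiable_binomialCoeffNeg m).mul_const _).analyticAt s).meromorphicAt
  have h2 : MeromorphicAt (fun s : ℂ => riemannZeta (s + k + m)) s :=
    (meromorphicAt_riemannZeta (s + k + m)).comp_analyticAt (g := fun s : ℂ => s + k + m)
      (by fun_prop)
  exact h1.mul (h2.sub (MeromorphicAt.const 1 s))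

/-- For `‖s‖ ≤ N`, starting at index `N + 2` ensures `Re (s + k + m + N + 2) ≥ 2 + m`, clear of the
pole of `ζ`. The tail is then a normally convergent series of holomorphic functions. -/
theorem exists_norm_shiftedZetaTerm_le (k N : ℕ) :
    ∃ u : ℕ → ℝ, Summable u ∧ ∀ (s : ℂ) (m : ℕ), ‖s‖ ≤ N →
      ‖shiftedZetaTerm k (m + (N + 2)) s‖ ≤ u m := by
  obtain ⟨C, hC, hle⟩ := exists_norm_riemannZeta_sub_one_le
  have hsum := (((summable_nat_add_iff (N + 2)).2 (summable_choose_mul_half_pow N)).mul_left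
    (C * 2 ^ (N + 2)))
  refine ⟨_, hsum, fun s m hs => ?_⟩
  have h1 : 2 + (m : ℝ) ≤ (s + k + (m + (N + 2) : ℕ)).re := by
    have h2 := (abs_le.1 ((Complex.abs_re_le_norm s).trans hs)).1
    simp
    linarith [(k.cast_nonneg : (0 : ℝ) ≤ k)]
  rw [shiftedZetaTerm, norm_mul, norm_mul, norm_pow, Complex.norm_I, one_pow, mul_one]
  calc _ ≤ ((m + (N + 2) + N).choose N : ℝ) * (C * (1 / 2) ^ m) := by
        gcongr
        · exact norm_binomialCoeffNeg_le hs _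
        · exact hle _ _ h1
    _ = _ := by
        rw [pow_add (1 / 2 : ℝ) m]
        have : (2 : ℝ) ^ (N + 2) * (1 / 2) ^ (N + 2) = 1 := by
          rw [← mul_pow]; norm_num
        linear_combination -((m + (N + 2) + N).choose N : ℝ) * C * (1 / 2) ^ m * this

/-- Locally only finitely many terms can have a pole; analyticity and meromorphy are read off from
this splitting. -/
theorem shiftedZeta_eq_sum_add_tsum (k N : ℕ) {s : ℂ} (hs : ‖s‖ ≤ N) :
    shiftedZeta k s = (1 + Complex.I) ^ (-s) +
      (∑ m ∈ Finset.range (N + 2), shiftedZetaTerm k m s +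
        ∑' m : ℕ, shiftedZetaTerm k (m + (N + 2)) s) := by
  obtain ⟨u, hu, hle⟩ := exists_norm_shiftedZetaTerm_le k N
  have h : Summable fun m => shiftedZetaTerm k m s :=
    (summable_nat_add_iff (N + 2)).1 (Summable.of_norm_bounded hu fun m => hle s m hs)
  rw [shiftedZeta, h.sum_add_tsum_nat_add]

theorem differentiableOn_shiftedZeta_tail (k N : ℕ) :
    DifferentiableOn ℂ (fun s => ∑' m : ℕ, shiftedZetaTerm k (m + (N + 2)) s)
      (Metric.ball 0 N) := by
  obtain ⟨u, hu, hle⟩ := exists_norm_shiftedZetaTerm_le k N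
  refine Complex.differentiableOn_tsum_of_summable_norm hu (fun m s hs => ?_) Metric.isOpen_ball
    fun m s hs => hle s m (by simpa using (mem_ball_zero_iff.1 hs).le)
  refine (differentiableAt_shiftedZetaTerm fun h => ?_).differentiableWithinAt
  have h1 := congrArg Complex.re h
  have h2 := (abs_lt.1 ((Complex.abs_re_le_norm s).trans_lt (mem_ball_zero_iff.1 hs))).1
  simp at h1
  linarith [(k.cast_nonneg : (0 : ℝ) ≤ k), (m.cast_nonneg : (0 : ℝ) ≤ m)]

theorem exists_ball_mem_nhds (s : ℂ) : ∃ N : ℕ, Metric.ball (0 : ℂ) N ∈ 𝓝 s := by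
  obtain ⟨N, hN⟩ := exists_nat_gt ‖s‖
  exact ⟨N, Metric.isOpen_ball.mem_nhds (by simpa using hN)⟩

theorem one_add_I_ne_zero : 1 + Complex.I ≠ 0 := fun h => by
  simpa using congrArg Complex.re h

theorem differentiableAt_shiftedZeta {k : ℕ} {s : ℂ} (hs : ∀ m : ℕ, s + k + m ≠ 1) :
    DifferentiableAt ℂ (shiftedZeta k) s := by
  obtain ⟨N, hN⟩ := exists_ball_mem_nhds s
  have h1 : DifferentiableAt ℂ (fun s : ℂ => (1 + Complex.I) ^ (-s)) s :=
    DifferentiableAt.const_cpow (by fun_prop) (Or.inl one_add_I_ne_zero)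
  have h2 : DifferentiableAt ℂ (fun s => ∑ m ∈ Finset.range (N + 2), shiftedZetaTerm k m s) s :=
    DifferentiableAt.fun_sum fun m _ => differentiableAt_shiftedZetaTerm (hs m)
  refine (h1.add (h2.add ((differentiableOn_shiftedZeta_tail k N).differentiableAt
    hN))).congr_of_eventuallyEq ?_
  filter_upwards [hN] with x hx
  exact shiftedZeta_eq_sum_add_tsum k N (mem_ball_zero_iff.1 hx).le

theorem meromorphicAt_shiftedZeta (k : ℕ) (s : ℂ) : MeromorphicAt (shiftedZeta k) s := by
  obtain ⟨N, hN⟩ := exists_ball_mem_nhds s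
  have h1 : MeromorphicAt (fun s : ℂ => (1 + Complex.I) ^ (-s)) s := by
    have : Differentiable ℂ fun s : ℂ => (1 + Complex.I) ^ (-s) := fun s =>
      DifferentiableAt.const_cpow (by fun_prop) (Or.inl one_add_I_ne_zero)
    exact (this.analyticAt s).meromorphicAt
  have h2 : MeromorphicAt (fun s => ∑ m ∈ Finset.range (N + 2), shiftedZetaTerm k m s) s :=
    MeromorphicAt.fun_sum fun m _ => meromorphicAt_shiftedZetaTerm k m s
  have h3 : MeromorphicAt (fun s => ∑' m : ℕ, shiftedZetaTerm k (m + (N + 2)) s) s :=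
    ((differentiableOn_shiftedZeta_tail k N).analyticAt hN).meromorphicAt
  refine (h1.add (h2.add h3)).congr (eventually_nhdsWithin_of_eventually_nhds ?_)
  filter_upwards [hN] with x hx
  exact (shiftedZeta_eq_sum_add_tsum k N (mem_ball_zero_iff.1 hx).le).symm

theorem natCast_add_I_cpow_neg {n : ℕ} (hn : n ≠ 0) (s : ℂ) :
    ((n : ℂ) + Complex.I) ^ (-s) = (1 + Complex.I / n) ^ (-s) * (n : ℂ) ^ (-s) := by
  have hn0 : (n : ℂ) ≠ 0 := Nat.cast_ne_zero.2 hn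
  have h0 : 1 + Complex.I / n ≠ 0 := fun h => by
    have := congrArg Complex.re h
    simp [Complex.div_natCast_re] at this
  have h := mul_ofReal_cpow h0 (y := n) (by positivity) (-s)
  rw [Complex.ofReal_natCast] at h
  rw [← h]
  congr 1
  field_simp

/-- Expand `(n + i) ^ (-s) = n ^ (-s) (1 + i/n) ^ (-s)` binomially and sum the absolutely convergent
double series over `n` first. The term `n = 1` stays apart, since `|i/n| = 1` is on the circle of
convergence; hence `ζ - 1` in the terms. -/
theorem hasSum_shiftedZeta {k : ℕ} {s : ℂ} (hs : 1 - (k : ℝ) < s.re) :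
    HasSum (fun n : ℕ => 1 / (((n + 1 : ℕ) : ℂ) ^ k *
      (((n + 1 : ℕ) : ℂ) + Complex.I) ^ s)) (shiftedZeta k s) := by
  set g : ℕ → ℕ → ℂ := fun n m => binomialCoeffNeg m s * Complex.I ^ m *
    (1 / ((n + 2 : ℕ) : ℂ) ^ (s + k + m)) with hg
  have hp : 1 < s.re + k := by linarith
  obtain ⟨N, hN⟩ := exists_nat_ge ‖s‖
  have hre : ∀ m : ℕ, s.re + k + m = (s + k + m).re := fun m => by simp
  have hsumm : Summable fun p : ℕ × ℕ => g p.1 p.2 := by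
    refine Summable.of_norm_bounded ((summable_nat_add_two_rpow_neg hp).mul_of_nonneg
      (summable_choose_mul_half_pow N) (fun n => by positivity) (fun m => by positivity))
      fun p => ?_
    rw [hg]
    simp only
    rw [norm_mul, norm_mul, norm_pow, Complex.norm_I, one_pow, mul_one]
    calc _ ≤ ((p.2 + N).choose N : ℝ) * (((p.1 + 2 : ℕ) : ℝ) ^ (-(s.re + k)) * (1 / 2) ^ p.2) := by
          gcongr
          · exact norm_binomialCoeffNeg_le hN _
          · exact norm_natCast_add_two_cpow_le p.1 p.2 (hre p.2).le
      _ = _ := by ring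
  have hrow : ∀ n : ℕ, HasSum (g n) (1 / (((n + 2 : ℕ) : ℂ) ^ k *
      (((n + 2 : ℕ) : ℂ) + Complex.I) ^ s)) := by
    intro n
    have hn0 : ((n + 2 : ℕ) : ℂ) ≠ 0 := Nat.cast_ne_zero.2 (by omega)
    have hx : ‖Complex.I / ((n + 2 : ℕ) : ℂ)‖ < 1 := by
      rw [norm_div, Complex.norm_I, Complex.norm_natCast, div_lt_one (by positivity)]
      push_cast
      linarith [(n.cast_nonneg : (0 : ℝ) ≤ n)]
    have h := (hasSum_one_add_cpow_neg s hx).mul_right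
      (((n + 2 : ℕ) : ℂ) ^ (-s) / ((n + 2 : ℕ) : ℂ) ^ k)
    have hval : 1 / (((n + 2 : ℕ) : ℂ) ^ k * (((n + 2 : ℕ) : ℂ) + Complex.I) ^ s) =
        (1 + Complex.I / ((n + 2 : ℕ) : ℂ)) ^ (-s) *
          (((n + 2 : ℕ) : ℂ) ^ (-s) / ((n + 2 : ℕ) : ℂ) ^ k) := by
      rw [one_div, mul_inv, ← Complex.cpow_neg, natCast_add_I_cpow_neg (by omega)]
      ring
    rw [hval]
    refine h.congr_fun fun m => ?_
    simp only [hg]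
    rw [Complex.cpow_add _ _ hn0, Complex.cpow_add _ _ hn0, Complex.cpow_natCast,
      Complex.cpow_natCast, Complex.cpow_neg, div_pow]
    field_simp
  have hcol : ∀ m : ℕ, HasSum (fun n => g n m) (shiftedZetaTerm k m s) := fun m =>
    (hasSum_riemannZeta_sub_one (x := s + k + m)
      (by rw [← hre]; linarith [(m.cast_nonneg : (0 : ℝ) ≤ m)])).mul_left _
  have h1 := hsumm.hasSum.prod_fiberwise hrow
  have h2 := hsumm.prod_symm.hasSum.prod_fiberwise hcol
  have h3 : ∑' p : ℕ × ℕ, g p.1 p.2 = ∑' m : ℕ, shiftedZetaTerm k m s := by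
    rw [h2.tsum_eq, ← (Equiv.prodComm ℕ ℕ).tsum_eq]
    rfl
  rw [h3] at h1
  -- Puts back the term `n = 1`, which is `(1 + i) ^ (-s)`.
  have h4 := (hasSum_nat_add_iff (f := fun n : ℕ => 1 / (((n + 1 : ℕ) : ℂ) ^ k *
    (((n + 1 : ℕ) : ℂ) + Complex.I) ^ s)) 1).1 (by simpa [add_assoc, one_add_one_eq_two] using h1)
  rw [shiftedZeta, add_comm, Complex.cpow_neg]
  simpa using h4

theorem hasBoundaryPMT_exp_I_mul_polylog {k : ℕ} (hk : 1 ≤ k) {z : ℂ}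
    (hz : 0 < (z + 1 / 2).re) :
    HasBoundaryPMT (fun u => Complex.exp (Complex.I * u) * polylog k (Complex.exp u)) z
      (pmtG z * shiftedZeta k (z + 1 / 2)) := by
  obtain ⟨S, hS, h⟩ := hasBoundaryPMT_exp_mul_periodicPolylog (c := fun _ => 1) (q := 1)
    le_rfl (fun n => rfl) (fun n => by simp) hk 1 hz
  have hk1 : (1 : ℝ) ≤ k := by exact_mod_cast hk
  have h1 := (hasSum_shiftedZeta (k := k) (s := z + 1 / 2) (by linarith)).mul_left (pmtG z)
  have hSeq : S = pmtG z * shiftedZeta k (z + 1 / 2) := by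
    refine hS.unique (h1.congr_fun fun n => ?_)
    rw [Complex.ofReal_one, one_mul, Complex.cpow_neg]
    ring
  rw [← hSeq]
  simpa [polylog] using h

theorem continuesTransform_exp_I_mul_polylog {k : ℕ} (hk : 1 ≤ k) :
    ContinuesTransform
      (HasBoundaryPMT (fun u => Complex.exp (Complex.I * u) * polylog k (Complex.exp u)))
      {z | 0 < (z + 1 / 2).re} {z | ∀ j : ℕ, (z + 1 / 2) ≠ 1 - k - j}
      (fun z => pmtG z * shiftedZeta k (z + 1 / 2)) := by
  have hk1 : (1 : ℝ) ≤ k := by exact_mod_cast hk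
  have hU : {z : ℂ | ∀ j : ℕ, (z + 1 / 2) ≠ 1 - k - j} =
      {z : ℂ | ∀ j : ℕ, ((k : ℂ) - 1 / 2) + z ≠ -j} := by
    ext z
    refine forall_congr' fun j => not_congr ⟨fun h => ?_, fun h => ?_⟩ <;> linear_combination h
  exact
  { isOpen_dom := isOpen_lt continuous_const (by fun_prop)
    nonempty_dom := ⟨0, by simp⟩
    subset := fun z hz j h => by
      have hz : 0 < (z + 1 / 2).re := hz
      rw [h] at hz
      simp at hz
      linarith [(j.cast_nonneg : (0 : ℝ) ≤ j)]
    isOpen := hU ▸ (isOpen_preconnected_ne_neg_nat _).1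
    isPreconnected := hU ▸ (isOpen_preconnected_ne_neg_nat _).2
    eq_transform := fun z hz => hasBoundaryPMT_exp_I_mul_polylog hk hz
    differentiableOn := fun z hz => DifferentiableAt.differentiableWithinAt
      ((differentiable_pmtG z).mul (DifferentiableAt.comp (g := shiftedZeta k)
        (f := fun z => z + 1 / 2) z
        (differentiableAt_shiftedZeta fun m h => hz m (by linear_combination h)) (by fun_prop))) }

theorem meromorphic_pmtG_mul_shiftedZeta (k : ℕ) :
    Meromorphic fun z => pmtG z * shiftedZeta k (z + 1 / 2) := fun z =>
  (differentiable_pmtG.analyticAt z).meromorphicAt.mul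
    ((meromorphicAt_shiftedZeta k (z + 1 / 2)).comp_analyticAt (g := fun z : ℂ => z + 1 / 2)
      (by fun_prop))

/-! ### Continuation of the rational transform -/

theorem continuesTransform_rational {σ : ℝ} (hσ : 0 < σ) (hσ1 : σ < 1) :
    ContinuesTransform (HasPMT σ (fun u => 1 / (1 - u))) {z | z.re < 1 / 2} univ
      (fun _ => (Real.pi : ℂ)) where
  isOpen_dom := isOpen_lt (by fun_prop) continuous_const
  nonempty_dom := ⟨0, by simp⟩
  subset := subset_univ _
  isOpen := isOpen_univ
  isPreconnected := isPreconnected_univ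
  eq_transform := fun _ hz => hasPMT_rational hσ hσ1 hz
  differentiableOn := differentiableOn_const _

/-! ### The dictionary -/

theorem mainTheorem8 :
    -- the function `G`
    ((∀ σ : ℝ, 0 < σ → ∀ z : ℂ, HasPMT σ Complex.exp z (pmtG z)) ∧
      (∀ z : ℂ, (∀ m : ℕ, z + 1 / 2 ≠ -m) →
        pmtG z = Complex.cos (Real.pi * z) * Complex.Gamma (z + 1 / 2)) ∧
      (∀ z : ℂ, pmtG z = Real.pi / Complex.Gamma (1 - (z + 1 / 2)))) ∧
    -- rational weight
    (∀ σ : ℝ, 0 < σ → σ < 1 →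
      ContinuesTransform (HasPMT σ (fun u => 1 / (1 - u))) {z | z.re < 1 / 2} univ
        (fun _ => (Real.pi : ℂ))) ∧
    -- scaled Gaussian
    (∀ α : ℂ, 0 < α.re → ∀ σ : ℝ, 0 < σ → ∀ z : ℂ,
      HasPMT σ (fun u => Complex.exp (α * u)) z (α ^ (-(z + 1 / 2)) * pmtG z)) ∧
    -- perturbed exponential
    (∀ l : ℂ, 0 < l.re → ∀ σ : ℝ, 0 < σ → ∀ z : ℂ,
      HasPMT σ (fun u => Complex.exp (u / 2 - l * u ^ (1 / 2 : ℂ))) z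
        ((√(2 * Real.pi) : ℂ) * Complex.exp (-l ^ 2 / 4) * parabolicCylinderD (2 * z) l)) ∧
    -- incomplete Gamma function
    (∀ ν l : ℂ, 0 < ν.re → 0 < l.re →
      ContinuesTransform (HasBoundaryPMT (fun u => upperGamma ν (-l * u)))
        {z | 0 < (z + 1 / 2).re} {z | ∀ m : ℕ, ν + (z + 1 / 2) ≠ -m}
        (fun z => pmtG z * l ^ (-(z + 1 / 2)) * (Complex.Gamma (ν + (z + 1 / 2)) /
          Complex.Gamma ((z + 1 / 2) + 1)))) ∧
    -- monomial
    (∀ k : ℕ, ∀ σ : ℝ, 0 < σ → ∀ z : ℂ,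
      HasPMT σ (fun u => u ^ k * Complex.exp u) z (pmtG (z + k))) ∧
    -- log-Gaussian
    ((∀ σ : ℝ, 0 < σ → ∀ z : ℂ, DifferentiableAt ℂ pmtG z ∧
        HasPMT σ (fun u => Complex.exp u * Complex.log u) z (deriv pmtG z)) ∧
      (∀ z : ℂ, Complex.cos (Real.pi * z) ≠ 0 →
        deriv pmtG z = pmtG z * (Complex.digamma (z + 1 / 2) -
          Real.pi * Complex.tan (Real.pi * z)))) ∧
    -- geometric weight
    (∀ σ : ℝ, 0 < σ → σ < √Real.pi → ∀ z : ℂ, HasPMT σ zetaWeight z (pmtR z) ∧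
      (z + 1 / 2 ≠ 1 → pmtR z = pmtG z * riemannZeta (z + 1 / 2))) ∧
    -- alternating weight
    (∀ σ : ℝ, 0 < σ → σ < √(Real.pi / 2) → ∀ z : ℂ, HasPMT σ etaWeight z (pmtD z) ∧
      pmtD z = pmtG z * dirichletEta (z + 1 / 2)) ∧
    -- Hurwitz weight
    (∀ a : ℝ, 0 < a → ∀ σ : ℝ, 0 < σ → σ < √Real.pi → ∀ z : ℂ,
      HasPMT σ (hurwitzWeight a) z (pmtRa z a) ∧
      (z + 1 / 2 ≠ 1 → pmtRa z a = pmtG z * hurwitzZetaPos (z + 1 / 2) a)) ∧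
    -- Dirichlet `L`-weight
    (∀ (q : ℕ) [NeZero q] (χ : DirichletCharacter ℂ q) (k : ℕ), 1 ≤ k →
      ContinuesTransform (HasBoundaryPMT (dirichletWeight χ k))
        {z | 0 < (z + 1 / 2).re} {z | (z + 1 / 2) + k ≠ 1 ∨ χ ≠ 1}
        (fun z => pmtG z * DirichletCharacter.LFunction χ ((z + 1 / 2) + k))) ∧
    -- Fresnel sine
    ((∀ σ : ℝ, 0 ≤ σ → ∀ z : ℂ, (0 < σ ∨ 0 < (z + 1 / 2).re) →
        HasAbelPMT σ Complex.sin z (-pmtG z * Complex.sin (Real.pi / 2 * (z + 1 / 2)))) ∧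
      (∀ z : ℂ, HasAbelBoundaryPMT Complex.sin z
        (-pmtG z * Complex.sin (Real.pi / 2 * (z + 1 / 2))))) ∧
    -- Fresnel cosine
    ((∀ σ : ℝ, 0 ≤ σ → ∀ z : ℂ, (0 < σ ∨ 0 < (z + 1 / 2).re) →
        HasAbelPMT σ Complex.cos z (pmtG z * Complex.cos (Real.pi / 2 * (z + 1 / 2)))) ∧
      (∀ z : ℂ, HasAbelBoundaryPMT Complex.cos z
        (pmtG z * Complex.cos (Real.pi / 2 * (z + 1 / 2))))) ∧
    -- polylogarithm
    (∀ k : ℕ, 1 ≤ k →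
      ContinuesTransform (HasBoundaryPMT (fun u => polylog k (Complex.exp u)))
        {z | 0 < (z + 1 / 2).re} {z | (z + 1 / 2) + k ≠ 1}
        (fun z => pmtG z * riemannZeta ((z + 1 / 2) + k)) ∧
      (∀ z : ℂ, (∀ j : ℕ, j < k → (z + 1 / 2) + j ≠ 0) →
        pmtG z * riemannZeta ((z + 1 / 2) + k) =
          pmtR (z + k) / ((-1) ^ k * ∏ j ∈ Finset.range k, ((z + 1 / 2) + j)))) ∧
    -- alternating polylogarithm
    (∀ k : ℕ, 1 ≤ k → ∀ z : ℂ,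
      HasBoundaryPMT (fun u => polylog k (-Complex.exp u)) z
        (-pmtG z * dirichletEta ((z + 1 / 2) + k))) ∧
    -- polylogarithm with a complex shift
    (∀ k : ℕ, 1 ≤ k → ∃ F : ℂ → ℂ, Meromorphic F ∧
      ContinuesTransform
        (HasBoundaryPMT (fun u => Complex.exp (Complex.I * u) * polylog k (Complex.exp u)))
        {z | 0 < (z + 1 / 2).re} {z | ∀ j : ℕ, (z + 1 / 2) ≠ 1 - k - j} F ∧
      (∀ z : ℂ, 1 - (k : ℝ) < (z + 1 / 2).re → ∃ S : ℂ,
        HasSum (fun n : ℕ => 1 / (((n + 1 : ℕ) : ℂ) ^ k *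
          (((n + 1 : ℕ) : ℂ) + Complex.I) ^ (z + 1 / 2))) S ∧ F z = pmtG z * S)) := by
  refine ⟨⟨fun σ hσ z => hasPMT_exp hσ z, fun z hz => pmtG_eq_cos_mul_Gamma hz,
      pmtG_eq_pi_div_Gamma⟩,
    fun σ hσ hσ1 => continuesTransform_rational hσ hσ1,
    fun α hα σ hσ z => hasPMT_exp_mul hα hσ z,
    fun l _ σ hσ z => hasPMT_perturbed hσ l z,
    fun ν l hν hl => continuesTransform_upperGamma hν hl,
    fun k σ hσ z => hasPMT_pow_mul_exp k hσ z,
    ⟨fun σ hσ z => ⟨differentiable_pmtG z, hasPMT_exp_mul_log hσ z⟩, fun z hz => deriv_pmtG hz⟩,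
    fun σ hσ hσπ z => ⟨hasPMT_zetaWeight hσ hσπ z, fun hz => pmtR_eq hz⟩,
    fun σ hσ hσπ z => ⟨hasPMT_etaWeight hσ hσπ z, pmtD_eq z⟩,
    fun a ha σ hσ hσπ z => ⟨hasPMT_hurwitzWeight ha hσ hσπ z, fun hz => pmtRa_eq ha hz⟩,
    fun q _ χ k hk => continuesTransform_dirichletWeight χ hk,
    ⟨fun σ hσ z h => ?_, fun z => ?_⟩, ⟨fun σ hσ z h => ?_, fun z => ?_⟩,
    fun k hk => ⟨continuesTransform_polylog hk, fun z hz => pmtG_mul_riemannZeta_add_natCast hk hz⟩,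
    fun k hk z => hasBoundaryPMT_polylog_neg hk z,
    -- The continuation is `G(z) shiftedZeta k s`, and the sum `S` is `shiftedZeta k s` itself, so
    -- the last equation is definitional.
    fun k hk => ⟨_, meromorphic_pmtG_mul_shiftedZeta k, continuesTransform_exp_I_mul_polylog hk,
      fun z hz => ⟨_, hasSum_shiftedZeta hz, rfl⟩⟩⟩
  · rw [← fresnel_sin_value, sin_eq_exp]
    exact hasAbelPMT_exp _ _ hσ h
  · rw [← fresnel_sin_value, sin_eq_exp]
    exact hasAbelBoundaryPMT_exp _ _ z
  · rw [← fresnel_cos_value, cos_eq_exp]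
    exact hasAbelPMT_exp _ _ hσ h
  · rw [← fresnel_cos_value, cos_eq_exp]
    exact hasAbelBoundaryPMT_exp _ _ z
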